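/- Let $k=\frac12$, let $\Gamma=\Gamma_0(4)$, and let $\nu=\nu_\theta$ be the theta multiplier, $\nu_\theta\begin{pmatrix}*&*\\c&d\end{pmatrix}=\left(\frac cd\right)\varepsilon_d^{-1}$ (Shimura's extension of the Jacobi symbol; $\varepsilon_d=1$ or $i$ as $d\equiv1$ or $3\bmod 4$). Represent the cusps of $\Gamma$ by $\infty,0,\frac12$, with scaling matrices $\sigma_\infty=I$, $\sigma_0=\begin{pmatrix}0&-\frac12\\2&0\end{pmatrix}$, $\sigma_{1/2}=\begin{pmatrix}1&-\frac12\\2&0\end{pmatrix}$; for a cusp $\mathfrak a$ define $\kappa_{\mathfrak a}\in[0,1)$ by $\nu(\sigma_{\mathfrak a}\begin{pmatrix}1&1\\0&1\end{pmatrix}\sigma_{\mathfrak a}^{-1})=e(-\kappa_{\mathfrak a})$, where $e(x)=e^{2\pi i x}$ (so $\kappa_\infty=\kappa_0=0$, $\kappa_{1/2}=\frac34$), and put $n_{\mathfrak a}=n-\kappa_{\mathfrak a}$. For $\gamma_1,\gamma_2\in\mathrm{SL}_2(\mathbb R)$ let $w(\gamma_1,\gamma_2)=j(\gamma_2,z)^{k}j(\gamma_1,\gamma_2z)^{k}j(\gamma_1\gamma_2,z)^{-k}$,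 with $j(\gamma,z)=\frac{cz+d}{|cz+d|}$ and principal powers. For cusps $\mathfrak a,\mathfrak b$ and integers $m,n$ let $$S_{\mathfrak a\mathfrak b}(m,n,c,\nu)=\sum_{\gamma=\begin{pmatrix}a&b\\c&d\end{pmatrix}\in\Gamma_\infty\backslash\sigma_{\mathfrak a}^{-1}\Gamma\sigma_{\mathfrak b}/\Gamma_\infty}\overline{\nu_{\mathfrak a\mathfrak b}(\gamma)}\,e\!\left(\frac{m_{\mathfrak a}a+n_{\mathfrak b}d}{c}\right),\qquad \nu_{\mathfrak a\mathfrak b}(\gamma)=\nu(\sigma_{\mathfrak a}\gamma\sigma_{\mathfrak b}^{-1})\frac{w(\sigma_{\mathfrak a}\gamma\sigma_{\mathfrak b}^{-1},\sigma_{\mathfrak b})}{w(\sigma_{\mathfrak a},\gamma)},$$ for $c$ in the set $\mathcal C(\mathfrak a,\mathfrak b)$ of positive lower left entries of elements of $\sigma_{\mathfrak a}^{-1}\Gamma\sigma_{\mathfrak b}$, and let $\phi_{\mathfrak a\mathfrak b}(n,s)$ be the meromorphic continuation in $s$ to $\mathbb C$ of $$\sum_{c\in\mathcal C(\mathfrak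 a,\mathfrak b)}\frac{S_{\mathfrak a\mathfrak b}(0,n,c,\nu)}{c^{2s}},$$ which converges absolutely for $\operatorname{Re}s$ sufficiently large (this is the $n$-th Fourier coefficient at $\mathfrak b$ of the Eisenstein series for $\mathfrak a$, without its archimedean factor). Let $m,n\equiv0,1\pmod 4$ be integers with $m=v^2d'$ and $n=w^2d$, where $v,w$ are positive integers and $d',d$ are fundamental discriminants ($1$ included), and let $\mathfrak a=0$ or $\frac12$ according to $n\equiv0$ or $1\pmod4$. Let $r\in\mathbb R$. Then the coefficients $\phi_{\mathfrak c\infty}(m,s)$, $\phi_{\mathfrak c\infty}(n,s)$, $\phi_{\mathfrak c\mathfrak a}(\frac n4+\kappa_{\mathfrak a},s)$, for $\mathfrak c\in\{\infty,0\}$, can be continued meromorphically to $\mathbb C$, are regular at $s=\frac12+ir$, and $$\sum_{\mathfrak c\in\{\infty,0\}}\overline{\phi_{\mathfrak c\infty}(m,\tfrac12+ir)}\left(\phi_{\mathfrak c\infty}(n,\tfrac12+ir)+\frac{1+i}{2\cdot4^{ir}}\,\phi_{\mathfrak c\mathfrak a}\Big(\frac n4+\kappa_{\mathfrak a},\tfrac12+ir\Big)\right)=\frac{L(\frac12-2ir,\chi_{d'})L(\frac12+2ir,\chi_d)}{2|\zeta(1+4ir)|^2}\left(\frac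 vw\right)^{2ir}\mathfrak S_{d'}(v,2ir)\,\mathfrak S_d(w,2ir),$$ where $\chi_d=\left(\frac d\cdot\right)$ is the Kronecker symbol, $\mathfrak S_d(w,s)=\sum_{\ell\mid w}\mu(\ell)\chi_d(\ell)\tau_s(w/\ell)\ell^{-1/2}$, $\tau_s(\ell)=\sum_{ab=\ell}(a/b)^s$, and for $r=0$ the right-hand side is read as $0$ (because of the pole of $\zeta$ at $1$). -/

import Mathlib

open scoped MatrixGroups

namespace EisPlus

/-! Weight `1/2`, the theta multiplier, the group `Γ₀(4)`. -/

/-- `e(x) = exp(2πix)`. -/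
noncomputable def e (x : ℝ) : ℂ := Complex.exp (2 * Real.pi * Complex.I * x)

/-- The extension of the Jacobi symbol `(c/d)` to all odd `d` in the convention of Shimura:
`(c/d) = (c/|d|)`, with an additional sign when both `c` and `d` are negative;
`(0/±1) = 1`. -/
def shimuraSymbol (c d : ℤ) : ℤ :=
  if c < 0 ∧ d < 0 then -jacobiSym c d.natAbs else jacobiSym c d.natAbs

/-- `ε_d` for odd `d`. -/
noncomputable def eps (d : ℤ) : ℂ := if d % 4 = 1 then 1 else Complex.I

/-- The theta multiplier on `Γ₀(4)`. -/
noncomputable def nuTheta (A : SL(2, ℤ)) : ℂ :=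
  (shimuraSymbol (A 1 0) (A 1 1) : ℂ) * (eps (A 1 1))⁻¹

/-- The Möbius action on complex numbers. -/
noncomputable def act (g : SL(2, ℝ)) (z : ℂ) : ℂ :=
  ((g 0 0 : ℂ) * z + (g 0 1 : ℂ)) / ((g 1 0 : ℂ) * z + (g 1 1 : ℂ))

/-- The automorphy factor `j(γ, z) = (cz + d) / |cz + d|`. -/
noncomputable def autoJ (g : SL(2, ℝ)) (z : ℂ) : ℂ :=
  ((g 1 0 : ℂ) * z + (g 1 1 : ℂ)) / (‖(g 1 0 : ℂ) * z + (g 1 1 : ℂ)‖ : ℂ)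

/-- The factor `w(γ₁, γ₂) = j(γ₂, z)^k j(γ₁, γ₂ z)^k j(γ₁ γ₂, z)^{-k}` for `k = 1/2`, with
principal powers. It does not depend on the point `z` of the upper half-plane; here `z = i`. -/
noncomputable def cocycleW (g₁ g₂ : SL(2, ℝ)) : ℂ :=
  autoJ g₂ Complex.I ^ (1 / 2 : ℂ) * autoJ g₁ (act g₂ Complex.I) ^ (1 / 2 : ℂ) *
    autoJ (g₁ * g₂) Complex.I ^ (-(1 / 2) : ℂ)

/-- Representatives `∞`, `0`, `1/2` of the cusps of `Γ₀(4)`. -/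
inductive Cusp where
  | infinity
  | zero
  | half
  deriving DecidableEq

/-- The scaling matrices. -/
noncomputable def scaling : Cusp → SL(2, ℝ)
  | .infinity => 1
  | .zero => ⟨!![0, -(1 / 2); 2, 0], by simp [Matrix.det_fin_two]⟩
  | .half => ⟨!![1, -(1 / 2); 2, 0], by simp [Matrix.det_fin_two]⟩

/-- The inclusion of `SL₂(ℤ)` in `SL₂(ℝ)`. -/
def toReal (A : SL(2, ℤ)) : SL(2, ℝ) :=
  Matrix.SpecialLinearGroup.map (Int.castRingHom ℝ) A

/-- The cusp parameter `κ_𝔞` of the theta multiplier; see `kappa_spec`. -/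
noncomputable def kappa : Cusp → ℝ
  | .infinity => 0
  | .zero => 0
  | .half => 3 / 4

/-- The generator `σ_𝔞 (1 1; 0 1) σ_𝔞⁻¹` of the stabilizer (up to sign) of the cusp `𝔞`. -/
def stabGen : Cusp → SL(2, ℤ)
  | .infinity => ⟨!![1, 1; 0, 1], by simp [Matrix.det_fin_two]⟩
  | .zero => ⟨!![1, 0; -4, 1], by simp [Matrix.det_fin_two]⟩
  | .half => ⟨!![-1, 1; -4, 3], by simp [Matrix.det_fin_two]⟩

theorem stabGen_mem (a : Cusp) : stabGen a ∈ CongruenceSubgroup.Gamma0 4 := by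
  rw [CongruenceSubgroup.Gamma0_mem]
  cases a <;> simp only [stabGen] <;> decide

theorem stabGen_eq (a : Cusp) :
    toReal (stabGen a) = scaling a * toReal (stabGen .infinity) * (scaling a)⁻¹ := by
  rw [eq_mul_inv_iff_mul_eq]
  apply Subtype.ext
  simp only [toReal, Matrix.SpecialLinearGroup.coe_mul, Matrix.SpecialLinearGroup.map_apply_coe,
    RingHom.mapMatrix_apply]
  cases a <;> ext i j <;> fin_cases i <;> fin_cases j <;>
    simp [stabGen, scaling, Matrix.mul_apply, Fin.sum_univ_two] <;> norm_num

/-- The defining property of `κ_𝔞`. -/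
theorem kappa_spec (a : Cusp) :
    nuTheta (stabGen a) = e (-kappa a) ∧ 0 ≤ kappa a ∧ kappa a < 1 := by
  cases a
  · refine ⟨?_, by simp [kappa], by simp [kappa]⟩
    simp [nuTheta, stabGen, shimuraSymbol, eps, e, kappa]
  · refine ⟨?_, by simp [kappa], by simp [kappa]⟩
    simp [nuTheta, stabGen, shimuraSymbol, eps, e, kappa]
  · refine ⟨?_, by norm_num [kappa], by norm_num [kappa]⟩
    have h : jacobiSym (-4) 3 = -1 := by norm_num
    have h2 : Complex.exp (2 * Real.pi * Complex.I * ((-(3 / 4) : ℝ) : ℂ)) = Complex.I := by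
      have : (2 * Real.pi * Complex.I * ((-(3 / 4) : ℝ) : ℂ)) =
          (Real.pi / 2 : ℂ) * Complex.I - 2 * Real.pi * Complex.I := by
        push_cast; ring
      rw [this, Complex.exp_sub, Complex.exp_pi_div_two_mul_I, Complex.exp_two_pi_mul_I, div_one]
    simp [nuTheta, stabGen, shimuraSymbol, eps, e, kappa, h] at h2 ⊢
    exact h2.symm

/-- The matrix `σ_𝔞⁻¹ A σ_𝔟`. -/
noncomputable def conj (a b : Cusp) (A : SL(2, ℤ)) : SL(2, ℝ) :=
  (scaling a)⁻¹ * toReal A * scaling b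

/-- The set `C(𝔞, 𝔟)` of allowed moduli: the positive lower left entries of the elements of
`σ_𝔞⁻¹ Γ₀(4) σ_𝔟`. -/
def moduli (a b : Cusp) : Set ℝ :=
  {c | 0 < c ∧ ∃ A ∈ CongruenceSubgroup.Gamma0 4, conj a b A 1 0 = c}

/-- The matrices `A` in `Γ₀(4)` for which `σ_𝔞⁻¹ A σ_𝔟 = (α β; c δ)` has the given lower left
entry `c > 0` and `0 ≤ α < c`, `0 ≤ δ < c`. Since translations on the left and on the right move
`α` and `δ` by the multiples of `c`, and `α`, `c`, `δ` determine the matrix, these represent each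
double coset in `Γ_∞ \ σ_𝔞⁻¹ Γ₀(4) σ_𝔟 / Γ_∞` with lower left entry `±c` exactly once. -/
def cosetReps (a b : Cusp) (c : ℝ) : Set SL(2, ℤ) :=
  {A | A ∈ CongruenceSubgroup.Gamma0 4 ∧ conj a b A 1 0 = c ∧
    conj a b A 0 0 ∈ Set.Ico 0 c ∧ conj a b A 1 1 ∈ Set.Ico 0 c}

/-- `ν_𝔞𝔟(γ) = ν(σ_𝔞 γ σ_𝔟⁻¹) w(σ_𝔞 γ σ_𝔟⁻¹, σ_𝔟) / w(σ_𝔞, γ)`, at `γ = σ_𝔞⁻¹ A σ_𝔟`. -/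
noncomputable def nuPair (a b : Cusp) (A : SL(2, ℤ)) : ℂ :=
  nuTheta A * cocycleW (toReal A) (scaling b) / cocycleW (scaling a) (conj a b A)

/-- The Kloosterman sum `S_𝔞𝔟(x, y, c, ν_θ)`; the indices `x`, `y` are integers (typed as real
numbers), and `x_𝔞 = x - κ_𝔞`, `y_𝔟 = y - κ_𝔟`. -/
noncomputable def kloosterman (a b : Cusp) (x y c : ℝ) : ℂ :=
  ∑ᶠ A ∈ cosetReps a b c, (starRingEnd ℂ) (nuPair a b A) *
    e (((x - kappa a) * conj a b A 0 0 + (y - kappa b) * conj a b A 1 1) / c)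

/-- `g` is the meromorphic continuation to `ℂ`, normalized at its singularities, of the
series `∑_{c ∈ C(𝔞, 𝔟)} S_𝔞𝔟(0, y, c, ν_θ) c^{-2s}`, which converges absolutely on some right
half-plane. -/
def IsContinuation (a b : Cusp) (y : ℝ) (g : ℂ → ℂ) : Prop :=
  MeromorphicNFOn g Set.univ ∧
    ∃ σ : ℝ, ∀ s : ℂ, σ < s.re →
      HasSum (fun c : moduli a b => kloosterman a b 0 y c / ((c : ℝ) : ℂ) ^ (2 * s)) (g s)

open Classical in
/-- The Eisenstein coefficient `φ_𝔞𝔟(y, s)`: the meromorphic continuation of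
`∑_{c ∈ C(𝔞, 𝔟)} S_𝔞𝔟(0, y, c, ν_θ) c^{-2s}` (and `0` if there were none). -/
noncomputable def phi (a b : Cusp) (y : ℝ) : ℂ → ℂ :=
  if h : ∃ g, IsContinuation a b y g then h.choose else 0

/-- Fundamental discriminants, including `1`. -/
def IsFundamentalDiscriminant (d : ℤ) : Prop :=
  (d % 4 = 1 ∧ Squarefree d) ∨
    ∃ t : ℤ, d = 4 * t ∧ (t % 4 = 2 ∨ t % 4 = 3) ∧ Squarefree t

/-- The Kronecker symbol `(d/p)` at a prime `p`. -/
def kroneckerPrime (d : ℤ) (p : ℕ) : ℤ :=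
  if p = 2 then
    (if d % 2 = 0 then 0 else if d % 8 = 1 ∨ d % 8 = 7 then 1 else -1)
  else jacobiSym d p

/-- The Kronecker symbol `χ_d(n) = (d/n)` for natural numbers `n`. -/
def kronecker (d : ℤ) (n : ℕ) : ℤ :=
  if n = 0 then (if d.natAbs = 1 then 1 else 0)
  else (n.primeFactorsList.map (kroneckerPrime d)).prod

/-- The analytically continued Dirichlet `L`-function `L(s, χ_d)`, where `d` is a fundamental
discriminant, so that `χ_d` is periodic modulo `|d|`. -/
noncomputable def dirichletL (d : ℤ) (s : ℂ) : ℂ :=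
  if h : d = 0 then 0
  else
    haveI : NeZero d.natAbs := ⟨Int.natAbs_ne_zero.mpr h⟩
    ZMod.LFunction (fun x : ZMod d.natAbs => (kronecker d x.val : ℂ)) s

/-- `τ_s(ℓ) = ∑_{ab = ℓ} (a/b)^s`. -/
noncomputable def tau (s : ℂ) (l : ℕ) : ℂ :=
  ∑ p ∈ l.divisorsAntidiagonal, ((p.1 : ℂ) / (p.2 : ℂ)) ^ s

/-- `𝔖_d(w, s) = ∑_{ℓ ∣ w} μ(ℓ) χ_d(ℓ) τ_s(w/ℓ) / √ℓ`. -/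
noncomputable def frakS (d : ℤ) (w : ℕ) (s : ℂ) : ℂ :=
  ∑ l ∈ w.divisors,
    (ArithmeticFunction.moebius l : ℂ) * (kronecker d l : ℂ) * tau s (w / l) / (Real.sqrt l : ℂ)

/-- The cusp `0` or `1/2` according to `n ≡ 0` or `1` modulo `4`. -/
def cuspOf (n : ℤ) : Cusp := if n % 4 = 0 then .zero else .half

end EisPlus

/-!
# Eisenstein coefficients of weight `1/2` and products of two central `L`-values

Both sides are computed explicitly. Write `Y = 4^{-s}` and let `f` run over odd positive integers.

*Kloosterman sums.* On the representatives of the double cosets fixed by `cosetReps` the cocycle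
factors in `nuPair` equal one, because the arguments of the factors `cz + d` add up without wrapping
around (`cocycleW_eq_one`, `nuPair_eq_nuTheta`). The sums are therefore finite sums of theta
multipliers against additive characters. Between equal cusps the moduli are `4k`, and for
`k = 2^i f` the sum factors by reciprocity into a Gauss sum modulo `2^(i+2)` and the normalized
Jacobi symbol Gauss sum `gauss n f` (`thetaSum_eq`). Between different cusps the moduli are `2f` and
the sum is a constant times `gauss n f` (`kloosterman_zero_infinity`, `kloosterman_infinity_zero`,
`kloosterman_infinity_half`, `kloosterman_zero_half`); this is quadratic reciprocity, with an
identity modulo `8` (`chi_eps_identity`) at the cusp `1/2`. Hence each of the six Dirichlet series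
is the series `∑ gauss n f · f^{-2s}`, for one of the two indices, times a polynomial in `Y`.

*The odd part.* The function `gauss n` is multiplicative, and its values at prime powers follow from
the quadratic Gauss sum including its sign (`sum_e_sq_div`), which is obtained by comparing both
sides of the Poisson summation formula for a Gaussian near a rational point. For `n = w² d` the
Euler product is `L(2s - 1/2, χ_d) / ζ(4s - 1)` without the factor at two, times a divisor
polynomial in the odd part of `w` (`tsum_oddGauss`). This gives the continuation `oddCont`, analytic
on `Re s ≥ 1/2` except possibly at `s = 3/4`, since `ζ` has no zero on `Re s ≥ 1`. By uniqueness of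
meromorphic continuation, `phi` agrees with the explicit functions there (`isContinuation_phi`).

*The factor at two.* For `n ≡ 0, 1 mod 4` the polynomial `twoSeries n` at the pair `(∞, ∞)` equals
`(1 + i) Y² (2 q_n - 1)` with `q_n = twoFactor n Y`. The second summand in the bracket has the
weight `(1 + i) Y` on the line `Re s = 1/2`, where `|Y| = 1/2`. Adding the contributions of `∞` and
`0`, everything cancels except `(1/2) · conj (D_m q_m) · D_n q_n`, where `D` is the odd part
(`combination_identity`). The number `q_n` is what completes the Euler product at two
(`twoFactor_mul`, `oddCont_mul_twoFactor`), so that `D_n q_n` is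
`L(2s - 1/2, χ_d) / ζ(4s - 1)` times the full divisor polynomial, which is `frakS` up to a power
of `w` (`squarePart_eq_frakS`). Complex conjugation of the factor with index `m`
(`dirichletL_conj`, `conj_frakS`) gives the right-hand side. At `r = 0` the continuation of `1 / ζ`
vanishes at `1`, and with it both sides.
-/

namespace EisPlus

/-! ### The exponential `e` and sums of periodic functions -/

lemma e_add (x y : ℝ) : e (x + y) = e x * e y := by
  simp only [e, ← Complex.exp_add]; congr 1; push_cast; ring

@[simp] lemma e_zero : e 0 = 1 := by simp [e]

lemma e_intCast (k : ℤ) : e k = 1 := by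
  rw [e, Complex.exp_eq_one_iff]; exact ⟨k, by push_cast; ring⟩

lemma e_add_intCast (x : ℝ) (k : ℤ) : e (x + k) = e x := by rw [e_add, e_intCast, mul_one]

lemma e_eq_of_sub_intCast {x y : ℝ} (k : ℤ) (h : x = y + k) : e x = e y := by
  rw [h, e_add_intCast]

lemma norm_e (x : ℝ) : ‖e x‖ = 1 := by
  rw [e, show (2 * Real.pi * Complex.I * x : ℂ) = ((2 * Real.pi * x : ℝ) : ℂ) * Complex.I by
    push_cast; ring, Complex.norm_exp_ofReal_mul_I]

lemma e_quarter : e (1 / 4) = Complex.I := by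
  rw [e, show (2 * Real.pi * Complex.I * ((1 / 4 : ℝ) : ℂ) : ℂ) = Real.pi / 2 * Complex.I by
    push_cast; ring, Complex.exp_pi_div_two_mul_I]

lemma e_half : e (1 / 2) = -1 := by
  rw [show (1 / 2 : ℝ) = 1 / 4 + 1 / 4 by norm_num, e_add, e_quarter, Complex.I_mul_I]

lemma e_pow (x : ℝ) (k : ℕ) : e x ^ k = e (k * x) := by
  rw [e, e, ← Complex.exp_nat_mul]; congr 1; push_cast; ring

lemma e_eq_one_iff (x : ℝ) : e x = 1 ↔ ∃ k : ℤ, x = k := by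
  rw [e, Complex.exp_eq_one_iff]
  refine exists_congr fun k => ?_
  rw [show (2 * Real.pi * Complex.I * x : ℂ) = x * (2 * Real.pi * Complex.I) by ring]
  rw [mul_left_inj' Complex.two_pi_I_ne_zero]
  exact_mod_cast Iff.rfl

lemma sum_e_mul_div (N : ℤ) {M : ℕ} (hM : 0 < M) :
    ∑ b ∈ Finset.range M, e (N * b / M) = if (M : ℤ) ∣ N then (M : ℂ) else 0 := by
  have hM' : (M : ℝ) ≠ 0 := by positivity
  have h : ∀ b ∈ Finset.range M, e (N * b / M) = e (N / M) ^ b := fun b _ => by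
    rw [e_pow]; congr 1; ring
  rw [Finset.sum_congr rfl h]
  have h1 : e (N / M) = 1 ↔ (M : ℤ) ∣ N := by
    rw [e_eq_one_iff]
    refine exists_congr fun k => ?_
    rw [div_eq_iff hM', mul_comm]
    exact_mod_cast Iff.rfl
  split_ifs with hd
  · simp [h1.2 hd]
  · rw [geom_sum_eq (mt h1.1 hd), e_pow, mul_div_cancel₀ _ hM', e_intCast, sub_self, zero_div]

lemma periodic_eq_of_modEq {F : ℤ → ℂ} {M : ℕ} (hF : ∀ x, F (x + M) = F x) {x y : ℤ}
    (h : x ≡ y [ZMOD M]) : F x = F y := by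
  obtain ⟨k, hk⟩ := h.dvd
  have hp : Function.Periodic F (M : ℤ) := hF
  have := hp.int_mul k x
  rw [show y = x + k * M by linarith [mul_comm k (M : ℤ)]]
  simpa using this.symm

lemma sum_range_eq_sum_zmod {F : ℤ → ℂ} {M : ℕ} [NeZero M] :
    ∑ b ∈ Finset.range M, F b = ∑ x : ZMod M, F (x.val : ℤ) := by
  refine Finset.sum_bij' (fun b _ => (b : ZMod M)) (fun x _ => x.val) ?_ ?_ ?_ ?_ ?_
  · simp
  · simp [ZMod.val_lt]
  · intro b hb; exact ZMod.val_cast_of_lt (Finset.mem_range.1 hb)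
  · simp
  · intro b hb; rw [ZMod.val_cast_of_lt (Finset.mem_range.1 hb)]

lemma sum_zmod_comp_cast {F : ℤ → ℂ} {M : ℕ} [NeZero M] (hF : ∀ x, F (x + M) = F x)
    (z : ℤ) : F ((z : ZMod M).val : ℤ) = F z := by
  apply periodic_eq_of_modEq hF
  rw [← ZMod.intCast_eq_intCast_iff]; simp

/-- A full period may be rescaled by a unit and translated. -/
lemma sum_range_periodic_affine {F : ℤ → ℂ} {M : ℕ} (hM : 0 < M) (hF : ∀ x, F (x + M) = F x)
    {u : ℤ} (hu : IsCoprime u M) (t : ℤ) :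
    ∑ b ∈ Finset.range M, F (u * b + t) = ∑ b ∈ Finset.range M, F b := by
  have : NeZero M := ⟨hM.ne'⟩
  obtain ⟨u', k, huk⟩ := hu
  have hinv : (u' : ZMod M) * u = 1 := by
    have := congrArg (fun x : ℤ => (x : ZMod M)) huk
    simpa using this
  rw [sum_range_eq_sum_zmod (F := fun b => F (u * b + t)), sum_range_eq_sum_zmod]
  refine Fintype.sum_equiv (⟨fun x => u * x + t, fun x => u' * (x - t), fun x => ?_, fun x => ?_⟩ :
    ZMod M ≃ ZMod M) _ _ fun x => ?_
  · simp [← mul_assoc, hinv]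
  · simp [← mul_assoc, mul_comm (u : ZMod M) u', hinv]
  · rw [← sum_zmod_comp_cast hF (u * x.val + t)]
    simp

/-- The Chinese remainder theorem for sums of a periodic function. -/
lemma sum_range_mul_of_coprime {F : ℤ → ℂ} {M N : ℕ} (hM : 0 < M) (hN : 0 < N)
    (h : M.Coprime N) (hF : ∀ x, F (x + (M * N : ℕ)) = F x) :
    ∑ x ∈ Finset.range (M * N), F x =
      ∑ a ∈ Finset.range M, ∑ b ∈ Finset.range N, F (a * N + b * M) := by
  rw [← Finset.sum_product']
  symm
  have hMN : 0 < M * N := Nat.mul_pos hM hN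
  refine Finset.sum_bij (fun p _ => (p.1 * N + p.2 * M) % (M * N)) ?_ ?_ ?_ ?_
  · intro p _; exact Finset.mem_range.2 (Nat.mod_lt _ hMN)
  · intro p hp q hq hpq
    simp only [Finset.mem_product, Finset.mem_range] at hp hq
    have h0 : p.1 * N + p.2 * M ≡ q.1 * N + q.2 * M [MOD M * N] := hpq
    have h1 : p.1 * N ≡ q.1 * N [MOD M] := by
      have := h0.of_mul_right N
      simpa [Nat.ModEq] using this
    have h2 : p.2 * M ≡ q.2 * M [MOD N] := by
      have := h0.of_mul_left M
      simpa [Nat.ModEq] using this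
    have h1' := Nat.ModEq.cancel_right_of_coprime (by simpa using h) h1
    have h2' := Nat.ModEq.cancel_right_of_coprime (by simpa using h.symm) h2
    exact Prod.ext (Nat.ModEq.eq_of_lt_of_lt h1' hp.1 hq.1) (Nat.ModEq.eq_of_lt_of_lt h2' hp.2 hq.2)
  · intro x hx
    have hx' := Finset.mem_range.1 hx
    have hu : IsCoprime (M : ℤ) N := Nat.isCoprime_iff_coprime.2 h
    have : NeZero M := ⟨hM.ne'⟩
    have : NeZero N := ⟨hN.ne'⟩
    let a : ZMod M := x * (N : ZMod M)⁻¹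
    let b : ZMod N := x * (M : ZMod N)⁻¹
    refine ⟨(a.val, b.val), by simp [ZMod.val_lt], ?_⟩
    have ha : a.val * N ≡ x [MOD M] := by
      rw [← ZMod.natCast_eq_natCast_iff]
      simp [a, mul_assoc, mul_comm (N : ZMod M)⁻¹, ZMod.coe_mul_inv_eq_one N h.symm]
    have hb : b.val * M ≡ x [MOD N] := by
      rw [← ZMod.natCast_eq_natCast_iff]
      simp [b, mul_assoc, mul_comm (M : ZMod N)⁻¹, ZMod.coe_mul_inv_eq_one M h]
    have : a.val * N + b.val * M ≡ x [MOD M * N] := by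
      rw [← Nat.modEq_and_modEq_iff_modEq_mul h]
      refine ⟨?_, ?_⟩
      · simpa [Nat.ModEq] using ha
      · simpa [Nat.ModEq] using hb
    exact Nat.ModEq.eq_of_lt_of_lt ((Nat.mod_modEq _ _).trans this) (Nat.mod_lt _ hMN) hx'
  · intro p _
    apply periodic_eq_of_modEq hF
    push_cast
    exact (Int.mod_modEq _ _).symm

lemma sum_range_mul_eq (F : ℕ → ℂ) {p M : ℕ} (hp : 0 < p) :
    ∑ x ∈ Finset.range (p * M), F x =
      ∑ a ∈ Finset.range p, ∑ b ∈ Finset.range M, F (a + p * b) := by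
  rw [← Finset.sum_product']
  refine Finset.sum_bij' (fun x _ => (x % p, x / p)) (fun q _ => q.1 + p * q.2) ?_ ?_ ?_ ?_ ?_
  · intro x hx
    have := Finset.mem_range.1 hx
    simp [Nat.mod_lt _ hp, Nat.div_lt_of_lt_mul this]
  · intro q hq
    simp only [Finset.mem_product, Finset.mem_range] at hq ⊢
    nlinarith
  · intro x _; exact Nat.mod_add_div x p
  · intro q hq
    simp only [Finset.mem_product, Finset.mem_range] at hq
    ext
    · simp [Nat.mod_eq_of_lt hq.1]
    · simp [Nat.add_mul_div_left _ _ hp, Nat.div_eq_of_lt hq.1]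
  · intro x _; rw [Nat.mod_add_div]

/-! ### The sign of the quadratic Gauss sum -/

open Filter Topology in
/-- The Gaussian factor is even and at most `exp (-π n²)` once `Re u ≥ 1`, so only the term
`n = 0` survives. -/
lemma tendsto_tsum_gaussian {α : Type*} {l : Filter α} {u : α → ℂ}
    (hu : Tendsto (fun i => (u i).re) l atTop) (x : ℝ) :
    Tendsto (fun i => ∑' n : ℤ, Complex.exp (-Real.pi * u i * n ^ 2) * e (n * x)) l (𝓝 1) := by
  have hs : Summable fun n : ℤ => Real.exp (-Real.pi * (n : ℝ) ^ 2) := by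
    have h := ((summable_jacobiTheta₂_term_iff 0 Complex.I).2 (by simp)).norm
    refine h.congr fun n => ?_
    rw [jacobiTheta₂_term, Complex.norm_exp]
    congr 1
    simp [pow_two, mul_assoc]
  have key : Tendsto (fun i => ∑' n : ℤ, Complex.exp (-Real.pi * u i * n ^ 2) * e (n * x)) l
      (𝓝 (∑' n : ℤ, if n = 0 then (1 : ℂ) else 0)) := by
    have hnorm : ∀ i (n : ℤ), ‖Complex.exp (-Real.pi * u i * n ^ 2) * e (n * x)‖ =
        Real.exp (-Real.pi * (n : ℝ) ^ 2 * (u i).re) := fun i n => by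
      rw [norm_mul, norm_e, mul_one, Complex.norm_exp]
      congr 1
      rw [show (-Real.pi * u i * n ^ 2 : ℂ) = ((-Real.pi * (n : ℝ) ^ 2 : ℝ) : ℂ) * u i by
        push_cast; ring, Complex.re_ofReal_mul]
    refine tendsto_tsum_of_dominated_convergence hs (fun n => ?_) ?_
    · rcases eq_or_ne n 0 with rfl | hn
      · simpa using tendsto_const_nhds
      · rw [if_neg hn, tendsto_zero_iff_norm_tendsto_zero]
        simp only [hnorm]
        refine Real.tendsto_exp_atBot.comp ?_
        refine hu.const_mul_atTop_of_neg ?_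
        have : (0 : ℝ) < (n : ℝ) ^ 2 := by positivity
        nlinarith [Real.pi_pos]
    · filter_upwards [hu.eventually_ge_atTop 1] with i hi n
      rw [hnorm]
      apply Real.exp_le_exp.2
      have : (0 : ℝ) ≤ Real.pi * (n : ℝ) ^ 2 := by positivity
      nlinarith
  simpa using key

lemma mul_ofReal_cpow_half {x : ℂ} (hx : x ≠ 0) {r : ℝ} (hr : 0 < r) :
    (x * r) ^ (1 / 2 : ℂ) = x ^ (1 / 2 : ℂ) * (Real.sqrt r : ℂ) := by
  have hr' : (r : ℂ) ≠ 0 := by exact_mod_cast hr.ne'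
  rw [Complex.cpow_def_of_ne_zero (mul_ne_zero hx hr'), Complex.cpow_def_of_ne_zero hx, mul_comm x,
    Complex.log_ofReal_mul hr hx, add_mul, Complex.exp_add, mul_comm, Real.sqrt_eq_rpow,
    Real.rpow_def_of_pos hr]
  push_cast
  rfl

/-- Poisson summation for a Gaussian along a residue class. -/
lemma tsum_gaussian_residue {τ : ℂ} (hτ : 0 < τ.re) {N : ℕ} (hN : 0 < N) (r : ℤ) :
    ∑' m : ℤ, Complex.exp (-Real.pi * τ * (r + N * m) ^ 2) =
      1 / (τ ^ (1 / 2 : ℂ) * N) *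
        ∑' n : ℤ, Complex.exp (-Real.pi * (1 / τ * (1 / (N : ℝ) ^ 2 : ℝ)) * n ^ 2) *
          e (n * (r / N)) := by
  have hN' : (N : ℂ) ≠ 0 := by exact_mod_cast hN.ne'
  have hτ0 : τ ≠ 0 := by rintro rfl; simp at hτ
  have ha : 0 < (τ * ((N : ℝ) ^ 2 : ℝ)).re := by
    rw [Complex.re_mul_ofReal]; positivity
  have h := Complex.tsum_exp_neg_quadratic ha (-τ * r * N)
  rw [mul_ofReal_cpow_half hτ0 (by positivity), Real.sqrt_sq (by positivity)] at h
  have h1 : ∀ m : ℤ, Complex.exp (-Real.pi * τ * (r + N * m) ^ 2) =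
      Complex.exp (-Real.pi * τ * r ^ 2) * Complex.exp (-Real.pi * (τ * ((N : ℝ) ^ 2 : ℝ)) * m ^ 2 +
        2 * Real.pi * (-τ * r * N) * m) := fun m => by
    rw [← Complex.exp_add]; congr 1; push_cast; ring
  have h2 : ∀ n : ℤ, Complex.exp (-Real.pi * (1 / τ * (1 / (N : ℝ) ^ 2 : ℝ)) * n ^ 2) *
          e (n * (r / N)) = Complex.exp (-Real.pi * τ * r ^ 2) *
      Complex.exp (-Real.pi / (τ * ((N : ℝ) ^ 2 : ℝ)) * (n + Complex.I * (-τ * r * N)) ^ 2) :=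
    fun n => by
    rw [e, ← Complex.exp_add, ← Complex.exp_add]; congr 1
    have hI := Complex.I_sq
    push_cast
    field_simp
    ring_nf
    rw [hI]; ring
  simp only [h1, h2, tsum_mul_left]
  rw [h]
  push_cast
  ring

lemma summable_gaussian {τ : ℂ} (hτ : 0 < τ.re) :
    Summable fun n : ℤ => Complex.exp (-Real.pi * τ * n ^ 2) := by
  refine ((summable_jacobiTheta₂_term_iff 0 (Complex.I * τ)).2 (by simpa using hτ)).congr
    fun n => ?_
  rw [jacobiTheta₂_term]
  congr 1
  linear_combination (Real.pi * n ^ 2 * τ : ℂ) * Complex.I_sq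

/-- A theta series with periodic coefficients, split into residue classes. -/
lemma tsum_periodic_gaussian {τ : ℂ} (hτ : 0 < τ.re) {N : ℕ} (hN : 0 < N) {c : ℤ → ℂ}
    (hc : ∀ n, c (n + N) = c n) :
    ∑' n : ℤ, c n * Complex.exp (-Real.pi * τ * n ^ 2) =
      ∑ r ∈ Finset.range N, c r * ∑' m : ℤ, Complex.exp (-Real.pi * τ * ((r : ℤ) + N * m) ^ 2) := by
  have : NeZero N := ⟨hN.ne'⟩
  have hper : ∀ (r : ℕ) (m : ℤ), c (r + N * m) = c r := fun r m =>
    periodic_eq_of_modEq hc (by simp [Int.ModEq])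
  have hbd : ∃ B, ∀ n, ‖c n‖ ≤ B := by
    refine ⟨∑ r ∈ Finset.range N, ‖c r‖, fun n => ?_⟩
    have h0 : 0 ≤ n % N := Int.emod_nonneg _ (by exact_mod_cast hN.ne')
    have hlt : n % N < N := Int.emod_lt_of_pos _ (by exact_mod_cast hN)
    have h1 : c n = c ((n % N).toNat : ℤ) := by
      rw [Int.toNat_of_nonneg h0]
      exact periodic_eq_of_modEq hc (Int.mod_modEq _ _).symm
    rw [h1]
    refine Finset.single_le_sum (f := fun r : ℕ => ‖c r‖) (fun _ _ => norm_nonneg _) ?_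
    rw [Finset.mem_range]; omega
  obtain ⟨B, hB⟩ := hbd
  have hs : Summable fun n : ℤ => c n * Complex.exp (-Real.pi * τ * n ^ 2) := by
    refine Summable.of_norm_bounded ((summable_gaussian hτ).norm.mul_left B) fun n => ?_
    rw [norm_mul]
    exact mul_le_mul_of_nonneg_right (hB n) (norm_nonneg _)
  rw [← (Int.divModEquiv N).symm.tsum_eq]
  have hs' := (Int.divModEquiv N).symm.summable_iff.2 hs
  have hs'' := (Equiv.prodComm (Fin N) ℤ).summable_iff.2 hs'
  rw [← (Equiv.prodComm (Fin N) ℤ).tsum_eq]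
  refine (Summable.tsum_prod hs'').trans ?_
  rw [tsum_fintype, Finset.sum_range]
  refine Finset.sum_congr rfl fun r _ => ?_
  rw [← tsum_mul_left]
  refine tsum_congr fun m => ?_
  simp only [Function.comp_apply, Equiv.prodComm_apply, Prod.swap_prod_mk,
    Int.divModEquiv_symm_apply]
  rw [show m * (N : ℤ) + ((r : ℕ) : ℤ) = (r : ℕ) + N * m by ring, hper]
  push_cast
  ring_nf

open Filter Topology in
/-- The size of a theta series with periodic coefficients at the cusp `0`: `τ^{1/2}` times it
tends to the mean value of the coefficients. -/
lemma tendsto_theta_periodic {α : Type*} {l : Filter α} {τ : α → ℂ}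
    (hτ : ∀ᶠ i in l, 0 < (τ i).re) (hτ' : Tendsto (fun i => (1 / τ i).re) l atTop)
    {N : ℕ} (hN : 0 < N) {c : ℤ → ℂ} (hc : ∀ n, c (n + N) = c n) :
    Tendsto (fun i => (τ i) ^ (1 / 2 : ℂ) * ∑' n : ℤ, c n * Complex.exp (-Real.pi * τ i * n ^ 2)) l
      (𝓝 ((∑ r ∈ Finset.range N, c r) / N)) := by
  have hN' : (N : ℂ) ≠ 0 := by exact_mod_cast hN.ne'
  have hu : Tendsto (fun i => (1 / τ i * (1 / (N : ℝ) ^ 2 : ℝ)).re) l atTop := by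
    simp only [Complex.re_mul_ofReal]
    exact hτ'.atTop_mul_const (by positivity)
  have h := tendsto_finsetSum (Finset.range N) fun r _ =>
    ((tendsto_tsum_gaussian hu ((r : ℤ) / N)).const_mul (c r / N))
  have hlim : ∑ r ∈ Finset.range N, c r / N * 1 = (∑ r ∈ Finset.range N, c r) / N := by
    simp [Finset.sum_div]
  rw [hlim] at h
  refine h.congr' ?_
  filter_upwards [hτ] with i hi
  have hτ0 : τ i ≠ 0 := by intro h0; simp [h0] at hi
  have hτ1 : τ i ^ (1 / 2 : ℂ) ≠ 0 := by simp [Complex.cpow_eq_zero_iff, hτ0]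
  rw [tsum_periodic_gaussian hi hN hc, Finset.mul_sum]
  refine Finset.sum_congr rfl fun r _ => ?_
  rw [tsum_gaussian_residue hi hN]
  push_cast
  field_simp
  simp only [mul_comm, mul_div_assoc]

open Filter Topology in
/-- The Gauss sum of an odd modulus `p`, sign included. Poisson summation for the Gaussian with
parameter `a = -2i/p + t`, `t → 0⁺`, relates the theta series with coefficients `e(n²/p)` and
`e(-pn²/4)`; the second has period two. -/
theorem sum_e_sq_div {p : ℕ} (hp : Odd p) :
    ∑ b ∈ Finset.range p, e ((b : ℝ) ^ 2 / p) = eps p * (Real.sqrt p : ℂ) := by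
  have hp0 : 0 < p := hp.pos
  have hpR : (0 : ℝ) < p := by exact_mod_cast hp0
  have hpC : (p : ℂ) ≠ 0 := by exact_mod_cast hp0.ne'
  let c : ℤ → ℂ := fun n => e ((n : ℝ) ^ 2 / p)
  let c' : ℤ → ℂ := fun n => e (-(p * (n : ℝ) ^ 2 / 4))
  have hc : ∀ n, c (n + p) = c n := fun n =>
    e_eq_of_sub_intCast (2 * n + p) (by push_cast; field_simp; ring)
  have hc' : ∀ n, c' (n + 2) = c' n := fun n =>
    e_eq_of_sub_intCast (-(p * n + p)) (by push_cast; ring)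
  let a₀ : ℂ := -2 * Complex.I / p
  have ha₀ : a₀ ≠ 0 := by simp [a₀, hpC]
  let a : ℝ → ℂ := fun t => a₀ + t
  have hare : ∀ t, (a t).re = t := fun t => by
    simp [a, a₀, Complex.div_natCast_re]
  have haim : ∀ t, (a t).im = -2 / p := fun t => by
    simp [a, a₀, Complex.div_natCast_im]
  have ha : ∀ t, a t ≠ 0 := fun t h => by
    have := haim t
    rw [h, Complex.zero_im, eq_comm, div_eq_zero_iff] at this
    rcases this with h | h
    · norm_num at h
    · exact hpR.ne' h
  let κ : ℝ → ℂ := fun t => -1 / (a t * a₀)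
  have hκ : ∀ t, κ t ≠ 0 := fun t => by simp [κ, ha t, ha₀]
  let τ : ℝ → ℂ := fun t => κ t * t
  have hτ_eq : ∀ t, τ t = 1 / a t - 1 / a₀ := fun t => by
    have h1 := ha t
    simp only [τ, κ]
    field_simp
    simp only [a]; ring
  have ha₀inv : 1 / a₀ = p * Complex.I / 2 := by
    simp only [a₀]
    field_simp
    linear_combination (-1 : ℂ) * Complex.I_sq
  have hτre : ∀ t, 0 < t → 0 < (τ t).re := fun t ht => by
    rw [hτ_eq, ha₀inv, Complex.sub_re, one_div, Complex.inv_re, hare]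
    have : 0 < Complex.normSq (a t) := Complex.normSq_pos.2 (ha t)
    simp
    positivity
  have hτinv : ∀ t : ℝ, 0 < t → 1 / τ t = ((4 / p ^ 2 * t⁻¹ : ℝ) : ℂ) - a₀ := fun t ht => by
    have h1 := ha t
    have ht' : (t : ℂ) ≠ 0 := by exact_mod_cast ht.ne'
    have h2 : a₀ * a₀ = -4 / p ^ 2 := by
      simp only [a₀]; field_simp; linear_combination (4 : ℂ) * Complex.I_sq
    have h3 : 1 / τ t = -(a₀ * a₀) / t - a₀ := by
      simp only [τ, κ]; field_simp; simp only [a]; ring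
    rw [h3, h2]; push_cast; field_simp
  have hev : ∀ᶠ t : ℝ in 𝓝[>] 0, 0 < t := eventually_mem_nhdsWithin
  have h1 : Tendsto (fun t : ℝ => (t : ℂ) ^ (1 / 2 : ℂ) *
      ∑' n : ℤ, c n * Complex.exp (-Real.pi * t * n ^ 2)) (𝓝[>] 0)
      (𝓝 ((∑ r ∈ Finset.range p, c r) / p)) := by
    refine tendsto_theta_periodic (τ := fun t : ℝ => (t : ℂ)) ?_ ?_ hp0 hc
    · filter_upwards [hev] with t ht using by simpa using ht
    · refine tendsto_inv_nhdsGT_zero.congr fun t => ?_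
      rw [← Complex.ofReal_one, ← Complex.ofReal_div, Complex.ofReal_re, one_div]
  have h2 : Tendsto (fun t : ℝ => (τ t) ^ (1 / 2 : ℂ) *
      ∑' n : ℤ, c' n * Complex.exp (-Real.pi * τ t * n ^ 2)) (𝓝[>] 0)
      (𝓝 ((∑ r ∈ Finset.range 2, c' r) / (2 : ℕ))) := by
    refine tendsto_theta_periodic ?_ ?_ two_pos hc'
    · filter_upwards [hev] with t ht using hτre t ht
    · have : Tendsto (fun t : ℝ => 4 / p ^ 2 * t⁻¹) (𝓝[>] 0) atTop :=
        tendsto_inv_nhdsGT_zero.const_mul_atTop (by positivity)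
      refine (tendsto_atTop_add_const_right _ (-a₀.re) this).congr' ?_
      filter_upwards [hev] with t ht
      rw [hτinv t ht, Complex.sub_re, Complex.ofReal_re, sub_eq_add_neg]
  have hpoisson : ∀ t : ℝ, 0 < t → ∑' n : ℤ, c n * Complex.exp (-Real.pi * t * n ^ 2) =
      1 / a t ^ (1 / 2 : ℂ) * ∑' n : ℤ, c' n * Complex.exp (-Real.pi * τ t * n ^ 2) := by
    intro t ht
    have h := Complex.tsum_exp_neg_mul_int_sq (a := a t) (by rw [hare]; exact ht)
    have e1 : ∀ n : ℤ, c n * Complex.exp (-Real.pi * t * n ^ 2) =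
        Complex.exp (-Real.pi * a t * n ^ 2) := fun n => by
      simp only [c, e]
      rw [← Complex.exp_add]; congr 1
      simp only [a, a₀]; push_cast; field_simp; ring
    have e2 : ∀ n : ℤ, c' n * Complex.exp (-Real.pi * τ t * n ^ 2) =
        Complex.exp (-Real.pi / a t * n ^ 2) := fun n => by
      simp only [c', e]
      rw [← Complex.exp_add]; congr 1
      rw [hτ_eq, ha₀inv]; push_cast; ring
    simp only [e1, e2]
    exact h
  -- `a₀ = β²` and `-1 / a₀² = (p/2)²` fix both square roots in the limit
  let β : ℂ := (1 - Complex.I) / (Real.sqrt p : ℝ)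
  have hsq : ((Real.sqrt p : ℝ) : ℂ) ^ 2 = p := by
    rw [← Complex.ofReal_pow, Real.sq_sqrt hpR.le, Complex.ofReal_natCast]
  have hsq0 : ((Real.sqrt p : ℝ) : ℂ) ≠ 0 := by
    exact_mod_cast (Real.sqrt_pos.2 hpR).ne'
  have hβ : a₀ ^ (1 / 2 : ℂ) = β := by
    have : a₀ = β ^ 2 := by
      simp only [a₀, β, div_pow, hsq]
      congr 1
      linear_combination -Complex.I_sq
    rw [this, one_div]
    apply Complex.sq_cpow_two_inv
    simp only [β, Complex.div_ofReal_re]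
    simp
    exact hp0
  have hκ0 : κ 0 = ((p : ℂ) / 2) ^ 2 := by
    simp only [κ, a, a₀, Complex.ofReal_zero, add_zero]
    field_simp
    linear_combination (-1 : ℂ) * Complex.I_sq
  have hκ0' : κ 0 ^ (1 / 2 : ℂ) = p / 2 := by
    rw [hκ0, one_div]
    apply Complex.sq_cpow_two_inv
    simpa using hp0
  have hcont : Continuous a := by fun_prop
  have hca : Tendsto (fun t => a t ^ (1 / 2 : ℂ)) (𝓝[>] 0) (𝓝 β) := by
    have h0 : a 0 ∈ Complex.slitPlane := by
      right
      rw [haim]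
      exact (div_neg_of_neg_of_pos (by norm_num) hpR).ne
    have : ContinuousAt (fun t => a t ^ (1 / 2 : ℂ)) 0 :=
      hcont.continuousAt.cpow continuousAt_const h0
    have h := this.tendsto.mono_left (nhdsWithin_le_nhds (s := Set.Ioi 0))
    rwa [show a 0 = a₀ by simp [a], hβ] at h
  have hcκ : Tendsto (fun t => κ t ^ (1 / 2 : ℂ)) (𝓝[>] 0) (𝓝 (p / 2)) := by
    have h0 : κ 0 ∈ Complex.slitPlane := by
      left
      rw [hκ0, show ((p : ℂ) / 2) ^ 2 = (((p : ℝ) / 2) ^ 2 : ℝ) by push_cast; ring,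
        Complex.ofReal_re]
      positivity
    have hcκ : ContinuousAt κ 0 :=
      continuousAt_const.div (hcont.continuousAt.mul continuousAt_const) (mul_ne_zero (ha 0) ha₀)
    have : ContinuousAt (fun t => κ t ^ (1 / 2 : ℂ)) 0 := hcκ.cpow continuousAt_const h0
    have h := this.tendsto.mono_left (nhdsWithin_le_nhds (s := Set.Ioi 0))
    rwa [hκ0'] at h
  have hβ0 : β ≠ 0 := by
    rw [← hβ]; simp [Complex.cpow_eq_zero_iff, ha₀]
  have hmain : (∑ r ∈ Finset.range p, c r) / p * (β * (p / 2)) =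
      (∑ r ∈ Finset.range 2, c' r) / (2 : ℕ) := by
    refine tendsto_nhds_unique (h1.mul (hca.mul hcκ)) (h2.congr' ?_)
    filter_upwards [hev] with t ht
    have h3 : a t ^ (1 / 2 : ℂ) ≠ 0 := by simp [Complex.cpow_eq_zero_iff, ha t]
    have h4 : (t : ℂ) ^ (1 / 2 : ℂ) = (Real.sqrt t : ℂ) := by
      have := mul_ofReal_cpow_half one_ne_zero ht
      rwa [one_mul, Complex.one_cpow, one_mul] at this
    rw [hpoisson t ht, mul_ofReal_cpow_half (hκ t) ht, h4]
    field_simp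
  have hsum : (∑ r ∈ Finset.range p, c r) * (1 - Complex.I) =
      (1 + e (-(p / 4))) * (Real.sqrt p : ℝ) := by
    have h5 : ∑ r ∈ Finset.range 2, c' r = 1 + e (-(p / 4)) := by
      simp [Finset.sum_range_succ, c']
    rw [h5] at hmain
    simp only [β] at hmain
    push_cast at hmain
    field_simp at hmain
    rw [hmain, mul_comm]
  have hI : (1 - Complex.I) * (1 + Complex.I) = 2 := by
    linear_combination -Complex.I_sq
  have hI0 : (1 - Complex.I) ≠ 0 := left_ne_zero_of_mul (hI ▸ two_ne_zero)
  have hgoal : (∑ r ∈ Finset.range p, c r) = eps p * (Real.sqrt p : ℂ) := by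
    apply mul_right_cancel₀ hI0
    rw [hsum]
    have h6 : e (-(p / 4)) = if (p : ℤ) % 4 = 1 then -Complex.I else Complex.I := by
      have hodd := Nat.odd_iff.1 hp
      split_ifs with h
      · rw [e_eq_of_sub_intCast (y := 1 / 4 + 1 / 2) (-((p : ℤ) / 4) - 1), e_add, e_quarter,
          e_half]
        · ring
        · have h7 : (p : ℤ) = 4 * ((p : ℤ) / 4) + 1 := by omega
          have h8 : (p : ℝ) = 4 * (((p : ℤ) / 4 : ℤ) : ℝ) + 1 := by exact_mod_cast h7
          push_cast; linarith
      · rw [e_eq_of_sub_intCast (y := 1 / 4) (-((p : ℤ) / 4) - 1), e_quarter]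
        have h7 : (p : ℤ) = 4 * ((p : ℤ) / 4) + 3 := by omega
        have h8 : (p : ℝ) = 4 * (((p : ℤ) / 4 : ℤ) : ℝ) + 3 := by exact_mod_cast h7
        push_cast; linarith
    rw [h6, eps]
    split_ifs
    · ring
    · linear_combination (-(Real.sqrt p : ℂ)) * (-1 : ℂ) * Complex.I_sq
  simpa [c] using hgoal

/-! ### Gauss sums of odd modulus -/

lemma eps_congr {c d : ℤ} (h : c % 4 = d % 4) : eps c = eps d := by simp [eps, h]

lemma eps_ne_zero (d : ℤ) : eps d ≠ 0 := by rw [eps]; split_ifs <;> simp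

lemma norm_eps (d : ℤ) : ‖eps d‖ = 1 := by rw [eps]; split_ifs <;> simp

lemma eps_one : eps 1 = 1 := by simp [eps]

lemma norm_jacobiSym_le (a : ℤ) (b : ℕ) : ‖(jacobiSym a b : ℂ)‖ ≤ 1 := by
  rcases jacobiSym.trichotomy a b with h | h | h <;> simp [h]

/-- The Gauss sum `ε_f⁻¹ ∑_{b mod f} (b/f) e(nb/f)` for odd `f`. The factor `ε_f⁻¹` makes it
multiplicative in `f`. -/
noncomputable def gauss (n : ℤ) (f : ℕ) : ℂ :=
  (eps f)⁻¹ * ∑ b ∈ Finset.range f, (jacobiSym b f : ℂ) * e (n * b / f)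

lemma gauss_summand_periodic (n : ℤ) {f : ℕ} (hf : 0 < f) (x : ℤ) :
    (jacobiSym (x + f) f : ℂ) * e (n * (x + f : ℤ) / f) = (jacobiSym x f : ℂ) * e (n * x / f) := by
  have hf' : (f : ℝ) ≠ 0 := by positivity
  congr 1
  · rw [jacobiSym.mod_left' (Int.add_emod_right x f)]
  · exact e_eq_of_sub_intCast n (by push_cast; field_simp)

lemma gauss_one (n : ℤ) : gauss n 1 = 1 := by simp [gauss, eps_one]

lemma norm_gauss_le (n : ℤ) (f : ℕ) : ‖gauss n f‖ ≤ f := by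
  rw [gauss, norm_mul, norm_inv, norm_eps, inv_one, one_mul]
  refine (norm_sum_le _ _).trans ((Finset.sum_le_sum (g := fun _ => (1 : ℝ)) fun b _ => ?_).trans
    (by simp))
  rw [norm_mul, norm_e, mul_one]
  exact norm_jacobiSym_le _ _

/-- Quadratic reciprocity in terms of `ε`. -/
lemma eps_mul_reciprocity {a b : ℕ} (ha : Odd a) (hb : Odd b) (h : a.Coprime b) :
    (eps (a * b : ℕ))⁻¹ * ((jacobiSym a b : ℂ) * jacobiSym b a) = (eps a)⁻¹ * (eps b)⁻¹ := by
  have hsq : (jacobiSym b a : ℂ) * jacobiSym b a = 1 := by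
    have := jacobiSym.sq_one (a := (b : ℤ)) (b := a) (by simpa using h.symm)
    rw [← pow_two]; exact_mod_cast this
  have ha' := Nat.odd_iff.1 ha
  have hb' := Nat.odd_iff.1 hb
  have hcase : ∀ x : ℕ, x % 2 = 1 → x % 4 = 1 ∨ x % 4 = 3 := by omega
  have hmod : ((a * b : ℕ) : ℤ) % 4 = ((a : ℤ) % 4) * ((b : ℤ) % 4) % 4 := by
    push_cast; exact Int.mul_emod _ _ _
  rcases hcase a ha' with h1 | h1
  · rw [jacobiSym.quadratic_reciprocity_one_mod_four h1 hb, hsq]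
    have h1' : (a : ℤ) % 4 = 1 := by omega
    rw [eps_congr (c := (a * b : ℕ)) (d := b) (by rw [hmod, h1']; omega),
      eps_congr (c := a) (d := 1) (by omega), eps_one]
    ring
  · rcases hcase b hb' with h2 | h2
    · rw [jacobiSym.quadratic_reciprocity_one_mod_four' ha h2, hsq]
      have h2' : (b : ℤ) % 4 = 1 := by omega
      rw [eps_congr (c := (a * b : ℕ)) (d := a) (by rw [hmod, h2']; omega),
        eps_congr (c := b) (d := 1) (by omega), eps_one]
      ring
    · rw [jacobiSym.quadratic_reciprocity_three_mod_four h1 h2]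
      have h1' : (a : ℤ) % 4 = 3 := by omega
      have h2' : (b : ℤ) % 4 = 3 := by omega
      push_cast
      rw [neg_mul, hsq, eps_congr (c := a * b) (d := 1) (by
        have := hmod; rw [h1', h2'] at this; push_cast at this; omega), eps_one,
        eps_congr (c := a) (d := 3) (by omega), eps_congr (c := b) (d := 3) (by omega)]
      simp [eps]

/-- Multiplicativity. The Chinese remainder theorem produces the factor `(f/g)(g/f)`, which quadratic
reciprocity turns into the quotient of the normalizing factors `eps`. -/
lemma gauss_mul (n : ℤ) {f g : ℕ} (hf : Odd f) (hg : Odd g) (h : f.Coprime g) :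
    gauss n (f * g) = gauss n f * gauss n g := by
  have hf0 : (f : ℝ) ≠ 0 := by exact_mod_cast hf.pos.ne'
  have hg0 : (g : ℝ) ≠ 0 := by exact_mod_cast hg.pos.ne'
  have hNf : NeZero f := ⟨hf.pos.ne'⟩
  have hNg : NeZero g := ⟨hg.pos.ne'⟩
  have hcrt := sum_range_mul_of_coprime hf.pos hg.pos h
    (F := fun x : ℤ => (jacobiSym x (f * g) : ℂ) * e (n * x / (f * g : ℕ)))
    (fun x => gauss_summand_periodic n (Nat.mul_pos hf.pos hg.pos) x)
  have hterm : ∀ a b : ℕ, (jacobiSym ((a : ℤ) * g + b * f) (f * g) : ℂ) *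
      e (n * ((a : ℤ) * g + b * f : ℤ) / (f * g : ℕ)) =
      ((jacobiSym f g : ℂ) * jacobiSym g f) * (((jacobiSym a f : ℂ) * e (n * a / f)) *
        ((jacobiSym b g : ℂ) * e (n * b / g))) := by
    intro a b
    have h1 : jacobiSym ((a : ℤ) * g + b * f) f = jacobiSym a f * jacobiSym g f := by
      rw [← jacobiSym.mul_left]
      exact jacobiSym.mod_left' (Int.add_mul_emod_self_right _ _ _)
    have h2 : jacobiSym ((a : ℤ) * g + b * f) g = jacobiSym b g * jacobiSym f g := by
      rw [← jacobiSym.mul_left, add_comm]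
      exact jacobiSym.mod_left' (Int.add_mul_emod_self_right _ _ _)
    have h3 : e (n * ((a : ℤ) * g + b * f : ℤ) / (f * g : ℕ)) = e (n * a / f) * e (n * b / g) := by
      rw [← e_add]; congr 1; push_cast; field_simp
    rw [jacobiSym.mul_right, h1, h2, h3]
    push_cast
    ring
  have hcrt' : ∑ x ∈ Finset.range (f * g), (jacobiSym x (f * g) : ℂ) * e (n * x / (f * g : ℕ)) =
      ((jacobiSym f g : ℂ) * jacobiSym g f) *
        ((∑ a ∈ Finset.range f, (jacobiSym a f : ℂ) * e (n * a / f)) *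
          ∑ b ∈ Finset.range g, (jacobiSym b g : ℂ) * e (n * b / g)) := by
    rw [Finset.sum_mul_sum, Finset.mul_sum]
    simp only [Finset.mul_sum]
    simp only [hterm] at hcrt
    exact_mod_cast hcrt
  rw [gauss, hcrt', ← mul_assoc, eps_mul_reciprocity hf hg h, gauss, gauss]
  ring

/-- `(u/f) ∑_b (b/f) e(uNb/f) = ∑_b (b/f) e(Nb/f)` for `u` prime to `f`. -/
lemma sum_jacobi_rescale (N : ℤ) {f : ℕ} (hf : 0 < f) {u : ℤ} (hu : IsCoprime u f) :
    (jacobiSym u f : ℂ) * ∑ b ∈ Finset.range f, (jacobiSym b f : ℂ) * e ((N * u : ℤ) * b / f) =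
      ∑ b ∈ Finset.range f, (jacobiSym b f : ℂ) * e (N * b / f) := by
  have h := sum_range_periodic_affine (F := fun x : ℤ => (jacobiSym x f : ℂ) * e (N * x / f)) hf
    (fun x => gauss_summand_periodic N hf x) hu 0
  simp only [add_zero] at h
  rw [Finset.mul_sum]
  push_cast at h ⊢
  rw [← h]
  refine Finset.sum_congr rfl fun b _ => ?_
  rw [jacobiSym.mul_left, ← mul_assoc]
  push_cast
  congr 2
  ring

lemma gauss_four_mul (N : ℤ) {f : ℕ} (hf : Odd f) : gauss (4 * N) f = gauss N f := by
  have hu : IsCoprime (4 : ℤ) f := by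
    have : (4 : ℕ).Coprime f := Nat.Coprime.pow_left 2 (Nat.coprime_two_left.2 hf)
    exact_mod_cast Nat.isCoprime_iff_coprime.2 this
  rw [gauss, gauss, ← sum_jacobi_rescale N hf.pos hu, jacobiSym.at_four hf, mul_comm 4 N]
  simp

/-- Fibring `x ↦ x²` over its image, with fibres of size `1 + (b/p)`, reduces to the quadratic Gauss
sum. -/
lemma sum_jacobi_prime {p : ℕ} [Fact p.Prime] (hp : p ≠ 2) :
    ∑ b ∈ Finset.range p, (jacobiSym b p : ℂ) * e (b / p) = eps p * (Real.sqrt p : ℂ) := by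
  have hprime : p.Prime := Fact.out
  have hp0 : (p : ℝ) ≠ 0 := by exact_mod_cast hprime.ne_zero
  rw [← sum_e_sq_div (hprime.odd_of_ne_two hp)]
  have hper1 : ∀ x : ℤ, e ((x + p : ℤ) / p) = e (x / p) := fun x =>
    e_eq_of_sub_intCast 1 (by push_cast; field_simp)
  have h1 : ∑ b ∈ Finset.range p, e ((b : ℝ) ^ 2 / p) =
      ∑ x : ZMod p, e (((x ^ 2).val : ℤ) / p) := by
    have := sum_range_eq_sum_zmod (M := p) (F := fun x : ℤ => e ((x : ℝ) ^ 2 / p))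
    push_cast at this ⊢
    rw [this]
    refine Finset.sum_congr rfl fun x _ => ?_
    have h := sum_zmod_comp_cast (F := fun x : ℤ => e (x / p)) hper1 ((x.val : ℤ) ^ 2)
    push_cast at h
    rw [← h]
    simp
  have h2 : ∑ b ∈ Finset.range p, (jacobiSym b p : ℂ) * e (b / p) =
      ∑ x : ZMod p, (jacobiSym x.val p : ℂ) * e ((x.val : ℤ) / p) := by
    have := sum_range_eq_sum_zmod (M := p) (F := fun x : ℤ => (jacobiSym x p : ℂ) * e (x / p))
    push_cast at this ⊢
    exact this
  have h3 : ∑ x : ZMod p, e ((x.val : ℤ) / p) = 0 := by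
    have h := sum_e_mul_div 1 hprime.pos
    rw [if_neg (by exact_mod_cast hprime.one_lt.ne' ∘ Nat.dvd_one.1)] at h
    rw [← sum_range_eq_sum_zmod (M := p) (F := fun x : ℤ => e (x / p)), ← h]
    simp
  have h6 := Finset.sum_fiberwise Finset.univ (fun x : ZMod p => x ^ 2)
    (fun x => e (((x ^ 2).val : ℤ) / p))
  rw [h1, h2, ← h6, ← add_zero (∑ x : ZMod p, _ * _), ← h3, ← Finset.sum_add_distrib]
  refine Finset.sum_congr rfl fun b _ => ?_
  have hcard := legendreSym.card_sqrts p hp b.val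
  have hset : ({x : ZMod p | x ^ 2 = ((b.val : ℤ) : ZMod p)} : Set (ZMod p)).toFinset =
      Finset.univ.filter fun x : ZMod p => x ^ 2 = b := by
    ext x; simp
  rw [hset, jacobiSym.legendreSym.to_jacobiSym] at hcard
  have h4 : ∀ x ∈ Finset.univ.filter (fun x : ZMod p => x ^ 2 = b),
      e (((x ^ 2).val : ℤ) / p) = e ((b.val : ℤ) / p) := fun x hx => by
    rw [(Finset.mem_filter.1 hx).2]
  rw [Finset.sum_congr rfl h4, Finset.sum_const, nsmul_eq_mul]
  have h5 : ((Finset.univ.filter fun x : ZMod p => x ^ 2 = b).card : ℂ) = jacobiSym b.val p + 1 := by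
    exact_mod_cast hcard
  rw [h5]; ring

lemma sum_jacobi_prime_mul {p : ℕ} [Fact p.Prime] (hp : p ≠ 2) (N : ℤ) :
    ∑ b ∈ Finset.range p, (jacobiSym b p : ℂ) * e (N * b / p) =
      jacobiSym N p * (eps p * (Real.sqrt p : ℂ)) := by
  have hprime : p.Prime := Fact.out
  have hN0 : NeZero p := ⟨hprime.ne_zero⟩
  by_cases hN : (p : ℤ) ∣ N
  · obtain ⟨k, rfl⟩ := hN
    have h0 : jacobiSym (p * k) p = 0 := by
      rw [jacobiSym.eq_zero_iff_not_coprime]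
      simp [hprime.one_lt.ne']
    have h1 : ∀ b ∈ Finset.range p, (jacobiSym b p : ℂ) * e ((p * k : ℤ) * b / p) =
        (jacobiSym b p : ℂ) := fun b _ => by
      rw [e_eq_of_sub_intCast (y := 0) (k * b), e_zero, mul_one]
      push_cast
      have : (p : ℝ) ≠ 0 := by exact_mod_cast hprime.ne_zero
      field_simp; ring
    rw [Finset.sum_congr rfl h1, h0]
    have h2 := sum_range_eq_sum_zmod (M := p) (F := fun x : ℤ => (jacobiSym x p : ℂ))
    rw [h2, Int.cast_zero, zero_mul, ← Int.cast_sum]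
    have h3 := quadraticChar_sum_zero (F := ZMod p) (by rwa [ZMod.ringChar_zmod_n])
    rw [← Int.cast_zero, ← h3]
    congr 1
    refine Finset.sum_congr rfl fun x _ => ?_
    rw [← jacobiSym.legendreSym.to_jacobiSym, legendreSym]
    simp
  · have hu : IsCoprime N p := by
      rw [Int.isCoprime_iff_gcd_eq_one, Int.gcd_comm]
      exact (Int.isCoprime_iff_gcd_eq_one.1
        ((Nat.prime_iff_prime_int.1 hprime).coprime_iff_not_dvd.2 hN))
    have h := sum_jacobi_rescale 1 hprime.pos hu
    simp only [one_mul, Int.cast_one] at h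
    rw [← sum_jacobi_prime hp, ← h, ← mul_assoc, ← pow_two]
    have : (jacobiSym N p : ℂ) ^ 2 = 1 := by
      exact_mod_cast jacobiSym.sq_one (Int.isCoprime_iff_gcd_eq_one.1 hu)
    rw [this, one_mul]

lemma odd_sq_mod_four {p : ℤ} (hp : p % 2 = 1) (k : ℕ) : p ^ (2 * k) % 4 = 1 := by
  have h : p ^ 2 ≡ 1 [ZMOD 4] := by
    rcases (by omega : p % 4 = 1 ∨ p % 4 = 3) with h | h
    · exact (Int.ModEq.pow 2 (show p ≡ 1 [ZMOD 4] from h)).trans (by decide)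
    · exact (Int.ModEq.pow 2 (show p ≡ 3 [ZMOD 4] from h)).trans (by decide)
  have := h.pow k
  rw [← pow_mul, one_pow] at this
  exact this

/-- The Gauss sum of modulus `p^(k+1)` for an odd prime `p`. -/
lemma gauss_prime_pow {p : ℕ} (hprime : p.Prime) (hp : p ≠ 2) (N : ℤ) (k : ℕ) :
    gauss (p ^ k * N) (p ^ (k + 1)) = p ^ k *
      (if Even k then jacobiSym N p * (Real.sqrt p : ℂ) else (if (p : ℤ) ∣ N then p else 0) - 1) := by
  have hfact : Fact p.Prime := ⟨hprime⟩
  have hp0 : (p : ℝ) ≠ 0 := by exact_mod_cast hprime.ne_zero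
  have hodd : p % 2 = 1 := Nat.odd_iff.1 (hprime.odd_of_ne_two hp)
  have hoddZ : (p : ℤ) % 2 = 1 := by omega
  have h1 : ∑ b ∈ Finset.range (p ^ (k + 1)), (jacobiSym b (p ^ (k + 1)) : ℂ) *
      e ((p ^ k * N : ℤ) * b / (p ^ (k + 1) : ℕ)) =
      p ^ k * ∑ b ∈ Finset.range p, (jacobiSym b p : ℂ) ^ (k + 1) * e (N * b / p) := by
    rw [pow_succ', sum_range_mul_eq _ hprime.pos, Finset.mul_sum]
    refine Finset.sum_congr rfl fun a _ => ?_
    have h2 : ∀ b ∈ Finset.range (p ^ k), (jacobiSym ((a + p * b : ℕ) : ℤ) (p * p ^ k) : ℂ) *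
        e ((p ^ k * N : ℤ) * (a + p * b : ℕ) / (p * p ^ k : ℕ)) =
        (jacobiSym a p : ℂ) ^ (k + 1) * e (N * a / p) := fun b _ => by
      rw [← pow_succ', jacobiSym.pow_right, jacobiSym.mod_left' (a₂ := a) (by simp)]
      push_cast
      congr 1
      refine e_eq_of_sub_intCast (N * b) ?_
      push_cast
      rw [pow_succ]
      field_simp
    rw [Finset.sum_congr rfl h2]
    simp
  rw [gauss, h1]
  split_ifs with hk hd
  · obtain ⟨j, rfl⟩ := hk
    have h3 : ∀ b ∈ Finset.range p, (jacobiSym b p : ℂ) ^ (j + j + 1) * e (N * b / p) =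
        (jacobiSym b p : ℂ) * e (N * b / p) := fun b _ => by
      congr 1
      rcases jacobiSym.trichotomy b p with h | h | h <;> rw [h] <;> simp [← two_mul, pow_succ]
    rw [Finset.sum_congr rfl h3, sum_jacobi_prime_mul hp]
    have h4 : eps ((p ^ (j + j + 1) : ℕ) : ℤ) = eps p := by
      apply eps_congr
      push_cast
      rw [pow_succ, ← two_mul, Int.mul_emod, odd_sq_mod_four hoddZ, one_mul, Int.emod_emod]
    rw [h4]
    have := eps_ne_zero p
    field_simp
  all_goals
    obtain ⟨j, rfl⟩ := Nat.not_even_iff_odd.1 hk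
    have h3 : ∑ b ∈ Finset.range p, (jacobiSym b p : ℂ) ^ (2 * j + 1 + 1) * e (N * b / p) =
        (if (p : ℤ) ∣ N then (p : ℂ) else 0) - 1 := by
      rw [← sum_e_mul_div N hprime.pos, eq_sub_iff_add_eq]
      have h5 : ∀ b ∈ Finset.range p, (jacobiSym b p : ℂ) ^ (2 * j + 1 + 1) * e (N * b / p) =
          e (N * b / p) - if b = 0 then 1 else 0 := fun b hb => by
        split_ifs with h0
        · subst h0
          rw [Nat.cast_zero, jacobiSym.zero_left hprime.one_lt]; simp
        · have hcop : (b : ℤ).gcd p = 1 := by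
            rw [Int.gcd_natCast_natCast]
            exact Nat.Coprime.symm ((Nat.Prime.coprime_iff_not_dvd hprime).2 fun h =>
              (Nat.le_of_dvd (Nat.pos_of_ne_zero h0) h).not_gt (Finset.mem_range.1 hb))
          rw [sub_zero, show 2 * j + 1 + 1 = 2 * (j + 1) by ring, pow_mul]
          have : (jacobiSym b p : ℂ) ^ 2 = 1 := by exact_mod_cast jacobiSym.sq_one hcop
          rw [this, one_pow, one_mul]
      rw [Finset.sum_congr rfl h5, Finset.sum_sub_distrib, Finset.sum_ite_eq' (Finset.range p) 0,
        if_pos (Finset.mem_range.2 hprime.pos), sub_add_cancel]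
    rw [h3]
    have h4 : eps ((p ^ (2 * j + 1 + 1) : ℕ) : ℤ) = 1 := by
      rw [← eps_one]
      apply eps_congr
      push_cast
      rw [show 2 * j + 1 + 1 = 2 * (j + 1) by ring, odd_sq_mod_four hoddZ]
    rw [h4, inv_one, one_mul]
    simp [hd]

/-- The Gauss sum of modulus `p^(k+1)` vanishes unless `p^k ∣ n`. -/
lemma gauss_prime_pow_eq_zero {p : ℕ} (hprime : p.Prime) {n : ℤ} {k : ℕ}
    (h : ¬ (p : ℤ) ^ k ∣ n) : gauss n (p ^ (k + 1)) = 0 := by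
  have hp0 : (p : ℝ) ≠ 0 := by exact_mod_cast hprime.ne_zero
  rw [gauss, pow_succ', sum_range_mul_eq _ hprime.pos]
  apply mul_eq_zero_of_right
  refine Finset.sum_eq_zero fun a _ => ?_
  have h2 : ∀ b ∈ Finset.range (p ^ k), (jacobiSym ((a + p * b : ℕ) : ℤ) (p * p ^ k) : ℂ) *
      e (n * (a + p * b : ℕ) / (p * p ^ k : ℕ)) =
      (jacobiSym a p : ℂ) ^ (k + 1) * e (n * a / p ^ (k + 1)) * e (n * b / (p ^ k : ℕ)) :=
    fun b _ => by
    rw [← pow_succ', jacobiSym.pow_right, jacobiSym.mod_left' (a₂ := a) (by simp), mul_assoc,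
      ← e_add]
    push_cast
    congr 2
    rw [pow_succ]
    field_simp
  rw [Finset.sum_congr rfl h2, ← Finset.mul_sum, sum_e_mul_div n (pow_pos hprime.pos k), if_neg,
    mul_zero]
  exact_mod_cast h

/-! ### Gauss sums whose modulus is a power of two -/

/-- The Gauss sum `∑ (2^k/d) ε_d e(nd/2^k)` over odd `d` modulo `2^k`, for `k ≥ 2`. -/
noncomputable def gaussTwo (n : ℤ) (k : ℕ) : ℂ :=
  ∑ d ∈ (Finset.range (2 ^ k)).filter Odd,
    (jacobiSym 2 d : ℂ) ^ k * eps d * e (n * d / (2 ^ k : ℕ))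

lemma jacobiSym_two_add_eight_mul {a : ℕ} (ha : Odd a) (b : ℕ) :
    jacobiSym 2 (a + 8 * b) = jacobiSym 2 a := by
  have h : Odd (a + 8 * b) := by
    rw [Nat.odd_iff] at ha ⊢; omega
  rw [jacobiSym.at_two ha, jacobiSym.at_two h]
  congr 1
  push_cast
  rw [show (8 : ZMod 8) = 0 from rfl, zero_mul, add_zero]

/-- The sum over the odd residues modulo eight that `gaussTwo` reduces to. -/
noncomputable def gaussEight (ω : ℂ) (k : ℕ) : ℂ :=
  ω + (-1) ^ k * Complex.I * ω ^ 3 + (-1) ^ k * ω ^ 5 + Complex.I * ω ^ 7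

/-- Writing `d = a + 8b`, the symbols depend only on `a`, and the sum over `b` detects divisibility of
`n` by `2^j`. -/
lemma gaussTwo_add_three (n : ℤ) (j : ℕ) :
    gaussTwo n (j + 3) = gaussEight (e (n / 2 ^ (j + 3))) (j + 3) *
      if ((2 ^ j : ℕ) : ℤ) ∣ n then ((2 ^ j : ℕ) : ℂ) else 0 := by
  rw [gaussTwo, Finset.sum_filter, show (2 : ℕ) ^ (j + 3) = 8 * 2 ^ j by ring,
    sum_range_mul_eq _ (by norm_num), ← sum_e_mul_div n (by positivity)]
  have h : ∀ a ∈ Finset.range 8, ∑ b ∈ Finset.range (2 ^ j),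
      (if Odd (a + 8 * b) then (jacobiSym 2 (a + 8 * b) : ℂ) ^ (j + 3) *
        eps (a + 8 * b : ℕ) * e (n * (a + 8 * b : ℕ) / (8 * 2 ^ j : ℕ)) else 0) =
      (if Odd a then (jacobiSym 2 a : ℂ) ^ (j + 3) * eps a * e (n / 2 ^ (j + 3)) ^ a else 0) *
        ∑ b ∈ Finset.range (2 ^ j), e (n * b / (2 ^ j : ℕ)) := by
    intro a _
    rw [Finset.mul_sum]
    refine Finset.sum_congr rfl fun b _ => ?_
    have hiff : Odd (a + 8 * b) ↔ Odd a := by rw [Nat.odd_iff, Nat.odd_iff]; omega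
    simp only [hiff]
    split_ifs with ha
    · rw [jacobiSym_two_add_eight_mul ha, eps_congr (c := (a + 8 * b : ℕ)) (d := a) (by omega),
        e_pow, mul_assoc _ (e _) (e _), ← e_add]
      congr 2
      push_cast
      rw [pow_add]
      field_simp
      ring
    · simp
  rw [Finset.sum_congr rfl h, ← Finset.sum_mul]
  congr 1
  have h3 : jacobiSym 2 3 = -1 := by norm_num
  have h5 : jacobiSym 2 5 = -1 := by norm_num
  have h7 : jacobiSym 2 7 = 1 := by norm_num
  simp [Finset.sum_range_succ, h3, h5, h7, eps, gaussEight, show ¬ Odd 2 by decide,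
    show ¬ Odd 4 by decide, show ¬ Odd 6 by decide, show Odd 3 by decide,
    show Odd 5 by decide, show Odd 7 by decide]

lemma gaussTwo_eq_zero {n : ℤ} {j : ℕ} (h : ¬ (2 : ℤ) ^ j ∣ n) : gaussTwo n (j + 3) = 0 := by
  rw [gaussTwo_add_three, if_neg (by exact_mod_cast h), mul_zero]

lemma gaussTwo_two (n : ℤ) : gaussTwo n 2 = e (n / 4) + Complex.I * e (n / 4) ^ 3 := by
  have h3 : jacobiSym 2 3 = -1 := by norm_num
  have hf : (Finset.range (2 ^ 2)).filter Odd = {1, 3} := by decide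
  rw [gaussTwo, hf, Finset.sum_pair (by norm_num), h3, e_pow]
  simp only [jacobiSym.one_right, eps]
  norm_num
  congr 2
  ring

lemma e_quarter_of_mod {n : ℤ} {r : ℤ} (h : n % 4 = r) : e (n / 4) = e (r / 4) := by
  refine e_eq_of_sub_intCast (n / 4) ?_
  have : n = r + 4 * (n / 4) := by omega
  have h' : (n : ℝ) = r + 4 * ((n / 4 : ℤ) : ℝ) := by exact_mod_cast this
  rw [h']; ring

lemma e_eighth_sq (n : ℤ) : e (n / 8) ^ 2 = e (n / 4) := by
  rw [e_pow]; congr 1; push_cast; ring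

lemma e_int_quarter (n : ℤ) : e (n / 4) = Complex.I ^ (n % 4).toNat := by
  have h0 : 0 ≤ n % 4 := by omega
  rw [e_quarter_of_mod rfl, ← e_quarter, e_pow]
  congr 1
  have : ((n % 4 : ℤ) : ℝ) = ((n % 4).toNat : ℝ) := by
    exact_mod_cast (Int.toNat_of_nonneg h0).symm
  rw [this]; ring

/-- `gaussTwo n 2` is `1 + i` for `n ≡ 0, 1` and `-(1 + i)` for `n ≡ 2, 3` modulo four. -/
lemma gaussTwo_two_eq {n : ℤ} :
    gaussTwo n 2 = if n % 4 = 0 ∨ n % 4 = 1 then 1 + Complex.I else -(1 + Complex.I) := by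
  have hI := Complex.I_sq
  rw [gaussTwo_two, e_int_quarter]
  rcases (by omega : n % 4 = 0 ∨ n % 4 = 1 ∨ n % 4 = 2 ∨ n % 4 = 3) with h | h | h | h <;>
    simp [h, pow_succ] <;> ring_nf

/-- `gaussTwo n 3` is `4 e(n/8)` for `n ≡ 1` modulo four, and vanishes otherwise. -/
lemma gaussTwo_three_eq {n : ℤ} : gaussTwo n 3 = if n % 4 = 1 then 4 * e (n / 8) else 0 := by
  have hI := Complex.I_sq
  have h := gaussTwo_add_three n 0
  have hsq := e_eighth_sq n
  rw [e_int_quarter] at hsq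
  simp only [zero_add, pow_zero, Nat.cast_one, one_dvd, if_true, mul_one] at h
  rw [show (n : ℝ) / 2 ^ 3 = n / 8 by norm_num] at h
  rw [h, gaussEight]
  set ω := e (n / 8)
  have h3 : ω ^ 3 = ω * ω ^ 2 := by ring
  have h5 : ω ^ 5 = ω * (ω ^ 2) ^ 2 := by ring
  have h7 : ω ^ 7 = ω * (ω ^ 2) ^ 3 := by ring
  rw [h3, h5, h7, hsq]
  rcases (by omega : n % 4 = 0 ∨ n % 4 = 1 ∨ n % 4 = 2 ∨ n % 4 = 3) with h | h | h | h <;>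
    simp [h] <;> ring_nf <;> simp <;> ring

lemma gaussTwo_eq_zero_of_not_dvd {n : ℤ} (h : ¬ (4 : ℤ) ∣ n) (j : ℕ) : gaussTwo n (j + 4) = 0 := by
  rcases j with _ | j
  · by_cases h2 : (2 : ℤ) ∣ n
    · obtain ⟨N, rfl⟩ := h2
      rw [gaussTwo_add_three, gaussEight, show ((2 * N : ℤ) : ℝ) / 2 ^ (0 + 1 + 2 + 1) = N / 8 by
        push_cast; ring]
      apply mul_eq_zero_of_left
      have h4 : e (N / 8) ^ 4 = -1 := by
        rw [e_pow, ← e_half]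
        refine e_eq_of_sub_intCast (N / 2) ?_
        have : N = 1 + 2 * (N / 2) := by omega
        have h' : (N : ℝ) = 1 + 2 * ((N / 2 : ℤ) : ℝ) := by exact_mod_cast this
        rw [h']; push_cast; ring_nf
      norm_num
      linear_combination (e (N / 8) + Complex.I * e (N / 8) ^ 3) * h4
    · exact gaussTwo_eq_zero (j := 1) (by simpa using h2)
  · refine gaussTwo_eq_zero (j := j + 2) fun h' => h (dvd_trans ?_ h')
    exact ⟨2 ^ j, by ring⟩

/-- The recursion in the square part of `n` at two. -/
lemma gaussTwo_four_mul (N : ℤ) (k : ℕ) : gaussTwo (4 * N) (k + 4) = 4 * gaussTwo N (k + 2) := by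
  rcases k with _ | j
  · rw [gaussTwo_two, gaussTwo_add_three, gaussEight, if_pos (by norm_num; omega),
      show ((4 * N : ℤ) : ℝ) / 2 ^ (0 + 1 + 2 + 1) = N / 4 by push_cast; ring]
    have h4 : e (N / 4) ^ 4 = 1 := by
      rw [e_pow, ← e_intCast N]; congr 1; push_cast; ring
    norm_num
    linear_combination (2 * e (N / 4) + 2 * Complex.I * e (N / 4) ^ 3) * h4
  · rw [gaussTwo_add_three N j, show j + 1 + 4 = (j + 2) + 3 by ring, gaussTwo_add_three,
      show ((4 * N : ℤ) : ℝ) / 2 ^ (j + 2 + 3) = N / 2 ^ (j + 3) by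
        push_cast; rw [pow_add, pow_add, pow_add]; field_simp; ring]
    have h1 : ((2 ^ (j + 2) : ℕ) : ℤ) ∣ 4 * N ↔ ((2 ^ j : ℕ) : ℤ) ∣ N := by
      rw [show ((2 ^ (j + 2) : ℕ) : ℤ) = 4 * ((2 ^ j : ℕ) : ℤ) by push_cast; ring]
      exact mul_dvd_mul_iff_left (by norm_num)
    have h2 : gaussEight (e (N / 2 ^ (j + 3))) (j + 2 + 3) = gaussEight (e (N / 2 ^ (j + 3))) (j + 3) := by
      simp only [gaussEight, show j + 2 + 3 = (j + 3) + 2 by ring, pow_add (-1 : ℂ) (j + 3) 2]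
      norm_num
    simp only [h1, h2]
    split_ifs
    · push_cast; ring
    · simp

/-- The series `∑_{k ≥ 2} gaussTwo n k Y^k`, a polynomial in `Y` when `n ≠ 0`. -/
noncomputable def twoSeries (n : ℤ) (Y : ℂ) : ℂ :=
  ∑ k ∈ Finset.range (n.natAbs + 2), gaussTwo n (k + 2) * Y ^ (k + 2)

lemma hasSum_twoSeries {n : ℤ} (hn : n ≠ 0) (Y : ℂ) :
    HasSum (fun k => gaussTwo n (k + 2) * Y ^ (k + 2)) (twoSeries n Y) := by
  refine hasSum_sum_of_ne_finset_zero fun k hk => ?_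
  rw [Finset.mem_range, not_lt] at hk
  obtain ⟨j, rfl⟩ : ∃ j, k = j + 1 := ⟨k - 1, by omega⟩
  rw [gaussTwo_eq_zero (j := j), zero_mul]
  intro h
  have h1 : 2 ^ j ≤ n.natAbs := by
    have := Int.natAbs_dvd_natAbs.2 h
    rw [Int.natAbs_pow] at this
    exact Nat.le_of_dvd (Int.natAbs_pos.2 hn) this
  have := Nat.lt_two_pow_self (n := j)
  omega

lemma twoSeries_four_mul {N : ℤ} (hN : N ≠ 0) (Y : ℂ) :
    twoSeries (4 * N) Y = (1 + Complex.I) * Y ^ 2 + 4 * Y ^ 2 * twoSeries N Y := by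
  have h1 := hasSum_twoSeries (n := 4 * N) (by omega) Y
  have h2 := (hasSum_twoSeries hN Y).mul_left (4 * Y ^ 2)
  have h3 := (hasSum_nat_add_iff' 2).2 h1
  have h4 : ∀ k, gaussTwo (4 * N) (k + 2 + 2) * Y ^ (k + 2 + 2) =
      4 * Y ^ 2 * (gaussTwo N (k + 2) * Y ^ (k + 2)) := fun k => by
    rw [show k + 2 + 2 = k + 4 by ring, gaussTwo_four_mul]; ring
  simp only [h4] at h3
  have h5 := h3.unique h2
  rw [sub_eq_iff_eq_add] at h5
  rw [h5]
  simp [Finset.sum_range_succ, gaussTwo_two_eq, gaussTwo_three_eq]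
  ring

lemma twoSeries_of_not_dvd {n : ℤ} (hn : ¬ (4 : ℤ) ∣ n) (Y : ℂ) :
    twoSeries n Y = gaussTwo n 2 * Y ^ 2 + gaussTwo n 3 * Y ^ 3 := by
  have h1 := hasSum_twoSeries (n := n) (by rintro rfl; simp at hn) Y
  have h2 : HasSum (fun k => gaussTwo n (k + 2) * Y ^ (k + 2))
      (∑ k ∈ Finset.range 2, gaussTwo n (k + 2) * Y ^ (k + 2)) :=
    hasSum_sum_of_ne_finset_zero fun k hk => by
      obtain ⟨j, rfl⟩ : ∃ j, k = j + 2 := ⟨k - 2, by simp at hk; omega⟩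
      rw [show j + 2 + 2 = j + 4 by ring, gaussTwo_eq_zero_of_not_dvd hn, zero_mul]
  rw [h1.unique h2]
  simp [Finset.sum_range_succ]

/-- The factor at two of the plus space coefficient, as a function of `Y = 2^{-2s}`. -/
noncomputable def twoFactor (n : ℤ) (Y : ℂ) : ℂ :=
  if n % 4 = 0 then 1 + (1 - Complex.I) * twoSeries (n / 4) Y
  else 1 + (1 - Complex.I) * e (n / 8) * Y

lemma twoSeries_eq_twoFactor {n : ℤ} (hn : n ≠ 0) (h : n % 4 = 0 ∨ n % 4 = 1) (Y : ℂ) :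
    twoSeries n Y = (1 + Complex.I) * Y ^ 2 * (2 * twoFactor n Y - 1) := by
  have hI := Complex.I_sq
  rcases h with h | h
  · obtain ⟨N, rfl⟩ : (4 : ℤ) ∣ n := Int.dvd_of_emod_eq_zero h
    rw [twoSeries_four_mul (by omega), twoFactor, if_pos h, Int.mul_ediv_cancel_left _ (by norm_num)]
    linear_combination 2 * Y ^ 2 * twoSeries N Y * hI
  · rw [twoSeries_of_not_dvd (by omega), twoFactor, if_neg (by omega), gaussTwo_two_eq,
      gaussTwo_three_eq, if_pos (Or.inr h), if_pos h]
    linear_combination 2 * Y ^ 3 * e (n / 8) * hI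

lemma twoFactor_four_mul {N : ℤ} (hN : N ≠ 0) (h : N % 4 = 0 ∨ N % 4 = 1) (Y : ℂ) :
    twoFactor (4 * N) Y = 1 - 2 * Y ^ 2 + 4 * Y ^ 2 * twoFactor N Y := by
  have hI := Complex.I_sq
  rw [twoFactor, if_pos (by omega), Int.mul_ediv_cancel_left _ (by norm_num),
    twoSeries_eq_twoFactor hN h]
  linear_combination (-Y ^ 2 * (2 * twoFactor N Y - 1)) * hI

lemma twoFactor_four_mul' {N : ℤ} (h : N % 4 = 2 ∨ N % 4 = 3) (Y : ℂ) :
    twoFactor (4 * N) Y = 1 - 2 * Y ^ 2 := by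
  have hI := Complex.I_sq
  rw [twoFactor, if_pos (by omega), Int.mul_ediv_cancel_left _ (by norm_num),
    twoSeries_of_not_dvd (by omega), gaussTwo_two_eq, gaussTwo_three_eq, if_neg (by omega),
    if_neg (by omega)]
  linear_combination (Y ^ 2) * hI

/-! ### Local factors at odd primes -/

lemma hasSum_gauss_of_not_dvd {p : ℕ} (hprime : p.Prime) (hp : p ≠ 2) {n : ℤ} (h : ¬ (p : ℤ) ∣ n)
    (Y : ℂ) : HasSum (fun k => gauss n (p ^ k) * Y ^ k)
      (1 + (jacobiSym n p : ℂ) * (Real.sqrt p * Y)) := by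
  have h1 : HasSum (fun k => gauss n (p ^ k) * Y ^ k)
      (∑ k ∈ Finset.range 2, gauss n (p ^ k) * Y ^ k) :=
    hasSum_sum_of_ne_finset_zero fun k hk => by
      obtain ⟨j, rfl⟩ : ∃ j, k = (j + 1) + 1 := ⟨k - 2, by simp at hk; omega⟩
      rw [gauss_prime_pow_eq_zero hprime, zero_mul]
      exact fun h' => h ((dvd_pow_self _ (Nat.succ_ne_zero j)).trans h')
  convert h1 using 1
  have h2 := gauss_prime_pow hprime hp n 0
  simp only [pow_zero, one_mul, zero_add, pow_one, Even.zero, if_true] at h2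
  simp [Finset.sum_range_succ, gauss_one, h2, mul_assoc]

lemma hasSum_gauss_of_dvd {p : ℕ} (hprime : p.Prime) (hp : p ≠ 2) {n : ℤ} (h : (p : ℤ) ∣ n)
    (h' : ¬ (p : ℤ) ^ 2 ∣ n) (Y : ℂ) :
    HasSum (fun k => gauss n (p ^ k) * Y ^ k) (1 - p * Y ^ 2) := by
  have hfact : Fact p.Prime := ⟨hprime⟩
  have h1 : HasSum (fun k => gauss n (p ^ k) * Y ^ k)
      (∑ k ∈ Finset.range 3, gauss n (p ^ k) * Y ^ k) :=
    hasSum_sum_of_ne_finset_zero fun k hk => by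
      obtain ⟨j, rfl⟩ : ∃ j, k = (j + 2) + 1 := ⟨k - 3, by simp at hk; omega⟩
      rw [gauss_prime_pow_eq_zero hprime, zero_mul]
      exact fun h'' => h' ((pow_dvd_pow _ (by omega)).trans h'')
  convert h1 using 1
  have h2 := gauss_prime_pow hprime hp n 0
  simp only [pow_zero, one_mul, zero_add, pow_one, Even.zero, if_true] at h2
  obtain ⟨N, rfl⟩ := h
  have h3 := gauss_prime_pow hprime hp N 1
  have h4 : ¬ (p : ℤ) ∣ N := fun h => h' (by rw [pow_two]; exact mul_dvd_mul_left _ h)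
  have h0 : jacobiSym (p * N) p = 0 := by
    rw [jacobiSym.eq_zero_iff_not_coprime]
    simp [hprime.one_lt.ne']
  simp only [pow_one, Nat.not_even_one, if_false, h4, one_add_one_eq_two] at h3
  simp [Finset.sum_range_succ, gauss_one, h2, h3, h0]
  ring

/-- The local series at `p² N` in terms of that at `N`: from the third power of `p` on, the
coefficients are `p²` times those at `N` with exponent lowered by two. -/
lemma hasSum_gauss_sq_mul {p : ℕ} (hprime : p.Prime) (hp : p ≠ 2) {N : ℤ} {Y A : ℂ}
    (h : HasSum (fun k => gauss N (p ^ k) * Y ^ k) A) :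
    HasSum (fun k => gauss (p ^ 2 * N) (p ^ k) * Y ^ k)
      (1 - p * Y ^ 2 + (p : ℂ) ^ 2 * Y ^ 2 * A) := by
  have hfact : Fact p.Prime := ⟨hprime⟩
  have hpZ : (p : ℤ) ≠ 0 := by exact_mod_cast hprime.ne_zero
  have h1 := gauss_prime_pow hprime hp (p ^ 2 * N) 0
  have h2 := gauss_prime_pow hprime hp (p * N) 1
  have h0 : jacobiSym (p ^ 2 * N) p = 0 := by
    rw [jacobiSym.eq_zero_iff_not_coprime, pow_two, mul_assoc]
    simp [hprime.one_lt.ne']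
  rw [show (p : ℤ) ^ 1 * (p * N) = p ^ 2 * N by ring] at h2
  simp only [pow_zero, one_mul, zero_add, pow_one, Even.zero, if_true, h0, Int.cast_zero,
    zero_mul] at h1
  simp only [pow_one, Nat.not_even_one, if_false, dvd_mul_right, if_true, one_add_one_eq_two] at h2
  have h3 : ∀ k, gauss (p ^ 2 * N) (p ^ (k + 1 + 2)) = p ^ 2 * gauss N (p ^ (k + 1)) := by
    intro k
    by_cases hd : (p : ℤ) ^ k ∣ N
    · obtain ⟨M, rfl⟩ := hd
      rw [gauss_prime_pow hprime hp, show k + 1 + 2 = (k + 2) + 1 by ring,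
        show (p : ℤ) ^ 2 * (p ^ k * M) = p ^ (k + 2) * M by ring, gauss_prime_pow hprime hp]
      simp only [Nat.even_add, even_two, iff_true]
      ring
    · rw [gauss_prime_pow_eq_zero hprime hd, show k + 1 + 2 = (k + 2) + 1 by ring,
        gauss_prime_pow_eq_zero hprime, mul_zero]
      rw [pow_add, mul_comm]
      exact fun h' => hd ((mul_dvd_mul_iff_left (pow_ne_zero 2 hpZ)).1 h')
  set f : ℕ → ℂ := fun k => gauss (p ^ 2 * N) (p ^ k) * Y ^ k with hf
  have h4 : HasSum (fun k => f (k + 3)) ((p : ℂ) ^ 2 * Y ^ 2 * (A - 1)) := by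
    have h5 := ((hasSum_nat_add_iff' 1).2 h).mul_left ((p : ℂ) ^ 2 * Y ^ 2)
    simp only [Finset.sum_range_one, pow_zero, gauss_one, one_mul] at h5
    have h8 : ∀ k, f (k + 3) = (p : ℂ) ^ 2 * Y ^ 2 * (gauss N (p ^ (k + 1)) * Y ^ (k + 1)) :=
      fun k => by
        simp only [hf]
        rw [show k + 3 = k + 1 + 2 by ring, h3]; ring
    simp only [h8]
    exact h5
  have h6 := (hasSum_nat_add_iff (f := f) 3).1 h4
  have h7 : ∑ k ∈ Finset.range 3, f k = 1 + p * (p - 1) * Y ^ 2 := by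
    simp [hf, Finset.sum_range_succ, gauss_one, h1, h2]
  rw [h7] at h6
  rwa [show 1 - (p : ℂ) * Y ^ 2 + p ^ 2 * Y ^ 2 * A =
    p ^ 2 * Y ^ 2 * (A - 1) + (1 + p * (p - 1) * Y ^ 2) by ring]

/-- The local polynomials: `B_0 = 1`, `B_{j+1} = 1 - x + Q B_j`. For `x = χ(p) p^{-z}` and
`Q = p^{1-2z}` this is the value at `p^j` of `∑_{ℓ ∣ w} μ(ℓ) χ(ℓ) ℓ^{-z} σ_{1-2z}(w/ℓ)`. -/
noncomputable def localPoly (x Q : ℂ) : ℕ → ℂ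
  | 0 => 1
  | j + 1 => 1 - x + Q * localPoly x Q j

/-- The local factor at an odd prime `p` of the Dirichlet series of the Gauss sums, at
`n = p^{2j} n₀` with `p² ∤ n₀`. -/
lemma exists_hasSum_gauss {p : ℕ} (hprime : p.Prime) (hp : p ≠ 2) {n₀ : ℤ}
    (h : ¬ (p : ℤ) ^ 2 ∣ n₀) (Y : ℂ) (j : ℕ) :
    ∃ A, HasSum (fun k => gauss (p ^ (2 * j) * n₀) (p ^ k) * Y ^ k) A ∧
      A * (1 - (jacobiSym n₀ p : ℂ) * (Real.sqrt p * Y)) = (1 - p * Y ^ 2) *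
        localPoly ((jacobiSym n₀ p : ℂ) * (Real.sqrt p * Y)) ((p : ℂ) ^ 2 * Y ^ 2) j := by
  have hfact : Fact p.Prime := ⟨hprime⟩
  induction j with
  | zero =>
    simp only [mul_zero, pow_zero, one_mul, localPoly, mul_one]
    by_cases hd : (p : ℤ) ∣ n₀
    · refine ⟨_, hasSum_gauss_of_dvd hprime hp hd h Y, ?_⟩
      obtain ⟨N, rfl⟩ := hd
      have h0 : jacobiSym (p * N) p = 0 := by
        rw [jacobiSym.eq_zero_iff_not_coprime]
        simp [hprime.one_lt.ne']
      simp [h0]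
    · refine ⟨_, hasSum_gauss_of_not_dvd hprime hp hd Y, ?_⟩
      have hcop : n₀.gcd p = 1 := by
        rw [Int.gcd_comm]
        exact (Int.isCoprime_iff_gcd_eq_one.1
          ((Nat.prime_iff_prime_int.1 hprime).coprime_iff_not_dvd.2 hd))
      have h1 : (jacobiSym n₀ p : ℂ) ^ 2 = 1 := by exact_mod_cast jacobiSym.sq_one hcop
      have h2 : ((Real.sqrt p : ℝ) : ℂ) ^ 2 = p := by
        rw [← Complex.ofReal_pow, Real.sq_sqrt (by positivity), Complex.ofReal_natCast]
      linear_combination (-(Real.sqrt p : ℂ) ^ 2 * Y ^ 2) * h1 - Y ^ 2 * h2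
  | succ j ih =>
    obtain ⟨A, hA, hA'⟩ := ih
    refine ⟨1 - p * Y ^ 2 + (p : ℂ) ^ 2 * Y ^ 2 * A, ?_, ?_⟩
    · have := hasSum_gauss_sq_mul hprime hp hA
      rw [← mul_assoc, ← pow_add, show 2 + 2 * j = 2 * (j + 1) by ring] at this
      exact this
    · rw [localPoly]
      linear_combination ((p : ℂ) ^ 2 * Y ^ 2) * hA'

/-! ### The Kronecker symbol and its `L`-function -/

lemma kronecker_one (d : ℤ) : kronecker d 1 = 1 := by simp [kronecker]

lemma kronecker_prime (d : ℤ) {p : ℕ} (hp : p.Prime) : kronecker d p = kroneckerPrime d p := by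
  simp [kronecker, hp.ne_zero, Nat.primeFactorsList_prime hp]

lemma kronecker_mul (d : ℤ) {m n : ℕ} (hm : m ≠ 0) (hn : n ≠ 0) :
    kronecker d (m * n) = kronecker d m * kronecker d n := by
  simp only [kronecker, mul_eq_zero, hm, hn, or_self, if_false]
  rw [((Nat.perm_primeFactorsList_mul hm hn).map _).prod_eq, List.map_append, List.prod_append]

lemma kroneckerPrime_trichotomy (d : ℤ) (p : ℕ) :
    kroneckerPrime d p = 0 ∨ kroneckerPrime d p = 1 ∨ kroneckerPrime d p = -1 := by
  rw [kroneckerPrime]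
  split_ifs <;> simp [jacobiSym.trichotomy]

lemma norm_kronecker_le (d : ℤ) (n : ℕ) : ‖(kronecker d n : ℂ)‖ ≤ 1 := by
  induction n using Nat.recOnMul with
  | zero => simp only [kronecker, if_true]; split_ifs <;> simp
  | one => simp [kronecker_one]
  | prime p hp =>
    rw [kronecker_prime d hp]
    rcases kroneckerPrime_trichotomy d p with h | h | h <;> simp [h]
  | mul m n hm hn =>
    rcases eq_or_ne m 0 with rfl | hm0
    · simpa using hm
    rcases eq_or_ne n 0 with rfl | hn0
    · simpa using hn
    rw [kronecker_mul d hm0 hn0, Int.cast_mul, norm_mul]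
    exact mul_le_one₀ hm (norm_nonneg _) hn

/-- Quadratic reciprocity, supplementary laws included, in terms of the Kronecker symbol. -/
lemma kroneckerPrime_eq_jacobiSym {d : ℤ} (hd : d % 4 = 1) {p : ℕ} (hp : p.Prime) :
    kroneckerPrime d p = jacobiSym p d.natAbs := by
  have hodd : Odd d.natAbs := by rw [Nat.odd_iff]; omega
  rw [kroneckerPrime]
  split_ifs with h2 h h8
  · omega
  · subst h2
    rw [Nat.cast_ofNat, jacobiSym.at_two hodd, ZMod.χ₈_nat_eq_if_mod_eight, if_neg (by omega),
      if_pos (by omega)]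
  · subst h2
    rw [Nat.cast_ofNat, jacobiSym.at_two hodd, ZMod.χ₈_nat_eq_if_mod_eight, if_neg (by omega),
      if_neg (by omega)]
  · have hpo : Odd p := hp.odd_of_ne_two h2
    have hpo' := Nat.odd_iff.1 hpo
    rcases le_total 0 d with h0 | h0
    · conv_lhs => rw [← Int.natAbs_of_nonneg h0]
      exact jacobiSym.quadratic_reciprocity_one_mod_four (by omega) hpo
    · have hd' : d = -(d.natAbs : ℤ) := by omega
      have h3 : d.natAbs % 4 = 3 := by omega
      conv_lhs => rw [hd', jacobiSym.neg _ hpo]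
      rcases (by omega : p % 4 = 1 ∨ p % 4 = 3) with h | h
      · rw [ZMod.χ₄_nat_one_mod_four h, one_mul]
        exact jacobiSym.quadratic_reciprocity_one_mod_four' hodd h
      · rw [ZMod.χ₄_nat_three_mod_four h, jacobiSym.quadratic_reciprocity_three_mod_four h3 h]
        ring

lemma kronecker_eq_jacobiSym_natAbs {d : ℤ} (hd : d % 4 = 1) (n : ℕ) :
    kronecker d n = jacobiSym n d.natAbs := by
  have hzero : kronecker d 0 = jacobiSym (0 : ℕ) d.natAbs := by
    simp only [kronecker, if_true]
    split_ifs with h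
    · rw [h, jacobiSym.one_right]
    · rw [Nat.cast_zero, jacobiSym.zero_left (by omega)]
  induction n using Nat.recOnMul with
  | zero => exact hzero
  | one => simp [kronecker_one]
  | prime p hp => rw [kronecker_prime d hp, kroneckerPrime_eq_jacobiSym hd hp]
  | mul m n hm hn =>
    rcases eq_or_ne m 0 with rfl | hm0
    · simpa using hzero
    rcases eq_or_ne n 0 with rfl | hn0
    · simpa using hzero
    rw [kronecker_mul d hm0 hn0, hm, hn, Nat.cast_mul, jacobiSym.mul_left]

lemma kronecker_eq_jacobiSym_of_odd (d : ℤ) {n : ℕ} (hn : Odd n) :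
    kronecker d n = jacobiSym d n := by
  induction n using Nat.recOnMul with
  | zero => exact absurd hn (by decide)
  | one => simp [kronecker_one]
  | prime p hp =>
    rw [kronecker_prime d hp, kroneckerPrime, if_neg]
    rintro rfl
    exact absurd hn (by decide)
  | mul m n hm hn' =>
    obtain ⟨h1, h2⟩ := Nat.odd_mul.1 hn
    have := NeZero.mk h1.pos.ne'
    have := NeZero.mk h2.pos.ne'
    rw [kronecker_mul d h1.pos.ne' h2.pos.ne', hm h1, hn' h2, jacobiSym.mul_right]

lemma kronecker_of_even {d : ℤ} (hd : d % 2 = 0) {n : ℕ} (hn : Even n) : kronecker d n = 0 := by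
  obtain ⟨m, rfl⟩ := hn
  rcases eq_or_ne m 0 with rfl | hm
  · simp only [kronecker, add_zero, if_true]
    rw [if_neg]; omega
  · rw [← two_mul, kronecker_mul d two_ne_zero hm, kronecker_prime d Nat.prime_two, kroneckerPrime,
      if_pos rfl, if_pos hd, zero_mul]

/-- The Kronecker symbol of a discriminant is periodic. -/
lemma kronecker_mod {d : ℤ} (hd : d % 4 = 0 ∨ d % 4 = 1) (n : ℕ) :
    kronecker d (n % d.natAbs) = kronecker d n := by
  rcases hd with hd | hd
  · obtain ⟨t, rfl⟩ := Int.dvd_of_emod_eq_zero hd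
    have h4 : (4 * t).natAbs = 4 * t.natAbs := by rw [Int.natAbs_mul]; rfl
    have hpar : n % (4 * t).natAbs % 2 = n % 2 :=
      Nat.mod_mod_of_dvd _ (by rw [h4]; exact ⟨2 * t.natAbs, by ring⟩)
    rcases Nat.even_or_odd n with hn | hn
    · rw [kronecker_of_even (by omega) hn, kronecker_of_even (by omega)]
      rw [Nat.even_iff] at hn ⊢; omega
    · have hn' : Odd (n % (4 * t).natAbs) := by rw [Nat.odd_iff] at hn ⊢; omega
      rw [kronecker_eq_jacobiSym_of_odd _ hn, kronecker_eq_jacobiSym_of_odd _ hn',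
        jacobiSym.mul_left, jacobiSym.mul_left, jacobiSym.at_four hn, jacobiSym.at_four hn', h4,
        ← jacobiSym.mod_right t hn]
  · rw [kronecker_eq_jacobiSym_natAbs hd, kronecker_eq_jacobiSym_natAbs hd]
    rw [Int.natCast_mod]
    exact (jacobiSym.mod_left _ _).symm

lemma IsFundamentalDiscriminant.mod_four {d : ℤ} (hd : IsFundamentalDiscriminant d) :
    d % 4 = 0 ∨ d % 4 = 1 := by
  rcases hd with ⟨h, -⟩ | ⟨t, rfl, -, -⟩ <;> omega

lemma IsFundamentalDiscriminant.ne_zero {d : ℤ} (hd : IsFundamentalDiscriminant d) : d ≠ 0 := by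
  rcases hd with ⟨h, -⟩ | ⟨t, rfl, h, -⟩ <;> omega

/-- `n ↦ χ_d(n) n^{-z}` as a completely multiplicative function. -/
noncomputable def kroneckerSummand (d : ℤ) (z : ℂ) : ℕ →*₀ ℂ where
  toFun n := if n = 0 then 0 else kronecker d n * (n : ℂ) ^ (-z)
  map_zero' := if_pos rfl
  map_one' := by simp [kronecker_one]
  map_mul' m n := by
    rcases eq_or_ne m 0 with rfl | hm
    · simp
    rcases eq_or_ne n 0 with rfl | hn
    · simp
    simp only [mul_eq_zero, hm, hn, or_self, if_false, kronecker_mul d hm hn]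
    push_cast
    rw [Complex.natCast_mul_natCast_cpow]
    ring

lemma kroneckerSummand_apply (d : ℤ) (z : ℂ) {n : ℕ} (hn : n ≠ 0) :
    kroneckerSummand d z n = kronecker d n * (n : ℂ) ^ (-z) := if_neg hn

lemma summable_norm_kroneckerSummand (d : ℤ) {z : ℂ} (hz : 1 < z.re) :
    Summable (‖kroneckerSummand d z ·‖) := by
  refine Summable.of_nonneg_of_le (fun _ => norm_nonneg _) (fun n => ?_)
    (Real.summable_nat_rpow.2 (by linarith : -z.re < -1))
  rcases eq_or_ne n 0 with rfl | hn
  · simp only [map_zero, norm_zero]; positivity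
  · rw [kroneckerSummand_apply d z hn, norm_mul, Complex.norm_natCast_cpow_of_pos
      (Nat.pos_of_ne_zero hn), Complex.neg_re]
    exact mul_le_of_le_one_left (by positivity) (norm_kronecker_le d n)

lemma dirichletL_eq_tsum {d : ℤ} (hd : d ≠ 0) (hd4 : d % 4 = 0 ∨ d % 4 = 1) {z : ℂ}
    (hz : 1 < z.re) : dirichletL d z = ∑' n, kroneckerSummand d z n := by
  have : NeZero d.natAbs := ⟨Int.natAbs_ne_zero.mpr hd⟩
  rw [dirichletL, dif_neg hd, ZMod.LFunction_eq_LSeries _ hz, LSeries]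
  refine tsum_congr fun n => ?_
  rcases eq_or_ne n 0 with rfl | hn
  · simp
  · rw [LSeries.term_of_ne_zero hn, kroneckerSummand_apply d z hn, ZMod.val_natCast,
      kronecker_mod hd4, Complex.cpow_neg, div_eq_mul_inv]

lemma hasProd_dirichletL {d : ℤ} (hd : d ≠ 0) (hd4 : d % 4 = 0 ∨ d % 4 = 1) {z : ℂ}
    (hz : 1 < z.re) :
    HasProd (fun p : Nat.Primes => (1 - (kronecker d p : ℂ) * (p : ℂ) ^ (-z))⁻¹)
      (dirichletL d z) := by
  rw [dirichletL_eq_tsum hd hd4 hz]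
  have h := EulerProduct.eulerProduct_completely_multiplicative_hasProd
    (summable_norm_kroneckerSummand d hz)
  have h' : ∀ p : Nat.Primes, kroneckerSummand d z p = kronecker d p * (p : ℂ) ^ (-z) :=
    fun p => kroneckerSummand_apply d z p.2.ne_zero
  simpa only [h'] using h

lemma differentiableAt_dirichletL (d : ℤ) {z : ℂ} (hz : z ≠ 1) :
    DifferentiableAt ℂ (dirichletL d) z := by
  rcases eq_or_ne d 0 with rfl | hd
  · have h : dirichletL 0 = fun _ => 0 := by funext s; simp [dirichletL]
    rw [h]; fun_prop
  · have : NeZero d.natAbs := ⟨Int.natAbs_ne_zero.mpr hd⟩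
    have h := ZMod.differentiableAt_LFunction
      (fun x : ZMod d.natAbs => (kronecker d x.val : ℂ)) z (Or.inl hz)
    exact h.congr_of_eventuallyEq (Filter.Eventually.of_forall fun s => by
      simp only [dirichletL, dif_neg hd])

/-! ### The Dirichlet series of the Gauss sums of odd modulus -/

/-- `ℓ ↦ μ(ℓ) χ_d(ℓ) ℓ^{-z}`. -/
noncomputable def moebiusTwist (d : ℤ) (z : ℂ) : ArithmeticFunction ℂ where
  toFun l := (ArithmeticFunction.moebius l : ℂ) * kroneckerSummand d z l
  map_zero' := by simp

/-- `t ↦ t^{1-2z}` as an arithmetic function. -/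
noncomputable def powerFunction (z : ℂ) : ArithmeticFunction ℂ where
  toFun t := if t = 0 then 0 else (t : ℂ) ^ (1 - 2 * z)
  map_zero' := if_pos rfl

/-- The divisor sum `σ_{1-2z}`. -/
noncomputable def divisorSum (z : ℂ) : ArithmeticFunction ℂ :=
  powerFunction z * (ArithmeticFunction.zeta : ArithmeticFunction ℂ)

lemma divisorSum_apply (z : ℂ) (l : ℕ) :
    divisorSum z l = ∑ t ∈ l.divisors, (t : ℂ) ^ (1 - 2 * z) := by
  rw [divisorSum, ArithmeticFunction.coe_mul_zeta_apply]
  exact Finset.sum_congr rfl fun t ht => if_neg (Nat.pos_of_mem_divisors ht).ne'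

/-- The correction `w ↦ ∑_{ℓ ∣ w} μ(ℓ) χ_d(ℓ) ℓ^{-z} σ_{1-2z}(w/ℓ)` for the square part `w²` of
`n = w² d`. -/
noncomputable def squarePart (d : ℤ) (z : ℂ) : ArithmeticFunction ℂ :=
  moebiusTwist d z * divisorSum z

lemma isMultiplicative_moebiusTwist (d : ℤ) (z : ℂ) : (moebiusTwist d z).IsMultiplicative := by
  refine ⟨by simp [moebiusTwist], fun {m n} h => ?_⟩
  simp only [moebiusTwist, ArithmeticFunction.coe_mk]
  rw [ArithmeticFunction.isMultiplicative_moebius.map_mul_of_coprime h, map_mul]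
  push_cast
  ring

lemma isMultiplicative_divisorSum (z : ℂ) : (divisorSum z).IsMultiplicative := by
  refine ArithmeticFunction.IsMultiplicative.mul ?_
    ArithmeticFunction.isMultiplicative_zeta.natCast
  refine ArithmeticFunction.IsMultiplicative.iff_ne_zero.2
    ⟨by simp [powerFunction], fun {m n} hm hn _ => ?_⟩
  simp only [powerFunction, ArithmeticFunction.coe_mk, mul_eq_zero, hm, hn, or_self, if_false]
  rw [Nat.cast_mul, Complex.natCast_mul_natCast_cpow]

lemma isMultiplicative_squarePart (d : ℤ) (z : ℂ) : (squarePart d z).IsMultiplicative :=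
  (isMultiplicative_moebiusTwist d z).mul (isMultiplicative_divisorSum z)

/-- At prime powers `squarePart` satisfies the recursion of `localPoly`, which is also the one that
the Gauss sums satisfy. -/
lemma squarePart_prime_pow (d : ℤ) (z : ℂ) {p : ℕ} (hp : p.Prime) (j : ℕ) :
    squarePart d z (p ^ j) =
      localPoly (kronecker d p * (p : ℂ) ^ (-z)) ((p : ℂ) ^ (1 - 2 * z)) j := by
  have hS : ∀ j, divisorSum z (p ^ (j + 1)) = 1 + (p : ℂ) ^ (1 - 2 * z) * divisorSum z (p ^ j) := by
    intro j
    rw [divisorSum_apply, divisorSum_apply, Nat.sum_divisors_prime_pow hp, Nat.sum_divisors_prime_pow hp, Finset.sum_range_succ',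
      Finset.mul_sum, add_comm]
    congr 1
    · simp
    · refine Finset.sum_congr rfl fun i _ => ?_
      rw [pow_succ', Nat.cast_mul, Complex.natCast_mul_natCast_cpow]
  have hF : ∀ j, squarePart d z (p ^ (j + 1)) =
      divisorSum z (p ^ (j + 1)) - kronecker d p * (p : ℂ) ^ (-z) * divisorSum z (p ^ j) := by
    intro j
    rw [squarePart, ArithmeticFunction.mul_apply,
      Nat.sum_divisorsAntidiagonal (fun a b => moebiusTwist d z a * divisorSum z b),
      Nat.sum_divisors_prime_pow hp, Finset.sum_range_succ', Finset.sum_range_succ']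
    have h0 : ∑ i ∈ Finset.range j, moebiusTwist d z (p ^ (i + 1 + 1)) *
        divisorSum z (p ^ (j + 1) / p ^ (i + 1 + 1)) = 0 := by
      refine Finset.sum_eq_zero fun i _ => ?_
      simp [moebiusTwist, ArithmeticFunction.moebius_apply_prime_pow hp]
    rw [h0]
    have h1 : p ^ (j + 1) / p ^ (0 + 1) = p ^ j := by
      rw [Nat.pow_div (by omega) hp.pos]; rfl
    rw [h1]
    simp [moebiusTwist, ArithmeticFunction.moebius_apply_prime hp,
      kroneckerSummand_apply d z hp.ne_zero]
    ring
  induction j with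
  | zero => simp [localPoly, (isMultiplicative_squarePart d z).map_one]
  | succ j ih =>
    rw [localPoly, ← ih, hF, hS]
    rcases j with _ | j
    · simp [(isMultiplicative_squarePart d z).map_one, (isMultiplicative_divisorSum z).map_one]
      ring
    · rw [hF, hS]; ring

/-- The summands of the Dirichlet series of the Gauss sums of odd modulus. -/
noncomputable def oddGauss (n : ℤ) (s : ℂ) (f : ℕ) : ℂ :=
  if Odd f then gauss n f / (f : ℂ) ^ (2 * s) else 0

lemma summable_norm_oddGauss (n : ℤ) {s : ℂ} (hs : 1 < s.re) : Summable (‖oddGauss n s ·‖) := by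
  refine Summable.of_nonneg_of_le (fun _ => norm_nonneg _) (fun f => ?_)
    (Real.summable_nat_rpow.2 (by linarith : 1 - 2 * s.re < -1))
  rw [oddGauss]
  split_ifs with hf
  · have h0 : (0 : ℝ) < f := by exact_mod_cast hf.pos
    rw [norm_div, Complex.norm_natCast_cpow_of_pos hf.pos, Real.rpow_sub h0, Real.rpow_one]
    have h2 : (2 * s).re = 2 * s.re := by simp
    rw [h2]
    gcongr
    exact norm_gauss_le n f
  · rw [norm_zero]; positivity

lemma oddGauss_mul (n : ℤ) (s : ℂ) {f g : ℕ} (h : f.Coprime g) :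
    oddGauss n s (f * g) = oddGauss n s f * oddGauss n s g := by
  simp only [oddGauss, Nat.odd_mul]
  by_cases hf : Odd f <;> by_cases hg : Odd g <;> simp only [hf, hg, and_self, and_false,
    false_and, if_true, if_false, zero_mul, mul_zero]
  rw [gauss_mul n hf hg h, Nat.cast_mul, Complex.natCast_mul_natCast_cpow]
  ring

/-- Powers of `p` in terms of `Y = p^{-2s}`, where `z = 2s - 1/2`. -/
lemma cpow_relations {p : ℕ} (hp : p ≠ 0) (s : ℂ) :
    (p : ℂ) ^ (-(2 * s - 1 / 2)) = Real.sqrt p * ((p : ℂ) ^ (2 * s))⁻¹ ∧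
    (p : ℂ) ^ (1 - 2 * (2 * s - 1 / 2)) = (p : ℂ) ^ 2 * (((p : ℂ) ^ (2 * s))⁻¹) ^ 2 ∧
    (p : ℂ) ^ (-(4 * s - 1)) = p * (((p : ℂ) ^ (2 * s))⁻¹) ^ 2 := by
  have hp' : (p : ℂ) ≠ 0 := by exact_mod_cast hp
  have hsq : (((p : ℂ) ^ (2 * s))⁻¹) ^ 2 = (p : ℂ) ^ (-(4 * s)) := by
    rw [← Complex.cpow_neg, pow_two, ← Complex.cpow_add _ _ hp']; congr 1; ring
  refine ⟨?_, ?_, ?_⟩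
  · rw [show -(2 * s - 1 / 2) = 1 / 2 + -(2 * s) by ring, Complex.cpow_add _ _ hp',
      Complex.cpow_neg, Real.sqrt_eq_rpow, Complex.ofReal_cpow (by positivity)]
    push_cast; rfl
  · rw [hsq, show 1 - 2 * (2 * s - 1 / 2) = (2 : ℕ) + -(4 * s) by push_cast; ring,
      Complex.cpow_add _ _ hp', Complex.cpow_natCast]
  · rw [hsq, show -(4 * s - 1) = 1 + -(4 * s) by ring, Complex.cpow_add _ _ hp',
      Complex.cpow_one]

lemma IsFundamentalDiscriminant.not_sq_dvd {d : ℤ} (hd : IsFundamentalDiscriminant d) {p : ℕ}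
    (hp : p.Prime) (hp2 : p ≠ 2) : ¬ (p : ℤ) ^ 2 ∣ d := by
  have hunit : ¬ IsUnit (p : ℤ) := (Nat.prime_iff_prime_int.1 hp).not_isUnit
  rintro h
  rcases hd with ⟨-, h1⟩ | ⟨t, rfl, -, h1⟩
  · exact hunit (h1 _ (by rwa [← pow_two]))
  · have hcop : IsCoprime ((p : ℤ) ^ 2) 4 := by
      have : (p ^ 2).Coprime (2 ^ 2) :=
        Nat.Coprime.pow 2 2 ((Nat.coprime_primes hp Nat.prime_two).2 hp2)
      exact_mod_cast Nat.isCoprime_iff_coprime.2 this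
    exact hunit (h1 _ (by rw [← pow_two]; exact hcop.dvd_of_dvd_mul_left h))

/-- The local factor at an odd prime, as an identity with the local factors of
`L(z, χ_d)`, `ζ(2z)` and `squarePart`. -/
lemma tsum_oddGauss_prime_pow {d : ℤ} (hd : IsFundamentalDiscriminant d) {w : ℕ} (hw : w ≠ 0)
    {p : ℕ} (hp : p.Prime) (hp2 : p ≠ 2) (s : ℂ) :
    (∑' k, oddGauss (w ^ 2 * d) s (p ^ k)) *
        (1 - kronecker d p * (p : ℂ) ^ (-(2 * s - 1 / 2))) =
      (1 - (p : ℂ) ^ (-(4 * s - 1))) *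
        squarePart d (2 * s - 1 / 2) (p ^ w.factorization p) := by
  have hfact : Fact p.Prime := ⟨hp⟩
  have hodd : Odd p := hp.odd_of_ne_two hp2
  obtain ⟨w₀, hw₀⟩ := Nat.ordProj_dvd w p
  set v := w.factorization p with hv
  have hpw : ¬ (p : ℤ) ∣ w₀ := by
    have h1 := Nat.not_dvd_ordCompl hp hw
    have h2 : w / p ^ v = w₀ := by
      conv_lhs => rw [hw₀]
      exact Nat.mul_div_cancel_left _ (pow_pos hp.pos _)
    rw [← hv, h2] at h1
    exact_mod_cast h1
  have hgcd : ((w₀ : ℤ) ).gcd p = 1 := by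
    rw [Int.gcd_comm]
    exact (Int.isCoprime_iff_gcd_eq_one.1
      ((Nat.prime_iff_prime_int.1 hp).coprime_iff_not_dvd.2 hpw))
  have hsq : ¬ (p : ℤ) ^ 2 ∣ (w₀ : ℤ) ^ 2 * d := fun h =>
    hd.not_sq_dvd hp hp2 ((IsCoprime.pow ((Nat.prime_iff_prime_int.1 hp).coprime_iff_not_dvd.2
      hpw)).dvd_of_dvd_mul_left h)
  obtain ⟨A, hA, hA'⟩ := exists_hasSum_gauss hp hp2 hsq (((p : ℂ) ^ (2 * s))⁻¹) v
  have hJ : jacobiSym ((w₀ : ℤ) ^ 2 * d) p = kronecker d p := by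
    rw [jacobiSym.mul_left, jacobiSym.sq_one' hgcd, one_mul, kronecker_eq_jacobiSym_of_odd d hodd]
  have hn : (p : ℤ) ^ (2 * v) * ((w₀ : ℤ) ^ 2 * d) = (w : ℤ) ^ 2 * d := by
    have : (w : ℤ) = (p : ℤ) ^ v * w₀ := by exact_mod_cast hw₀
    rw [this]; ring
  obtain ⟨r1, r2, r3⟩ := cpow_relations hp.ne_zero s
  rw [hJ, ← r1, ← r2, ← r3, ← squarePart_prime_pow d _ hp] at hA'
  rw [hn] at hA
  rw [← hA']
  congr 1
  rw [← hA.tsum_eq]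
  refine tsum_congr fun k => ?_
  rw [oddGauss, if_pos (hodd.pow), Nat.cast_pow, ← Complex.natCast_cpow_natCast_mul,
    mul_comm (k : ℂ), Complex.cpow_mul_nat, div_eq_mul_inv, inv_pow]

lemma hasProd_squarePart (d : ℤ) (z : ℂ) {w : ℕ} (hw : w ≠ 0) :
    HasProd (fun p : Nat.Primes => squarePart d z ((p : ℕ) ^ w.factorization p))
      (squarePart d z w) := by
  rw [(isMultiplicative_squarePart d z).multiplicative_factorization _ hw, Finsupp.prod,
    Nat.support_factorization]
  have h := hasProd_prod_of_ne_finset_one (L := SummationFilter.unconditional Nat.Primes)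
    (f := fun p : Nat.Primes => squarePart d z ((p : ℕ) ^ w.factorization p))
    (s := w.primeFactors.subtype Nat.Prime) fun p hp => by
      have : w.factorization p = 0 := by
        rw [← Finsupp.notMem_support_iff, Nat.support_factorization]
        exact fun h => hp (Finset.mem_subtype.2 h)
      rw [this, pow_zero, (isMultiplicative_squarePart d z).map_one]
  convert h using 1
  exact (Finset.prod_subtype_of_mem (fun p => squarePart d z (p ^ w.factorization p))
    fun p hp => Nat.prime_of_mem_primeFactors hp).symm

/-- The Dirichlet series of the odd Gauss sums as a quotient of `L`-functions, in its region of
absolute convergence. -/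
theorem tsum_oddGauss {d : ℤ} (hd : IsFundamentalDiscriminant d) (j : ℕ) {w : ℕ} (hw : Odd w)
    {s : ℂ} (hs : 1 < s.re) :
    (∑' f, oddGauss ((2 ^ j * w : ℕ) ^ 2 * d) s f) *
        (riemannZeta (4 * s - 1) * (1 - (2 : ℂ) ^ (-(4 * s - 1)))) =
      dirichletL d (2 * s - 1 / 2) * (1 - kronecker d 2 * (2 : ℂ) ^ (-(2 * s - 1 / 2))) *
        squarePart d (2 * s - 1 / 2) w := by
  set z := 2 * s - 1 / 2 with hz
  set n : ℤ := (2 ^ j * w : ℕ) ^ 2 * d with hn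
  have hz1 : 1 < z.re := by simp [hz]; linarith
  have hs1 : 1 < (4 * s - 1).re := by simp; linarith
  have hw0 : 2 ^ j * w ≠ 0 := mul_ne_zero (by positivity) hw.pos.ne'
  have h1 := EulerProduct.eulerProduct_hasProd (f := oddGauss n s)
    (by simp [oddGauss, gauss_one]) (fun h => oddGauss_mul n s h) (summable_norm_oddGauss n hs)
    (by simp [oddGauss])
  have h2 := riemannZeta_eulerProduct_hasProd hs1
  have h3 := hasProd_dirichletL hd.ne_zero hd.mod_four hz1
  have h4 := hasProd_squarePart d z hw.pos.ne'
  have hnorm : ∀ p : Nat.Primes, ∀ u : ℂ, 0 < u.re → ‖((p : ℕ) : ℂ) ^ (-u)‖ < 1 := fun p u hu => by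
    rw [Complex.norm_natCast_cpow_of_pos p.2.pos]
    exact Real.rpow_lt_one_of_one_lt_of_neg (by exact_mod_cast p.2.one_lt) (by simpa using hu)
  have hne1 : ∀ p : Nat.Primes, 1 - ((p : ℕ) : ℂ) ^ (-(4 * s - 1)) ≠ 0 := fun p h => by
    have := hnorm p (4 * s - 1) (by linarith)
    rw [← sub_eq_zero.1 h] at this
    simp at this
  have hne2 : ∀ p : Nat.Primes, 1 - kronecker d p * ((p : ℕ) : ℂ) ^ (-z) ≠ 0 := fun p h => by
    have h' := hnorm p z (by linarith)
    have := (norm_mul_le (kronecker d p : ℂ) (((p : ℕ) : ℂ) ^ (-z))).trans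
      (mul_le_of_le_one_left (norm_nonneg _) (norm_kronecker_le d p))
    rw [← sub_eq_zero.1 h, norm_one] at this
    linarith
  let two : Nat.Primes := ⟨2, Nat.prime_two⟩
  have h5 := hasProd_ite_eq two
    ((1 - (kronecker d 2 : ℂ) * (2 : ℂ) ^ (-z)) * (1 - (2 : ℂ) ^ (-(4 * s - 1)))⁻¹)
  have h6 := (h3.mul h4).mul h5
  have h7 : ∀ p : Nat.Primes, (∑' k, oddGauss n s ((p : ℕ) ^ k)) *
      (1 - ((p : ℕ) : ℂ) ^ (-(4 * s - 1)))⁻¹ =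
      (1 - (kronecker d p : ℂ) * ((p : ℕ) : ℂ) ^ (-z))⁻¹ *
        squarePart d z ((p : ℕ) ^ w.factorization p) *
        (if p = two then (1 - (kronecker d 2 : ℂ) * (2 : ℂ) ^ (-z)) *
          (1 - (2 : ℂ) ^ (-(4 * s - 1)))⁻¹ else 1) := by
    intro p
    split_ifs with hp
    · subst hp
      have h8 : ∑' k, oddGauss n s ((two : ℕ) ^ k) = 1 := by
        rw [tsum_eq_single 0 fun k hk => ?_]
        · simp [oddGauss, gauss_one]
        · rw [oddGauss, if_neg]
          rw [Nat.not_odd_iff_even]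
          exact (Nat.even_pow.2 ⟨even_two, hk⟩)
      have h9 : w.factorization (two : ℕ) = 0 :=
        Nat.factorization_eq_zero_of_not_dvd hw.not_two_dvd_nat
      rw [h8, h9, pow_zero, (isMultiplicative_squarePart d z).map_one]
      have h10 := hne2 two
      simp only [two, Nat.cast_ofNat] at h10 ⊢
      field_simp
    · have hp2 : (p : ℕ) ≠ 2 := fun h => hp (Subtype.ext h)
      have h8 := tsum_oddGauss_prime_pow hd hw0 p.2 hp2 s
      have h9 : (2 ^ j * w).factorization p = w.factorization p := by
        rw [Nat.factorization_mul (by positivity) hw.pos.ne', Nat.factorization_pow,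
          Nat.Prime.factorization Nat.prime_two]
        simp [hp2.symm]
      rw [h9, ← hn, ← hz] at h8
      have h10 := hne2 p
      have h11 := hne1 p
      field_simp
      exact h8
  have h12 := (h1.mul h2).unique (by simpa only [h7] using h6)
  have h13 := hne1 two
  simp only [two, Nat.cast_ofNat] at h13
  rw [← mul_assoc, h12]
  field_simp

/-! ### The factor at two -/

lemma e_eighth : (1 - Complex.I) * e (1 / 8) = (Real.sqrt 2 : ℝ) := by
  have h : e (1 / 8) = (Real.sqrt 2 / 2 : ℝ) * (1 + Complex.I) := by
    rw [e, show (2 * Real.pi * Complex.I * ((1 / 8 : ℝ) : ℂ) : ℂ) =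
      ((Real.pi / 4 : ℝ) : ℂ) * Complex.I by push_cast; ring, Complex.exp_mul_I,
      ← Complex.ofReal_cos, ← Complex.ofReal_sin, Real.cos_pi_div_four, Real.sin_pi_div_four]
    ring
  rw [h]
  push_cast
  linear_combination (-(Real.sqrt 2 / 2 : ℂ)) * Complex.I_sq

lemma e_eighth_kronecker {n d : ℤ} (hd : d % 4 = 1) (h : n % 8 = d % 8) :
    (1 - Complex.I) * e (n / 8) = kronecker d 2 * (Real.sqrt 2 : ℝ) := by
  rw [kronecker_prime d Nat.prime_two, kroneckerPrime, if_pos rfl, if_neg (by omega)]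
  rcases (by omega : d % 8 = 1 ∨ d % 8 = 5) with h1 | h1
  · rw [if_pos (Or.inl h1), ← e_eighth, e_eq_of_sub_intCast (y := 1 / 8) (n / 8)]
    · simp
    · have h2 : n = 1 + 8 * (n / 8) := by omega
      have h3 : (n : ℝ) = 1 + 8 * ((n / 8 : ℤ) : ℝ) := by exact_mod_cast h2
      rw [h3]; ring_nf
  · rw [if_neg (by omega), ← e_eighth, e_eq_of_sub_intCast (y := 1 / 8 + 1 / 2) (n / 8), e_add,
      e_half]
    · push_cast; ring
    · have h2 : n = 5 + 8 * (n / 8) := by omega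
      have h3 : (n : ℝ) = 5 + 8 * ((n / 8 : ℤ) : ℝ) := by exact_mod_cast h2
      rw [h3]; ring_nf

lemma odd_sq_mod_eight {w : ℕ} (hw : Odd w) : (w : ℤ) ^ 2 % 8 = 1 := by
  obtain ⟨k, rfl⟩ := hw
  have h : (k * (k + 1)) % 2 = 0 := Nat.even_iff.1 (Nat.even_mul_succ_self k)
  obtain ⟨m, hm⟩ := Nat.dvd_of_mod_eq_zero h
  have : ((2 * k + 1 : ℕ) : ℤ) ^ 2 = 8 * m + 1 := by
    have : ((2 * k + 1 : ℕ) : ℤ) ^ 2 = 4 * (k * (k + 1) : ℕ) + 1 := by push_cast; ring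
    rw [this, hm]; push_cast; ring
  omega

/-- For odd `w` the factor `twoFactor` is the Euler factor at two of
`L(2s - 1/2, χ_d) / ζ(4s - 1)`. -/
lemma twoFactor_odd_sq_mul {d : ℤ} (hd : IsFundamentalDiscriminant d) {w : ℕ} (hw : Odd w) (Y : ℂ) :
    twoFactor ((w : ℤ) ^ 2 * d) Y * (1 - kronecker d 2 * (Real.sqrt 2 * Y)) = 1 - 2 * Y ^ 2 := by
  have h8 := odd_sq_mod_eight hw
  have hmod : (w : ℤ) ^ 2 * d % 8 = d % 8 := by
    rw [Int.mul_emod, h8, one_mul, Int.emod_emod]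
  have hsq : ((Real.sqrt 2 : ℝ) : ℂ) ^ 2 = 2 := by
    rw [← Complex.ofReal_pow, Real.sq_sqrt (by norm_num)]; norm_num
  rcases hd with ⟨h1, -⟩ | ⟨t, rfl, ht, -⟩
  · rw [twoFactor, if_neg (by omega), e_eighth_kronecker h1 hmod]
    have hχ : (kronecker d 2 : ℂ) ^ 2 = 1 := by
      rw [kronecker_prime d Nat.prime_two, kroneckerPrime, if_pos rfl, if_neg (by omega)]
      split_ifs <;> norm_num
    linear_combination (-((Real.sqrt 2 : ℝ) : ℂ) ^ 2 * Y ^ 2) * hχ - Y ^ 2 * hsq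
  · rw [show (w : ℤ) ^ 2 * (4 * t) = 4 * ((w : ℤ) ^ 2 * t) by ring, twoFactor_four_mul',
      kronecker_of_even (by omega) even_two]
    · simp
    · have h9 : (w : ℤ) ^ 2 * t % 4 = t % 4 := by
        rw [Int.mul_emod, show (w : ℤ) ^ 2 % 4 = 1 by omega, one_mul, Int.emod_emod]
      omega

/-- The analogue at two of `exists_hasSum_gauss`: the factor `twoFactor` supplies the Euler factor of
the quotient of `L`-functions together with the local divisor polynomial. -/
lemma twoFactor_mul {d : ℤ} (hd : IsFundamentalDiscriminant d) (j : ℕ) {w : ℕ} (hw : Odd w)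
    (Y : ℂ) :
    twoFactor ((2 ^ j * w : ℕ) ^ 2 * d) Y * (1 - kronecker d 2 * (Real.sqrt 2 * Y)) =
      (1 - 2 * Y ^ 2) * localPoly (kronecker d 2 * (Real.sqrt 2 * Y)) (2 ^ 2 * Y ^ 2) j := by
  induction j with
  | zero => simpa [localPoly] using twoFactor_odd_sq_mul hd hw Y
  | succ j ih =>
    set N : ℤ := (2 ^ j * w : ℕ) ^ 2 * d with hN
    have hN0 : N ≠ 0 := mul_ne_zero (by have := hw.pos; positivity) hd.ne_zero
    have hN4 : N % 4 = 0 ∨ N % 4 = 1 := by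
      have hsq : ∀ x : ℤ, x ^ 2 % 4 = 0 ∨ x ^ 2 % 4 = 1 := fun x => by
        rcases Int.emod_two_eq_zero_or_one x with h | h
        · left; obtain ⟨y, rfl⟩ := Int.dvd_of_emod_eq_zero h; ring_nf; omega
        · right; obtain ⟨y, hy⟩ : ∃ y, x = 2 * y + 1 := ⟨x / 2, by omega⟩
          rw [hy]; ring_nf; omega
      have h1 := hsq ((2 ^ j * w : ℕ) : ℤ)
      rw [hN, Int.mul_emod]
      rcases h1 with h | h <;> rcases hd.mod_four with h' | h' <;> rw [h, h'] <;> decide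
    have h4 : ((2 ^ (j + 1) * w : ℕ) : ℤ) ^ 2 * d = 4 * N := by
      rw [hN]; push_cast; ring
    rw [h4, twoFactor_four_mul hN0 hN4, localPoly]
    linear_combination (4 * Y ^ 2) * ih

/-! ### Meromorphic continuation of the odd Gauss sum series -/

/-- `1 / ζ`, with its value `0` at the pole `s = 1` of `ζ`. -/
noncomputable def zetaInv (s : ℂ) : ℂ := if s = 1 then 0 else (riemannZeta s)⁻¹

open Filter Topology in
/-- Uses that `ζ` has no zeros on `Re s ≥ 1`; at `s = 1` the pole of `ζ` makes `1 / ζ` tend to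
`0`. -/
lemma analyticAt_zetaInv {s : ℂ} (hs : 1 ≤ s.re) : AnalyticAt ℂ zetaInv s := by
  have hev : ∀ x : ℂ, x ≠ 1 → zetaInv =ᶠ[𝓝 x] fun t => (riemannZeta t)⁻¹ := fun x hx => by
    filter_upwards [isOpen_ne.mem_nhds hx] with t ht using if_neg ht
  have hdiff : ∀ x : ℂ, x ≠ 1 → riemannZeta x ≠ 0 → DifferentiableAt ℂ zetaInv x := fun x hx h0 =>
    ((differentiableAt_riemannZeta hx).inv h0).congr_of_eventuallyEq (hev x hx)
  refine Complex.analyticAt_of_differentiable_on_punctured_nhds_of_continuousAt ?_ ?_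
  all_goals rcases eq_or_ne s 1 with rfl | h1
  · have h := riemannZeta_residue_one.eventually_ne one_ne_zero
    filter_upwards [h, self_mem_nhdsWithin] with t ht ht1
    exact hdiff t ht1 (right_ne_zero_of_mul ht)
  · have h2 : ∀ᶠ t in 𝓝 s, t ≠ 1 ∧ riemannZeta t ≠ 0 :=
      (eventually_ne_nhds h1).and
        ((differentiableAt_riemannZeta h1).continuousAt.eventually_ne
          (riemannZeta_ne_zero_of_one_le_re hs))
    exact (h2.filter_mono nhdsWithin_le_nhds).mono fun t ht => hdiff t ht.1 ht.2
  · rw [continuousAt_iff_punctured_nhds]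
    have h := riemannZeta_residue_one
    have h3 : Tendsto (fun t : ℂ => (t - 1) / ((t - 1) * riemannZeta t)) (𝓝[≠] 1) (𝓝 (0 / 1)) := by
      refine Tendsto.div ?_ h one_ne_zero
      have : Tendsto (fun t : ℂ => t - 1) (𝓝 1) (𝓝 (1 - 1)) := (continuous_sub_right 1).tendsto 1
      rw [sub_self] at this
      exact this.mono_left nhdsWithin_le_nhds
    rw [zero_div] at h3
    rw [show zetaInv 1 = 0 from if_pos rfl]
    refine h3.congr' ?_
    filter_upwards [self_mem_nhdsWithin] with t ht
    have ht' : t - 1 ≠ 0 := sub_ne_zero.2 ht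
    rw [zetaInv, if_neg (show t ≠ 1 from ht), div_mul_eq_div_div, div_self ht', one_div]
  · exact (hdiff s h1 (riemannZeta_ne_zero_of_one_le_re hs)).continuousAt

lemma meromorphicAt_zetaInv (s : ℂ) : MeromorphicAt zetaInv s := by
  rcases eq_or_ne s 1 with rfl | h1
  · exact (analyticAt_zetaInv (by simp)).meromorphicAt
  · have h2 : AnalyticAt ℂ riemannZeta s :=
      Complex.analyticAt_iff_eventually_differentiableAt.2 <| by
        filter_upwards [isOpen_ne.mem_nhds h1] with t ht using differentiableAt_riemannZeta ht
    refine h2.meromorphicAt.inv.congr (Filter.EventuallyEq.filter_mono ?_ nhdsWithin_le_nhds)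
    filter_upwards [isOpen_ne.mem_nhds h1] with t ht using (if_neg ht).symm

lemma analyticAt_dirichletL (d : ℤ) {z : ℂ} (hz : z ≠ 1) : AnalyticAt ℂ (dirichletL d) z :=
  Complex.analyticAt_iff_eventually_differentiableAt.2 <| by
    filter_upwards [isOpen_ne.mem_nhds hz] with t ht using differentiableAt_dirichletL d ht

open Filter Topology in
lemma meromorphicAt_of_tendsto_sub_mul {f : ℂ → ℂ} {x c : ℂ}
    (hd : ∀ᶠ t in 𝓝[≠] x, DifferentiableAt ℂ f t)
    (h : Tendsto (fun t => (t - x) * f t) (𝓝[≠] x) (𝓝 c)) : MeromorphicAt f x := by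
  set g : ℂ → ℂ := Function.update (fun t => (t - x) * f t) x c with hg
  have hgx : ∀ t, t ≠ x → g t = (t - x) * f t := fun t ht => Function.update_of_ne ht _ _
  have hga : AnalyticAt ℂ g x := by
    refine Complex.analyticAt_of_differentiable_on_punctured_nhds_of_continuousAt ?_ ?_
    · filter_upwards [hd, self_mem_nhdsWithin] with t ht htx
      refine DifferentiableAt.congr_of_eventuallyEq (f := fun t => (t - x) * f t) (by fun_prop) ?_
      filter_upwards [isOpen_ne.mem_nhds htx] with u hu using hgx u hu
    · exact continuousAt_update_same.2 h
  have hm : MeromorphicAt (fun t => (t - x)⁻¹ * g t) x := by fun_prop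
  refine hm.congr ?_
  filter_upwards [self_mem_nhdsWithin] with t ht
  rw [hgx t ht, inv_mul_cancel_left₀ (sub_ne_zero.2 ht)]

open Filter Topology in
lemma meromorphicAt_dirichletL (d : ℤ) (z : ℂ) : MeromorphicAt (dirichletL d) z := by
  rcases ne_or_eq z 1 with hz | rfl
  · exact (analyticAt_dirichletL d hz).meromorphicAt
  rcases eq_or_ne d 0 with rfl | hd
  · have h : dirichletL 0 = fun _ => 0 := by funext s; simp [dirichletL]
    rw [h]; fun_prop
  have : NeZero d.natAbs := ⟨Int.natAbs_ne_zero.mpr hd⟩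
  have h := ZMod.LFunction_residue_one fun x : ZMod d.natAbs => (kronecker d x.val : ℂ)
  refine meromorphicAt_of_tendsto_sub_mul
    (c := ∑ j : ZMod d.natAbs, (kronecker d j.val : ℂ) / d.natAbs) ?_ ?_
  · filter_upwards [self_mem_nhdsWithin] with t ht using differentiableAt_dirichletL d ht
  · refine h.congr fun s => ?_
    rw [dirichletL, dif_neg hd]

lemma differentiable_squarePart (d : ℤ) (w : ℕ) : Differentiable ℂ fun z => squarePart d z w := by
  simp only [squarePart, ArithmeticFunction.mul_apply]
  refine Differentiable.fun_sum fun p hp => ?_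
  have hp0 : ∀ {m : ℕ}, m ≠ 0 → (m : ℂ) ≠ 0 := fun h => by exact_mod_cast h
  obtain ⟨hpw, hw⟩ := Nat.mem_divisorsAntidiagonal.1 hp
  have hp1 : p.1 ≠ 0 := left_ne_zero_of_mul (hpw ▸ hw)
  simp only [moebiusTwist, ArithmeticFunction.coe_mk, kroneckerSummand_apply d _ hp1,
    divisorSum_apply]
  refine Differentiable.mul ?_ (Differentiable.fun_sum fun t ht => ?_)
  · exact ((differentiable_neg.const_cpow (Or.inl (hp0 hp1))).const_mul _).const_mul _
  · exact Differentiable.const_cpow (by fun_prop)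
      (Or.inl (hp0 (Nat.pos_of_mem_divisors ht).ne'))

/-- The meromorphic continuation of the Dirichlet series of the odd Gauss sums for
`n = (2^j w)² d` with `w` odd. -/
noncomputable def oddCont (d : ℤ) (w : ℕ) (s : ℂ) : ℂ :=
  dirichletL d (2 * s - 1 / 2) * (1 - kronecker d 2 * (2 : ℂ) ^ (-(2 * s - 1 / 2))) *
    squarePart d (2 * s - 1 / 2) w * zetaInv (4 * s - 1) * (1 - (2 : ℂ) ^ (-(4 * s - 1)))⁻¹

lemma oddCont_eq (d : ℤ) (w : ℕ) : oddCont d w = fun s => dirichletL d (2 * s - 1 / 2) *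
    (1 - kronecker d 2 * (2 : ℂ) ^ (-(2 * s - 1 / 2))) * squarePart d (2 * s - 1 / 2) w *
      zetaInv (4 * s - 1) * (1 - (2 : ℂ) ^ (-(4 * s - 1)))⁻¹ := rfl

lemma one_sub_two_cpow_ne_zero {u : ℂ} (hu : 0 < u.re) : 1 - (2 : ℂ) ^ (-u) ≠ 0 := fun h => by
  have h1 : ‖((2 : ℕ) : ℂ) ^ (-u)‖ < 1 := by
    rw [Complex.norm_natCast_cpow_of_pos two_pos]
    exact Real.rpow_lt_one_of_one_lt_of_neg (by norm_num) (by simpa using hu)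
  rw [Nat.cast_ofNat, ← sub_eq_zero.1 h, norm_one] at h1
  exact lt_irrefl _ h1

lemma tsum_oddGauss_eq_oddCont {d : ℤ} (hd : IsFundamentalDiscriminant d) (j : ℕ) {w : ℕ}
    (hw : Odd w) {s : ℂ} (hs : 1 < s.re) :
    ∑' f, oddGauss ((2 ^ j * w : ℕ) ^ 2 * d) s f = oddCont d w s := by
  have hre : 1 < (4 * s - 1).re := by simp; linarith
  have h1 : 4 * s - 1 ≠ 1 := fun h => by rw [h] at hre; simp at hre
  have h2 := riemannZeta_ne_zero_of_one_le_re hre.le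
  have h3 := one_sub_two_cpow_ne_zero (u := 4 * s - 1) (by linarith)
  rw [oddCont, ← tsum_oddGauss hd j hw hs, zetaInv, if_neg h1]
  field_simp

lemma two_cpow_differentiable (u : ℂ → ℂ) (hu : Differentiable ℂ u) :
    Differentiable ℂ fun s => (2 : ℂ) ^ u s :=
  hu.const_cpow (Or.inl two_ne_zero)

lemma meromorphicAt_oddCont (d : ℤ) (w : ℕ) (s : ℂ) : MeromorphicAt (oddCont d w) s := by
  have h1 : AnalyticAt ℂ (fun s : ℂ => 2 * s - 1 / 2) s := by fun_prop
  have h2 : AnalyticAt ℂ (fun s : ℂ => 4 * s - 1) s := by fun_prop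
  have hL : MeromorphicAt (fun s : ℂ => dirichletL d (2 * s - 1 / 2)) s :=
    MeromorphicAt.comp_analyticAt (f := dirichletL d) (g := fun s : ℂ => 2 * s - 1 / 2)
      (meromorphicAt_dirichletL d _) h1
  have hZ : MeromorphicAt (fun s : ℂ => zetaInv (4 * s - 1)) s :=
    MeromorphicAt.comp_analyticAt (f := zetaInv) (g := fun s : ℂ => 4 * s - 1)
      (meromorphicAt_zetaInv _) h2
  have hF : Differentiable ℂ (fun s : ℂ => squarePart d (2 * s - 1 / 2) w) :=
    (differentiable_squarePart d w).comp (by fun_prop)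
  have h3 := (two_cpow_differentiable (fun s => -(2 * s - 1 / 2)) (by fun_prop)).analyticAt s
  have h4 := (two_cpow_differentiable (fun s => -(4 * s - 1)) (by fun_prop)).analyticAt s
  have h5 := (hF.analyticAt s).meromorphicAt
  have h6 : MeromorphicAt (fun s : ℂ => 1 - kronecker d 2 * (2 : ℂ) ^ (-(2 * s - 1 / 2))) s :=
    (analyticAt_const.sub (analyticAt_const.mul h3)).meromorphicAt
  have h7 : MeromorphicAt (fun s : ℂ => 1 - (2 : ℂ) ^ (-(4 * s - 1))) s :=
    (analyticAt_const.sub h4).meromorphicAt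
  rw [oddCont_eq]
  exact (((hL.fun_mul h6).fun_mul h5).fun_mul hZ).fun_mul h7.fun_inv

lemma analyticAt_oddCont (d : ℤ) (w : ℕ) {s : ℂ} (hs : 1 / 2 ≤ s.re) (hs' : s ≠ 3 / 4) :
    AnalyticAt ℂ (oddCont d w) s := by
  have hz : 2 * s - 1 / 2 ≠ 1 := fun h => hs' (by linear_combination (1 / 2 : ℂ) * h)
  have hre : 1 ≤ (4 * s - 1).re := by simp; linarith
  have hL : AnalyticAt ℂ (fun s : ℂ => dirichletL d (2 * s - 1 / 2)) s :=
    AnalyticAt.fun_comp (f := fun s : ℂ => 2 * s - 1 / 2) (analyticAt_dirichletL d hz) (by fun_prop)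
  have hZ : AnalyticAt ℂ (fun s : ℂ => zetaInv (4 * s - 1)) s :=
    AnalyticAt.fun_comp (f := fun s : ℂ => 4 * s - 1) (analyticAt_zetaInv hre) (by fun_prop)
  have hF : Differentiable ℂ (fun s : ℂ => squarePart d (2 * s - 1 / 2) w) :=
    (differentiable_squarePart d w).comp (by fun_prop)
  have h3 := (two_cpow_differentiable (fun s => -(2 * s - 1 / 2)) (by fun_prop)).analyticAt s
  have h4 := (two_cpow_differentiable (fun s => -(4 * s - 1)) (by fun_prop)).analyticAt s
  have h6 : AnalyticAt ℂ (fun s : ℂ => 1 - kronecker d 2 * (2 : ℂ) ^ (-(2 * s - 1 / 2))) s :=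
    analyticAt_const.sub (analyticAt_const.mul h3)
  have h7 : AnalyticAt ℂ (fun s : ℂ => 1 - (2 : ℂ) ^ (-(4 * s - 1))) s := analyticAt_const.sub h4
  rw [oddCont_eq]
  exact (((hL.fun_mul h6).fun_mul (hF.analyticAt s)).fun_mul hZ).fun_mul
    (h7.fun_inv (one_sub_two_cpow_ne_zero (by linarith)))

/-- The factor at two turns the odd Gauss sum series into the complete quotient of
`L`-functions. -/
lemma oddCont_mul_twoFactor {d : ℤ} (hd : IsFundamentalDiscriminant d) (j : ℕ) {w : ℕ}
    (hw : Odd w) {s : ℂ} (hs : 1 / 2 ≤ s.re) :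
    oddCont d w s * twoFactor ((2 ^ j * w : ℕ) ^ 2 * d) ((2 : ℂ) ^ (2 * s))⁻¹ =
      dirichletL d (2 * s - 1 / 2) * squarePart d (2 * s - 1 / 2) (2 ^ j * w) *
        zetaInv (4 * s - 1) := by
  have h3 := one_sub_two_cpow_ne_zero (u := 4 * s - 1) (by simp; linarith)
  obtain ⟨r1, r2, r3⟩ := cpow_relations two_ne_zero s
  have h2 := twoFactor_mul hd j hw ((2 : ℂ) ^ (2 * s))⁻¹
  have hF := squarePart_prime_pow d (2 * s - 1 / 2) Nat.prime_two j
  have hmul := (isMultiplicative_squarePart d (2 * s - 1 / 2)).map_mul_of_coprime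
    (Nat.Coprime.pow_left j (Nat.coprime_two_left.2 hw))
  simp only [Nat.cast_ofNat] at r1 r2 r3 hF
  rw [← r1, ← r2, ← r3, ← hF] at h2
  rw [hmul, oddCont]
  have h4 := inv_mul_cancel₀ h3
  linear_combination (dirichletL d (2 * s - 1 / 2) * squarePart d (2 * s - 1 / 2) w *
    zetaInv (4 * s - 1) * (1 - (2 : ℂ) ^ (-(4 * s - 1)))⁻¹) * h2 +
    (dirichletL d (2 * s - 1 / 2) * squarePart d (2 * s - 1 / 2) w * zetaInv (4 * s - 1) *
      squarePart d (2 * s - 1 / 2) (2 ^ j)) * h4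

/-! ### Uniqueness of the normalized continuation -/

open Filter Topology in
/-- Two meromorphic functions on `ℂ` that agree on a right half-plane agree near every point. -/
lemma eventuallyEq_of_eq_of_re_gt {f g : ℂ → ℂ} (hf : MeromorphicOn f Set.univ)
    (hg : MeromorphicOn g Set.univ) {σ : ℝ} (h : ∀ s : ℂ, σ < s.re → f s = g s) (s : ℂ) :
    f =ᶠ[𝓝[≠] s] g := by
  have hfg : MeromorphicOn (f - g) Set.univ := hf.sub hg
  have htop : meromorphicOrderAt (f - g) ((σ + 1 : ℝ) : ℂ) = ⊤ := by
    rw [meromorphicOrderAt_eq_top_iff]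
    have hopen : IsOpen {s : ℂ | σ < s.re} := isOpen_lt continuous_const Complex.continuous_re
    have hmem : ((σ + 1 : ℝ) : ℂ) ∈ {s : ℂ | σ < s.re} := by simp
    refine Eventually.filter_mono nhdsWithin_le_nhds ?_
    filter_upwards [hopen.mem_nhds hmem] with t ht
    rw [Pi.sub_apply, h t ht, sub_self]
  have hs : meromorphicOrderAt (f - g) s = ⊤ := by
    by_contra hne
    exact hfg.meromorphicOrderAt_ne_top_of_isPreconnected isPreconnected_univ (Set.mem_univ _)
      (Set.mem_univ _) hne htop
  rw [meromorphicOrderAt_eq_top_iff] at hs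
  filter_upwards [hs] with t ht
  exact sub_eq_zero.1 ht

/-- An explicit meromorphic function that represents the Dirichlet series on a half-plane computes
`phi` wherever it is analytic. -/
theorem isContinuation_phi {a b : Cusp} {y : ℝ} {M : ℂ → ℂ} (hM : MeromorphicOn M Set.univ)
    {σ : ℝ} (hσ : ∀ s : ℂ, σ < s.re → AnalyticAt ℂ M s)
    (hsum : ∀ s : ℂ, σ < s.re →
      HasSum (fun c : moduli a b => kloosterman a b 0 y c / ((c : ℝ) : ℂ) ^ (2 * s)) (M s)) :
    IsContinuation a b y (phi a b y) ∧
      ∀ s, AnalyticAt ℂ M s → AnalyticAt ℂ (phi a b y) s ∧ phi a b y s = M s := by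
  have hex : ∃ g, IsContinuation a b y g := by
    refine ⟨toMeromorphicNFOn M Set.univ, meromorphicNFOn_toMeromorphicNFOn M Set.univ, σ,
      fun s hs => ?_⟩
    rw [toMeromorphicNFOn_eq_toMeromorphicNFAt hM (Set.mem_univ s),
      toMeromorphicNFAt_eq_self.2 (hσ s hs).meromorphicNFAt]
    exact hsum s hs
  have hphi : IsContinuation a b y (phi a b y) := by
    rw [phi, dif_pos hex]; exact hex.choose_spec
  refine ⟨hphi, fun s hs => ?_⟩
  obtain ⟨hNF, σ', hσ'⟩ := hphi
  have heq := eventuallyEq_of_eq_of_re_gt hNF.meromorphicOn hM (σ := max σ σ')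
    (fun t ht => (hσ' t ((le_max_right _ _).trans_lt ht)).unique
      (hsum t ((le_max_left _ _).trans_lt ht))) s
  have h := ((hNF (Set.mem_univ s)).eventuallyEq_nhdsNE_iff_eventuallyEq_nhds
    hs.meromorphicNFAt).1 heq
  exact ⟨hs.congr h.symm, h.eq_of_nhds⟩

/-! ### Complex conjugation and the divisor sums `frakS` -/

lemma conj_natCast_cpow (n : ℕ) (u : ℂ) :
    (starRingEnd ℂ) ((n : ℂ) ^ u) = (n : ℂ) ^ (starRingEnd ℂ) u := by
  rw [Complex.cpow_conj _ _ (by rw [Complex.natCast_arg]; exact Real.pi_pos.ne),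
    Complex.conj_natCast]

/-- Term by term for `Re z > 1`, and then by the identity theorem; the coefficients are real. -/
lemma dirichletL_conj {d : ℤ} (hd : d ≠ 0) (hd4 : d % 4 = 0 ∨ d % 4 = 1) {z : ℂ} (hz : z ≠ 1) :
    dirichletL d ((starRingEnd ℂ) z) = (starRingEnd ℂ) (dirichletL d z) := by
  have hsummand : ∀ (z : ℂ) (n : ℕ), kroneckerSummand d ((starRingEnd ℂ) z) n =
      (starRingEnd ℂ) (kroneckerSummand d z n) := fun z n => by
    rcases eq_or_ne n 0 with rfl | hn
    · simp
    · rw [kroneckerSummand_apply d _ hn, kroneckerSummand_apply d _ hn, map_mul,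
        map_intCast, conj_natCast_cpow, map_neg]
  have hne : ∀ x : ℂ, x ≠ 1 → (starRingEnd ℂ) x ≠ 1 := fun x hx h => hx (by
    rw [← Complex.conj_conj x, h, map_one])
  have h1 : AnalyticOnNhd ℂ (fun x => (starRingEnd ℂ) (dirichletL d ((starRingEnd ℂ) x))) {1}ᶜ :=
    DifferentiableOn.analyticOnNhd
      (fun x hx => (differentiableAt_conj_conj_iff.2
        (differentiableAt_dirichletL d (hne x hx))).differentiableWithinAt) isOpen_compl_singleton
  have h2 : AnalyticOnNhd ℂ (dirichletL d) {1}ᶜ := fun x hx => analyticAt_dirichletL d hx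
  have hconn : IsPreconnected ({1}ᶜ : Set ℂ) :=
    (isConnected_compl_singleton_of_one_lt_rank (by simp) 1).isPreconnected
  have heq := h1.eqOn_of_preconnected_of_eventuallyEq h2 hconn (z₀ := 2) (by simp) (by
    have hopen : IsOpen {s : ℂ | 1 < s.re} := isOpen_lt continuous_const Complex.continuous_re
    filter_upwards [hopen.mem_nhds (show (1 : ℝ) < (2 : ℂ).re by norm_num)] with t ht
    rw [dirichletL_eq_tsum hd hd4 ht, dirichletL_eq_tsum hd hd4 (by simpa using ht), Complex.conj_tsum]
    refine tsum_congr fun n => ?_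
    rw [hsummand, Complex.conj_conj])
  rw [← heq hz, Complex.conj_conj]

/-- At `z = 1/2 + s` the sum `σ_{1-2z}(m) = σ_{-2s}(m)` is `m^{-s}` times the symmetric divisor sum
`τ_s(m)`. -/
lemma squarePart_eq_frakS (d : ℤ) {w : ℕ} (hw : w ≠ 0) (s : ℂ) :
    squarePart d (1 / 2 + s) w = (w : ℂ) ^ (-s) * frakS d w s := by
  rw [squarePart, ArithmeticFunction.mul_apply,
    Nat.sum_divisorsAntidiagonal (fun a b => moebiusTwist d _ a * divisorSum _ b), frakS,
    Finset.mul_sum]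
  refine Finset.sum_congr rfl fun l hl => ?_
  have hl0 := Nat.pos_of_mem_divisors hl
  obtain ⟨m, rfl⟩ := Nat.dvd_of_mem_divisors hl
  have hm0 : m ≠ 0 := right_ne_zero_of_mul hw
  have hmC : (m : ℂ) ≠ 0 := by exact_mod_cast hm0
  have hlC : (l : ℂ) ≠ 0 := by exact_mod_cast hl0.ne'
  rw [Nat.mul_div_cancel_left _ hl0, Nat.cast_mul, Complex.natCast_mul_natCast_cpow]
  have htau : tau s m = (m : ℂ) ^ s * divisorSum (1 / 2 + s) m := by
    rw [tau, divisorSum_apply, Finset.mul_sum, ← Nat.sum_divisorsAntidiagonal'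
      (fun _ b => (m : ℂ) ^ s * (b : ℂ) ^ (1 - 2 * (1 / 2 + s)))]
    refine Finset.sum_congr rfl fun p hp => ?_
    obtain ⟨hp1, -⟩ := Nat.mem_divisorsAntidiagonal.1 hp
    have h2 : p.2 ≠ 0 := right_ne_zero_of_mul (hp1 ▸ hm0)
    have h2C : (p.2 : ℂ) ≠ 0 := by exact_mod_cast h2
    rw [← hp1, Nat.cast_mul, Complex.natCast_mul_natCast_cpow,
      show 1 - 2 * (1 / 2 + s) = -s + -s by ring, Complex.cpow_add _ _ h2C, Complex.cpow_neg]
    have h3 := Complex.div_cpow_ofReal_nonneg (a := p.1) (b := p.2) (by positivity)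
      (by positivity) s
    simp only [Complex.ofReal_natCast] at h3
    rw [h3]
    have h4 : (p.2 : ℂ) ^ s ≠ 0 := by simp [Complex.cpow_eq_zero_iff, h2C]
    field_simp
  have hsqrt : ((Real.sqrt l : ℝ) : ℂ) = (l : ℂ) ^ (1 / 2 : ℂ) := by
    rw [Real.sqrt_eq_rpow, Complex.ofReal_cpow (by positivity)]; push_cast; rfl
  rw [htau, moebiusTwist, ArithmeticFunction.coe_mk, kroneckerSummand_apply d _ hl0.ne', hsqrt,
    neg_add, Complex.cpow_add _ _ hlC, Complex.cpow_neg (l : ℂ) (1 / 2), Complex.cpow_neg (m : ℂ)]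
  have h5 : (m : ℂ) ^ s ≠ 0 := by simp [Complex.cpow_eq_zero_iff, hmC]
  field_simp

lemma conj_natCast_cpow_I_mul (n : ℕ) (t : ℝ) :
    (starRingEnd ℂ) ((n : ℂ) ^ (Complex.I * t)) = (n : ℂ) ^ (-(Complex.I * t)) := by
  rw [conj_natCast_cpow, map_mul, Complex.conj_I, Complex.conj_ofReal, neg_mul]

/-- `τ_s` is even in `s`, hence real on the imaginary axis. -/
lemma conj_tau (t : ℝ) (l : ℕ) :
    (starRingEnd ℂ) (tau (Complex.I * t) l) = tau (Complex.I * t) l := by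
  have hdiv : ∀ (a b : ℕ) (u : ℂ), ((a : ℂ) / b) ^ u = (a : ℂ) ^ u / (b : ℂ) ^ u := fun a b u => by
    simpa using Complex.div_cpow_ofReal_nonneg (a := a) (b := b) (by positivity) (by positivity) u
  rw [tau, map_sum]
  conv_rhs => rw [← Nat.map_swap_divisorsAntidiagonal, Finset.sum_map]
  refine Finset.sum_congr rfl fun p _ => ?_
  simp only [Function.Embedding.coeFn_mk, Equiv.prodComm_apply,
    Prod.fst_swap, Prod.snd_swap]
  rw [hdiv, hdiv, map_div₀, conj_natCast_cpow_I_mul, conj_natCast_cpow_I_mul, Complex.cpow_neg,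
    Complex.cpow_neg, inv_div_inv]

lemma conj_frakS (d : ℤ) (w : ℕ) (t : ℝ) :
    (starRingEnd ℂ) (frakS d w (Complex.I * t)) = frakS d w (Complex.I * t) := by
  simp only [frakS, map_sum, map_div₀, map_mul, conj_tau, map_intCast,
    Complex.conj_ofReal]

/-! ### The cocycle is trivial on the chosen representatives -/

/-- The denominator `cz + d` of the Möbius action. -/
noncomputable def denomAt (g : SL(2, ℝ)) (z : ℂ) : ℂ := (g 1 0 : ℂ) * z + (g 1 1 : ℂ)

lemma denomAt_I_re (g : SL(2, ℝ)) : (denomAt g Complex.I).re = g 1 1 := by simp [denomAt]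

lemma denomAt_I_im (g : SL(2, ℝ)) : (denomAt g Complex.I).im = g 1 0 := by simp [denomAt]

lemma det_eq_one {R : Type*} [CommRing R] (g : SL(2, R)) : g 0 0 * g 1 1 - g 0 1 * g 1 0 = 1 := by
  rw [← Matrix.det_fin_two]; exact g.2

lemma denomAt_I_ne_zero (g : SL(2, ℝ)) : denomAt g Complex.I ≠ 0 := fun h => by
  have h1 := congrArg Complex.re h
  have h2 := congrArg Complex.im h
  rw [denomAt_I_re] at h1
  rw [denomAt_I_im] at h2
  have := det_eq_one g
  rw [h1, h2] at this
  simp at this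

lemma denomAt_mul (g₁ g₂ : SL(2, ℝ)) :
    denomAt (g₁ * g₂) Complex.I = denomAt g₂ Complex.I * denomAt g₁ (act g₂ Complex.I) := by
  have h := denomAt_I_ne_zero g₂
  simp only [denomAt, act, Matrix.SpecialLinearGroup.coe_mul, Matrix.mul_apply,
    Fin.sum_univ_two] at h ⊢
  push_cast
  field_simp
  ring

/-- If `g₂` has its bottom row in the closed first quadrant and `g₁ g₂` a nonnegative lower left
entry, the arguments of the two factors `cz + d` add up without wrapping around. -/
lemma cocycleW_eq_one {g₁ g₂ : SL(2, ℝ)} (h1 : 0 ≤ g₂ 1 1) (h2 : 0 ≤ g₂ 1 0)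
    (h3 : 0 ≤ (g₁ * g₂) 1 0) : cocycleW g₁ g₂ = 1 := by
  have hmul := denomAt_mul g₁ g₂
  have hu := denomAt_I_ne_zero g₂
  have huv := denomAt_I_ne_zero (g₁ * g₂)
  have hv : denomAt g₁ (act g₂ Complex.I) ≠ 0 := fun h => huv (by rw [hmul, h, mul_zero])
  rw [← denomAt_I_re] at h1
  rw [← denomAt_I_im] at h2 h3
  have hW : cocycleW g₁ g₂ = (denomAt g₂ Complex.I / ‖denomAt g₂ Complex.I‖) ^ (1 / 2 : ℂ) *
      (denomAt g₁ (act g₂ Complex.I) / ‖denomAt g₁ (act g₂ Complex.I)‖) ^ (1 / 2 : ℂ) *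
      (denomAt (g₁ * g₂) Complex.I / ‖denomAt (g₁ * g₂) Complex.I‖) ^ (-(1 / 2) : ℂ) := rfl
  rw [hmul] at h3 huv
  rw [hW, hmul]
  clear hW hmul
  generalize denomAt g₂ Complex.I = u at *
  generalize denomAt g₁ (act g₂ Complex.I) = v at *
  have harg : ∀ x : ℂ, x ≠ 0 → (x / ‖x‖).arg = x.arg := fun x hx => by
    rw [div_eq_mul_inv, ← Complex.ofReal_inv, mul_comm,
      Complex.arg_real_mul _ (inv_pos.2 (norm_pos_iff.2 hx))]
  have hne : ∀ x : ℂ, x ≠ 0 → x / ‖x‖ ≠ 0 := fun x hx => div_ne_zero hx (by simpa using hx)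
  have ha1 : 0 ≤ u.arg := Complex.arg_nonneg_iff.2 h2
  have ha2 : u.arg ≤ Real.pi / 2 := (abs_le.1 (Complex.abs_arg_le_pi_div_two_iff.2 h1)).2
  have hb := Complex.arg_mem_Ioc v
  have hsum : u.arg + v.arg ∈ Set.Ioc (-Real.pi) Real.pi := by
    refine ⟨by linarith [hb.1], ?_⟩
    by_contra hlt
    push Not at hlt
    have him : (u * v).im = ‖u‖ * ‖v‖ * Real.sin (u.arg + v.arg) := by
      calc (u * v).im = u.re * v.im + u.im * v.re := Complex.mul_im u v
        _ = (‖u‖ * Real.cos u.arg) * (‖v‖ * Real.sin v.arg) +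
            (‖u‖ * Real.sin u.arg) * (‖v‖ * Real.cos v.arg) := by
          simp only [Complex.norm_mul_cos_arg, Complex.norm_mul_sin_arg]
        _ = _ := by rw [Real.sin_add]; ring
    have hsin : 0 < Real.sin (u.arg + v.arg - Real.pi) :=
      Real.sin_pos_of_pos_of_lt_pi (by linarith) (by linarith [hb.2, Real.pi_pos])
    rw [Real.sin_sub_pi] at hsin
    have := mul_pos (mul_pos (norm_pos_iff.2 hu) (norm_pos_iff.2 hv)) hsin
    linarith
  have hu' := hne u hu
  have hv' := hne v hv
  rw [Complex.cpow_neg, norm_mul, Complex.ofReal_mul, mul_div_mul_comm,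
    Complex.cpow_def_of_ne_zero hu', Complex.cpow_def_of_ne_zero hv',
    Complex.cpow_def_of_ne_zero (mul_ne_zero hu' hv'),
    Complex.log_mul hu' hv' (by rwa [harg u hu, harg v hv]), ← Complex.exp_add, ← Complex.exp_neg,
    ← Complex.exp_add, ← Complex.exp_zero]
  congr 1
  ring

lemma coe_scaling_infinity : (scaling .infinity).1 = !![1, 0; 0, 1] :=
  Matrix.one_fin_two

lemma coe_scaling_zero : (scaling .zero).1 = !![0, -(1 / 2); 2, 0] := rfl

lemma coe_scaling_half : (scaling .half).1 = !![1, -(1 / 2); 2, 0] := rfl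

lemma coe_toReal (A : SL(2, ℤ)) : (toReal A).1 = !![(A 0 0 : ℝ), A 0 1; A 1 0, A 1 1] := by
  ext i j; fin_cases i <;> fin_cases j <;> rfl

lemma nuPair_eq_nuTheta {a b : Cusp} (ha : a = .infinity ∨ a = .zero) {c : ℝ} (hc : 0 < c)
    {A : SL(2, ℤ)} (hA : A ∈ cosetReps a b c) : nuPair a b A = nuTheta A := by
  obtain ⟨-, h10, h00, h11⟩ := hA
  have hmul : scaling a * conj a b A = toReal A * scaling b := by
    rw [conj, mul_assoc, mul_inv_cancel_left]
  have hlow : 0 ≤ (scaling a * conj a b A) 1 0 := by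
    rw [Matrix.SpecialLinearGroup.coe_mul, Matrix.mul_apply, Fin.sum_univ_two]
    rcases ha with rfl | rfl
    · simp [coe_scaling_infinity, h10, hc.le]
    · simp [coe_scaling_zero, h00.1]
  rw [nuPair, cocycleW_eq_one, cocycleW_eq_one (h11.1) (h10 ▸ hc.le) hlow, mul_one, div_one]
  · cases b <;> simp [scaling]
  · cases b <;> simp [scaling]
  · rwa [← hmul]

/-! ### Parametrization of the double cosets -/

lemma conj_eq_iff {a b : Cusp} {A : SL(2, ℤ)} {B : Matrix (Fin 2) (Fin 2) ℝ}
    (h : (toReal A).1 * (scaling b).1 = (scaling a).1 * B) : (conj a b A).1 = B := by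
  have h1 : (scaling a * conj a b A : SL(2, ℝ)).1 = (scaling a).1 * B := by
    rw [← h, conj, mul_assoc, mul_inv_cancel_left, Matrix.SpecialLinearGroup.coe_mul]
  rw [Matrix.SpecialLinearGroup.coe_mul] at h1
  have hdet : IsUnit (scaling a).1 := by
    rw [Matrix.isUnit_iff_isUnit_det, (scaling a).2]; exact isUnit_one
  exact hdet.mul_left_cancel h1

lemma conj_infinity_infinity (A : SL(2, ℤ)) :
    (conj .infinity .infinity A).1 = !![(A 0 0 : ℝ), A 0 1; A 1 0, A 1 1] :=
  conj_eq_iff (by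
    rw [coe_toReal, coe_scaling_infinity, Matrix.mul_fin_two, Matrix.mul_fin_two]
    ext i j; fin_cases i <;> fin_cases j <;> simp)

lemma conj_infinity_zero (A : SL(2, ℤ)) :
    (conj .infinity .zero A).1 = !![2 * (A 0 1 : ℝ), -A 0 0 / 2; 2 * A 1 1, -A 1 0 / 2] :=
  conj_eq_iff (by
    rw [coe_toReal, coe_scaling_infinity, coe_scaling_zero, Matrix.mul_fin_two, Matrix.mul_fin_two]
    ext i j; fin_cases i <;> fin_cases j <;> simp <;> ring)

lemma conj_infinity_half (A : SL(2, ℤ)) :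
    (conj .infinity .half A).1 =
      !![A 0 0 + 2 * (A 0 1 : ℝ), -A 0 0 / 2; A 1 0 + 2 * A 1 1, -A 1 0 / 2] :=
  conj_eq_iff (by
    rw [coe_toReal, coe_scaling_half, coe_scaling_infinity, Matrix.mul_fin_two, Matrix.mul_fin_two]
    ext i j; fin_cases i <;> fin_cases j <;> simp <;> ring)

lemma conj_zero_infinity (A : SL(2, ℤ)) :
    (conj .zero .infinity A).1 = !![(A 1 0 : ℝ) / 2, A 1 1 / 2; -2 * A 0 0, -2 * A 0 1] :=
  conj_eq_iff (by
    rw [coe_toReal, coe_scaling_infinity, coe_scaling_zero, Matrix.mul_fin_two, Matrix.mul_fin_two]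
    ext i j; fin_cases i <;> fin_cases j <;> simp <;> ring)

lemma conj_zero_zero (A : SL(2, ℤ)) :
    (conj .zero .zero A).1 = !![(A 1 1 : ℝ), -A 1 0 / 4; -4 * A 0 1, A 0 0] :=
  conj_eq_iff (by
    rw [coe_toReal, coe_scaling_zero, Matrix.mul_fin_two, Matrix.mul_fin_two]
    ext i j; fin_cases i <;> fin_cases j <;> simp <;> ring)

lemma conj_zero_half (A : SL(2, ℤ)) :
    (conj .zero .half A).1 =
      !![(A 1 0 : ℝ) / 2 + A 1 1, -A 1 0 / 4; -2 * (A 0 0 + 2 * A 0 1), A 0 0] :=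
  conj_eq_iff (by
    rw [coe_toReal, coe_scaling_half, coe_scaling_zero, Matrix.mul_fin_two, Matrix.mul_fin_two]
    ext i j; fin_cases i <;> fin_cases j <;> simp <;> ring)

/-- A Kloosterman sum with first index `0` as a sum over a set of residues `j`. -/
lemma kloosterman_eq_sum {a b : Cusp} (ha : a = .infinity ∨ a = .zero) {y c : ℝ} (hc : 0 < c)
    (S : Finset ℕ) (F : ℕ → ℂ) (idx : SL(2, ℤ) → ℤ)
    (hF : ∀ A ∈ cosetReps a b c, ∃ j ∈ S, idx A = j ∧
      (starRingEnd ℂ) (nuTheta A) * e ((y - kappa b) * conj a b A 1 1 / c) = F j)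
    (hinj : ∀ A ∈ cosetReps a b c, ∀ B ∈ cosetReps a b c, idx A = idx B → A = B)
    (hsurj : ∀ j ∈ S, ∃ A ∈ cosetReps a b c, idx A = j) :
    kloosterman a b 0 y c = ∑ j ∈ S, F j := by
  have hkappa : kappa a = 0 := by rcases ha with rfl | rfl <;> rfl
  rw [kloosterman, ← finsum_mem_coe_finset]
  refine finsum_mem_eq_of_bijOn (fun A => (idx A).toNat) ⟨fun A hA => ?_, fun A hA B hB h => ?_,
    fun j hj => ?_⟩ fun A hA => ?_
  · obtain ⟨j, hj, h, -⟩ := hF A hA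
    simpa [h] using hj
  · obtain ⟨j, -, h1, -⟩ := hF A hA
    obtain ⟨k, -, h2, -⟩ := hF B hB
    exact hinj A hA B hB (by simp only [h1, h2, Int.toNat_natCast] at h ⊢; rw [h])
  · obtain ⟨A, hA, h⟩ := hsurj j hj
    exact ⟨A, hA, by simp [h]⟩
  · obtain ⟨j, hj, h1, h2⟩ := hF A hA
    rw [nuPair_eq_nuTheta ha hc hA, hkappa, h1, Int.toNat_natCast, ← h2]
    simp

/-- An inverse of a residue class in the standard range. -/
lemma exists_mul_eq_one_add {x M : ℤ} (hM : 0 < M) (h : IsCoprime x M) :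
    ∃ y t : ℤ, 0 ≤ y ∧ y < M ∧ x * y = 1 + t * M := by
  obtain ⟨u, v, huv⟩ := h
  refine ⟨u % M, -v - x * (u / M), Int.emod_nonneg _ hM.ne', Int.emod_lt_of_pos _ hM, ?_⟩
  have := Int.emod_add_mul_ediv u M
  linear_combination huv + x * this

lemma eq_of_mul_eq_one_add {x M y y' t t' : ℤ} (h0 : 0 ≤ y) (h1 : y < M) (h0' : 0 ≤ y')
    (h1' : y' < M) (h : x * y = 1 + t * M) (h' : x * y' = 1 + t' * M) : y = y' := by
  have hco : IsCoprime M x := ⟨-t, y, by linear_combination h⟩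
  have hdvd : M ∣ y - y' := hco.dvd_of_dvd_mul_left ⟨t - t', by linear_combination h - h'⟩
  have := Int.eq_zero_of_abs_lt_dvd hdvd (by rw [abs_lt]; constructor <;> linarith)
  linarith

lemma ext_entries {A B : SL(2, ℤ)} (h00 : A 0 0 = B 0 0) (h01 : A 0 1 = B 0 1)
    (h10 : A 1 0 = B 1 0) (h11 : A 1 1 = B 1 1) : A = B := by
  ext i j; fin_cases i <;> fin_cases j <;> assumption

/-! ### Jacobi symbols to moduli close to a multiple of the numerator -/

lemma jacobiSym_one_add_mul (k t : ℕ) : jacobiSym k (1 + 4 * k * t) = 1 := by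
  rcases Nat.eq_zero_or_pos k with rfl | hk
  · simp
  have hodd : Odd (1 + 4 * k * t) := ⟨2 * k * t, by ring⟩
  rw [jacobiSym.mod_right' k hodd, Nat.add_mul_mod_self_left, Nat.mod_eq_of_lt (by omega),
    jacobiSym.one_right]

/-- `(k/b) = 1` for `b ≡ -1 mod 4k`, with `k` of either parity. -/
lemma jacobiSym_of_dvd_add_one {k b : ℕ} (hk : k ≠ 0) (h : 4 * k ∣ b + 1) : jacobiSym k b = 1 := by
  obtain ⟨e, k', hk', rfl⟩ := Nat.exists_eq_two_pow_mul_odd hk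
  have h4 : 4 ∣ b + 1 := (Dvd.intro _ rfl).trans h
  have hb4 : b % 4 = 3 := by omega
  have hb : Odd b := Nat.odd_iff.2 (by omega)
  have hdvd : (k' : ℤ) ∣ (b : ℤ) - (-1) := by
    have : k' ∣ b + 1 := (Dvd.intro_left (4 * 2 ^ e) (by ring)).trans h
    rw [sub_neg_eq_add]; exact_mod_cast this
  have hodd : jacobiSym k' b = 1 := by
    have hsq : jacobiSym (-1) k' = ZMod.χ₄ k' := jacobiSym.at_neg_one hk'
    have hred : jacobiSym b k' = jacobiSym (-1) k' :=
      jacobiSym.mod_left' (Int.modEq_iff_dvd.2 hdvd).symm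
    rcases Nat.odd_mod_four_iff.1 (Nat.odd_iff.1 hk') with h1 | h1
    · rw [jacobiSym.quadratic_reciprocity_one_mod_four h1 hb, hred, hsq,
        ZMod.χ₄_nat_one_mod_four h1]
    · rw [jacobiSym.quadratic_reciprocity_three_mod_four h1 hb4, hred, hsq,
        ZMod.χ₄_nat_three_mod_four h1, neg_neg]
  rw [Nat.cast_mul, jacobiSym.mul_left, hodd, mul_one, Nat.cast_pow, jacobiSym.pow_left]
  rcases e with _ | e
  · simp
  have h8 : 8 ∣ b + 1 := (Dvd.intro (2 ^ e * k') (by ring)).trans h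
  rw [Nat.cast_ofNat, jacobiSym.at_two hb, ZMod.χ₈_nat_eq_if_mod_eight, if_neg (by omega),
    if_pos (by omega), one_pow]

lemma jacobiSym_eq_of_mul_eq_one {a b : ℤ} {f g : ℕ} (h : jacobiSym a f * jacobiSym b g = 1) :
    jacobiSym a f = jacobiSym b g := by
  rcases jacobiSym.trichotomy a f with h1 | h1 | h1 <;> rw [h1] at h ⊢ <;> linarith

lemma jacobiSym_four_mul (a : ℤ) {f : ℕ} (hf : Odd f) : jacobiSym (4 * a) f = jacobiSym a f := by
  rw [jacobiSym.mul_left, jacobiSym.at_four hf, one_mul]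

lemma conj_inv_eps (d : ℤ) : (starRingEnd ℂ) (eps d)⁻¹ = eps d := by
  rw [eps]; split_ifs <;> simp

lemma conj_nuTheta (A : SL(2, ℤ)) :
    (starRingEnd ℂ) (nuTheta A) = shimuraSymbol (A 1 0) (A 1 1) * eps (A 1 1) := by
  rw [nuTheta, map_mul, conj_inv_eps, map_intCast]

lemma mem_gamma0_four_iff (A : SL(2, ℤ)) :
    A ∈ CongruenceSubgroup.Gamma0 4 ↔ (4 : ℤ) ∣ A 1 0 := by
  rw [CongruenceSubgroup.Gamma0_mem, ZMod.intCast_zmod_eq_zero_iff_dvd]; rfl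

lemma mem_cosetReps_iff {a b : Cusp} {c : ℝ} {A : SL(2, ℤ)} :
    A ∈ cosetReps a b c ↔ (4 : ℤ) ∣ A 1 0 ∧ (conj a b A).1 1 0 = c ∧
      (0 ≤ (conj a b A).1 0 0 ∧ (conj a b A).1 0 0 < c) ∧
      (0 ≤ (conj a b A).1 1 1 ∧ (conj a b A).1 1 1 < c) := by
  rw [← mem_gamma0_four_iff]; rfl

lemma eps_of_mul_mod_four {a d : ℤ} (h : a * d % 4 = 1) : eps a = eps d := by
  refine eps_congr ?_
  have h1 := Int.mul_emod a d 4
  rw [h] at h1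
  have ha := Int.emod_nonneg a (show (4 : ℤ) ≠ 0 by norm_num)
  have ha' := Int.emod_lt_of_pos a (show (0 : ℤ) < 4 by norm_num)
  have hd := Int.emod_nonneg d (show (4 : ℤ) ≠ 0 by norm_num)
  have hd' := Int.emod_lt_of_pos d (show (0 : ℤ) < 4 by norm_num)
  generalize a % 4 = x at *
  generalize d % 4 = y at *
  interval_cases x <;> interval_cases y <;> omega

/-! ### The Kloosterman sums between equal cusps -/

/-- The theta Kloosterman sum of modulus `4k`. -/
noncomputable def thetaSum (n : ℤ) (k : ℕ) : ℂ :=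
  ∑ d ∈ (Finset.range (4 * k)).filter Odd,
    (jacobiSym k d : ℂ) * eps d * e (n * d / (4 * k : ℕ))

lemma thetaSum_eq_coprime (n : ℤ) (k : ℕ) :
    thetaSum n k = ∑ d ∈ (Finset.range (4 * k)).filter (Nat.Coprime (4 * k)),
      (jacobiSym k d : ℂ) * eps d * e (n * d / (4 * k : ℕ)) := by
  symm
  refine Finset.sum_subset (fun d hd => ?_) fun d hd hd' => ?_
  · simp only [Finset.mem_filter] at hd ⊢
    refine ⟨hd.1, Nat.coprime_two_left.1 (hd.2.coprime_dvd_left ⟨2 * k, by ring⟩)⟩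
  · simp only [Finset.mem_filter, not_and] at hd hd'
    have hodd := hd.2
    have h4 : Nat.Coprime 4 d := Nat.Coprime.pow_left 2 (Nat.coprime_two_left.2 hodd)
    have hk : ¬ Nat.Coprime k d := fun h => hd' hd.1 (h4.mul_left h)
    rw [jacobiSym.eq_zero_iff.2 ⟨fun h => by simp [h] at hodd, by simpa using hk⟩]
    simp

/-- The double cosets of modulus `4k` are indexed by the lower right entry. -/
lemma kloosterman_infinity_infinity (n : ℤ) {k : ℕ} (hk : 0 < k) :
    kloosterman .infinity .infinity 0 n (4 * k : ℕ) = thetaSum n k := by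
  have hk4 : (0 : ℤ) < 4 * k := by positivity
  have hmem : ∀ A : SL(2, ℤ), A ∈ cosetReps .infinity .infinity ((4 * k : ℕ) : ℝ) ↔
      (4 : ℤ) ∣ A 1 0 ∧ A 1 0 = 4 * k ∧ (0 ≤ A 0 0 ∧ A 0 0 < 4 * k) ∧
        (0 ≤ A 1 1 ∧ A 1 1 < 4 * k) := fun A => by
    rw [mem_cosetReps_iff, conj_infinity_infinity]
    change _ ∧ ((A 1 0 : ℝ) = _) ∧ (0 ≤ (A 0 0 : ℝ) ∧ (A 0 0 : ℝ) < _) ∧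
      (0 ≤ (A 1 1 : ℝ) ∧ (A 1 1 : ℝ) < _) ↔ _
    norm_cast
  rw [thetaSum_eq_coprime]
  refine kloosterman_eq_sum (Or.inl rfl) (by positivity) _ _ (fun A => A 1 1) (fun A hA => ?_)
    (fun A hA B hB h => ?_) fun j hj => ?_
  · obtain ⟨-, h10, -, h0, h1⟩ := (hmem A).1 hA
    have hdet := det_eq_one A
    obtain ⟨j, hj⟩ := Int.eq_ofNat_of_zero_le h0
    rw [hj] at h1 hdet
    have hco : Nat.Coprime (4 * k) j := by
      rw [← Nat.isCoprime_iff_coprime]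
      exact ⟨-A 0 1, A 0 0, by rw [h10] at hdet; push_cast; linear_combination hdet⟩
    have hodd : Odd j := Nat.coprime_two_left.1 (hco.coprime_dvd_left ⟨2 * k, by ring⟩)
    refine ⟨j, by simp only [Finset.mem_filter, Finset.mem_range]; exact ⟨by omega, hco⟩, hj, ?_⟩
    rw [conj_nuTheta, conj_infinity_infinity, hj, h10, shimuraSymbol, if_neg (by omega),
      Int.natAbs_natCast, jacobiSym_four_mul _ hodd]
    simp [kappa]
  · obtain ⟨-, h10, ⟨ha, ha'⟩, -⟩ := (hmem A).1 hA
    obtain ⟨-, h10', ⟨hb, hb'⟩, -⟩ := (hmem B).1 hB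
    have hA1 := det_eq_one A
    have hB1 := det_eq_one B
    rw [h10] at hA1
    rw [h10', ← h] at hB1
    have h00 : A 0 0 = B 0 0 := eq_of_mul_eq_one_add (x := A 1 1) (t := A 0 1) (t' := B 0 1)
      ha ha' hb hb' (by linear_combination hA1) (by linear_combination hB1)
    refine ext_entries h00 ?_ (h10.trans h10'.symm) h
    rw [h00] at hA1
    exact mul_right_cancel₀ hk4.ne' (by linear_combination hB1 - hA1)
  · simp only [Finset.mem_filter, Finset.mem_range] at hj
    obtain ⟨y, t, h0, h1, h⟩ := exists_mul_eq_one_add (x := j) hk4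
      (by have := Nat.isCoprime_iff_coprime.2 hj.2.symm; push_cast at this; exact this)
    refine ⟨⟨!![y, t; 4 * k, j], by rw [Matrix.det_fin_two_of]; linear_combination h⟩,
      (hmem _).2 ⟨?_, ?_, ⟨h0, h1⟩, ?_, ?_⟩, ?_⟩ <;> simp
    have := hj.1
    omega

/-- The double cosets of modulus `4k` are indexed by the upper left entry of the matrix in `Γ₀(4)`. -/
lemma kloosterman_zero_zero (N : ℤ) {k : ℕ} (hk : 0 < k) :
    kloosterman .zero .zero 0 N (4 * k : ℕ) = thetaSum N k := by
  have hk4 : (0 : ℤ) < 4 * k := by positivity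
  have hmem : ∀ A : SL(2, ℤ), A ∈ cosetReps .zero .zero ((4 * k : ℕ) : ℝ) ↔
      (4 : ℤ) ∣ A 1 0 ∧ A 0 1 = -k ∧ (0 ≤ A 1 1 ∧ A 1 1 < 4 * k) ∧
        (0 ≤ A 0 0 ∧ A 0 0 < 4 * k) := fun A => by
    have : (-4 * (A 0 1 : ℝ) = (4 * k : ℕ)) ↔ A 0 1 = -k := by
      constructor
      · intro h; push_cast at h; have : (A 0 1 : ℝ) = -k := by linarith
        exact_mod_cast this
      · intro h; rw [h]; push_cast; ring
    rw [mem_cosetReps_iff, conj_zero_zero]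
    change _ ∧ (-4 * (A 0 1 : ℝ) = _) ∧ (0 ≤ (A 1 1 : ℝ) ∧ (A 1 1 : ℝ) < _) ∧
      (0 ≤ (A 0 0 : ℝ) ∧ (A 0 0 : ℝ) < _) ↔ _
    rw [this]
    norm_cast
  rw [thetaSum_eq_coprime]
  refine kloosterman_eq_sum (Or.inr rfl) (by positivity) _ _ (fun A => A 0 0) (fun A hA => ?_)
    (fun A hA B hB h => ?_) fun j hj => ?_
  · obtain ⟨⟨c, hc⟩, h01, ⟨hd, -⟩, h0, h1⟩ := (hmem A).1 hA
    have hdet := det_eq_one A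
    obtain ⟨j, hj⟩ := Int.eq_ofNat_of_zero_le h0
    obtain ⟨d, hd⟩ := Int.eq_ofNat_of_zero_le hd
    rw [hj] at h1
    rw [hj, hd, h01, hc] at hdet
    have hco : Nat.Coprime (4 * k) j := by
      rw [← Nat.isCoprime_iff_coprime]
      exact ⟨c, d, by push_cast; linear_combination hdet⟩
    have hodd : Odd j := Nat.coprime_two_left.1 (hco.coprime_dvd_left ⟨2 * k, by ring⟩)
    have hdodd : Odd d := by
      refine Nat.coprime_two_left.1 (Nat.isCoprime_iff_coprime.1 ⟨2 * k * c, j, ?_⟩)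
      push_cast; linear_combination hdet
    have hc0 : c ≤ 0 := by
      have : 0 < j * d := Nat.mul_pos hodd.pos hdodd.pos
      zify at this
      by_contra hc0
      push Not at hc0
      nlinarith
    obtain ⟨c', rfl⟩ : ∃ c' : ℕ, c = -c' := ⟨c.natAbs, by omega⟩
    have hprod : j * d = 1 + 4 * k * c' := by zify; linear_combination hdet
    refine ⟨j, by simp only [Finset.mem_filter, Finset.mem_range]; exact ⟨by omega, hco⟩, hj, ?_⟩
    have hsymm : jacobiSym (4 * -c' : ℤ) d = jacobiSym k j := by
      have : NeZero j := ⟨hodd.pos.ne'⟩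
      have : NeZero d := ⟨hdodd.pos.ne'⟩
      rw [jacobiSym_four_mul _ hdodd]
      have h1 : jacobiSym k j * jacobiSym k d = 1 := by
        rw [← jacobiSym.mul_right, hprod, jacobiSym_one_add_mul]
      have h2 : jacobiSym (-c') d * jacobiSym k d = 1 := by
        rw [← jacobiSym.mul_left, ← jacobiSym_four_mul _ hdodd, ← jacobiSym.one_left d]
        refine jacobiSym.mod_left' (Int.modEq_iff_dvd.2 ⟨j, ?_⟩)
        linear_combination -hdet
      rw [jacobiSym_eq_of_mul_eq_one h1, jacobiSym_eq_of_mul_eq_one h2]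
    have heps : eps (j : ℤ) = eps d := eps_of_mul_mod_four (by
      have : ((j * d : ℕ) : ℤ) = 1 + 4 * (k * c') := by rw [hprod]; push_cast; ring
      push_cast at this; omega)
    rw [conj_nuTheta, conj_zero_zero, hd, hc, shimuraSymbol, if_neg (by omega),
      Int.natAbs_natCast, hsymm, heps]
    simp [kappa, hj]
  · obtain ⟨⟨c, hc⟩, h01, ⟨ha, ha'⟩, -⟩ := (hmem A).1 hA
    obtain ⟨⟨c', hc'⟩, h01', ⟨hb, hb'⟩, -⟩ := (hmem B).1 hB
    have hA1 := det_eq_one A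
    have hB1 := det_eq_one B
    rw [h01, hc] at hA1
    rw [h01', ← h, hc'] at hB1
    have h11 : A 1 1 = B 1 1 := eq_of_mul_eq_one_add (x := A 0 0) (t := -c) (t' := -c')
      ha ha' hb hb' (by linear_combination hA1) (by linear_combination hB1)
    refine ext_entries h (h01.trans h01'.symm) ?_ h11
    rw [h11] at hA1
    rw [hc, hc', mul_right_cancel₀ hk4.ne' (by linear_combination hA1 - hB1 : c * (4 * k) = c' * (4 * k))]
  · simp only [Finset.mem_filter, Finset.mem_range] at hj
    obtain ⟨y, t, h0, h1, h⟩ := exists_mul_eq_one_add (x := j) hk4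
      (by have := Nat.isCoprime_iff_coprime.2 hj.2.symm; push_cast at this; exact this)
    refine ⟨⟨!![(j : ℤ), -k; 4 * -t, y], by rw [Matrix.det_fin_two_of]; linear_combination h⟩,
      (hmem _).2 ⟨Dvd.intro _ rfl, rfl, ⟨h0, h1⟩, ?_, ?_⟩, ?_⟩ <;> simp
    have := hj.1
    omega

/-! ### The Kloosterman sums between the cusps `∞` and `0` -/

lemma eps_of_mul_mod_four_eq_three {a d : ℤ} (h : a * d % 4 = 3) :
    eps d = Complex.I * (eps a)⁻¹ := by
  have h1 := Int.mul_emod a d 4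
  rw [h] at h1
  have ha := Int.emod_nonneg a (show (4 : ℤ) ≠ 0 by norm_num)
  have ha' := Int.emod_lt_of_pos a (show (0 : ℤ) < 4 by norm_num)
  have hd := Int.emod_nonneg d (show (4 : ℤ) ≠ 0 by norm_num)
  have hd' := Int.emod_lt_of_pos d (show (0 : ℤ) < 4 by norm_num)
  rw [eps, eps]
  generalize a % 4 = x at *
  generalize d % 4 = y at *
  interval_cases x <;> interval_cases y <;> first | omega | simp

lemma jacobiSym_neg_one_mul_eps {f : ℕ} (hf : Odd f) :
    (jacobiSym (-1) f : ℂ) * eps f = (eps f)⁻¹ := by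
  rw [jacobiSym.at_neg_one hf]
  rcases Nat.odd_mod_four_iff.1 (Nat.odd_iff.1 hf) with h | h
  · rw [ZMod.χ₄_nat_one_mod_four h, eps, if_pos (by omega)]; simp
  · rw [ZMod.χ₄_nat_three_mod_four h, eps, if_neg (by omega)]; simp

lemma gauss_eq_coprime (n : ℤ) {f : ℕ} (hf : 0 < f) :
    gauss n f = ∑ g ∈ (Finset.range f).filter (Nat.Coprime f),
      (eps f)⁻¹ * ((jacobiSym g f : ℂ) * e (n * g / f)) := by
  rw [gauss, Finset.mul_sum, Finset.sum_filter]
  refine Finset.sum_congr rfl fun g _ => ?_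
  split_ifs with h
  · rfl
  · rw [jacobiSym.eq_zero_iff.2 ⟨hf.ne', by simpa [Nat.gcd_comm] using h⟩]
    simp

/-- The double cosets of modulus `2f` are indexed by the upper right entry `-g`; the constant `i` comes
from `d f ≡ -1 mod 4` for the lower right entry `d`. -/
lemma kloosterman_zero_infinity (n : ℤ) {f : ℕ} (hf : Odd f) :
    kloosterman .zero .infinity 0 n (2 * f : ℕ) = Complex.I * gauss n f := by
  have hf0 : (0 : ℤ) < f := by exact_mod_cast hf.pos
  have hfR : (0 : ℝ) < f := by exact_mod_cast hf.pos
  have hmem : ∀ A : SL(2, ℤ), A ∈ cosetReps .zero .infinity ((2 * f : ℕ) : ℝ) ↔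
      (4 : ℤ) ∣ A 1 0 ∧ A 0 0 = -f ∧ (0 ≤ A 1 0 ∧ A 1 0 < 4 * f) ∧
        (A 0 1 ≤ 0 ∧ -f < A 0 1) := fun A => by
    rw [mem_cosetReps_iff, conj_zero_infinity]
    change _ ∧ (-2 * (A 0 0 : ℝ) = _) ∧ (0 ≤ (A 1 0 : ℝ) / 2 ∧ (A 1 0 : ℝ) / 2 < _) ∧
      (0 ≤ -2 * (A 0 1 : ℝ) ∧ -2 * (A 0 1 : ℝ) < _) ↔ _
    simp only [← Int.cast_inj (α := ℝ), ← Int.cast_le (R := ℝ), ← Int.cast_lt (R := ℝ)]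
    push_cast
    refine and_congr Iff.rfl (and_congr ?_ (and_congr (and_congr ?_ ?_) (and_congr ?_ ?_))) <;>
      constructor <;> intro h <;> linarith
  rw [gauss_eq_coprime n hf.pos, Finset.mul_sum]
  refine kloosterman_eq_sum (Or.inr rfl) (by exact_mod_cast (by linarith [hf.pos] : 0 < 2 * f)) _ _
    (fun A => -A 0 1) (fun A hA => ?_) (fun A hA B hB h => ?_) fun j hj => ?_
  · obtain ⟨⟨c, hc⟩, h00, ⟨hc0, hc1⟩, hb0, hb1⟩ := (hmem A).1 hA
    have hdet := det_eq_one A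
    obtain ⟨g, hg⟩ := Int.eq_ofNat_of_zero_le (neg_nonneg.2 hb0)
    obtain ⟨c', rfl⟩ := Int.eq_ofNat_of_zero_le (show 0 ≤ c by omega)
    have h01 : A 0 1 = -g := by omega
    rw [h00, h01, hc] at hdet
    have hco : Nat.Coprime f g := by
      rw [← Nat.isCoprime_iff_coprime]
      exact ⟨-A 1 1, 4 * c', by linear_combination hdet⟩
    refine ⟨g, by simp only [Finset.mem_filter, Finset.mem_range]; exact ⟨by omega, hco⟩, hg, ?_⟩
    have heps : eps (A 1 1) = Complex.I * (eps f)⁻¹ := eps_of_mul_mod_four_eq_three (by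
      have : (f : ℤ) * A 1 1 = -1 + 4 * (g * c') := by linear_combination -hdet
      omega)
    have hjac : jacobiSym (4 * c') (A 1 1).natAbs = jacobiSym g f := by
      rcases lt_or_ge 0 (A 1 1) with hd | hd
      · obtain ⟨d, hd'⟩ := Int.eq_ofNat_of_zero_le hd.le
        rw [hd'] at hdet hd ⊢
        have hprod : 4 * g * c' = f * d + 1 := by zify; linear_combination hdet
        have hdodd : Odd d := by
          refine Nat.coprime_two_left.1 (Nat.isCoprime_iff_coprime.1 ⟨2 * g * c', -f, ?_⟩)
          push_cast; linear_combination hdet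
        have : NeZero d := ⟨hdodd.pos.ne'⟩
        have : NeZero f := ⟨hf.pos.ne'⟩
        have hg0 : g ≠ 0 := by rintro rfl; simp at hprod
        rw [Int.natAbs_natCast, jacobiSym_four_mul _ hdodd]
        have h1 : jacobiSym c' d * jacobiSym g d = 1 := by
          rw [← jacobiSym.mul_left, ← jacobiSym_four_mul _ hdodd, ← jacobiSym.one_left d]
          refine jacobiSym.mod_left' (Int.modEq_iff_dvd.2 ⟨-f, ?_⟩)
          linear_combination -hdet
        have h2 : jacobiSym g f * jacobiSym g d = 1 := by
          rw [← jacobiSym.mul_right, jacobiSym_of_dvd_add_one hg0 ⟨c', hprod.symm⟩]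
        rw [jacobiSym_eq_of_mul_eq_one h1, jacobiSym_eq_of_mul_eq_one h2]
      · -- the degenerate double coset, which occurs only for `f = 1`
        have h1 : (f : ℤ) * A 1 1 ≥ -1 := by
          have : (0 : ℤ) ≤ g * c' := by positivity
          linarith
        have hd0 : A 1 1 ≠ 0 := fun h0 => by
          rw [h0] at hdet
          have : (4 : ℤ) * (g * c') = 1 := by linear_combination hdet
          omega
        have hf1 : (f : ℤ) = 1 := by nlinarith [lt_of_le_of_ne hd hd0]
        have hd1 : A 1 1 = -1 := by rw [hf1] at h1; omega
        rw [hd1, show f = 1 by exact_mod_cast hf1]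
        simp
    rw [conj_nuTheta, conj_zero_infinity, hc, shimuraSymbol, if_neg (by omega), hjac, heps]
    have harg : ((n : ℝ) - kappa .infinity) * (-2 * (A 0 1 : ℝ)) / (2 * f : ℕ) = n * g / f := by
      rw [h01, kappa]; push_cast; field_simp; ring
    change _ * e (((n : ℝ) - kappa .infinity) * (-2 * (A 0 1 : ℝ)) / (2 * f : ℕ)) = _
    rw [harg]
    ring
  · obtain ⟨⟨c, hc⟩, h00, ⟨ha, ha'⟩, -⟩ := (hmem A).1 hA
    obtain ⟨⟨c', hc'⟩, h00', ⟨hb, hb'⟩, -⟩ := (hmem B).1 hB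
    have hA1 := det_eq_one A
    have hB1 := det_eq_one B
    have h01 : A 0 1 = B 0 1 := neg_injective h
    rw [h00, hc, h01] at hA1
    rw [h00', hc'] at hB1
    have hcc : c = c' := eq_of_mul_eq_one_add (x := -4 * B 0 1) (M := f) (t := A 1 1) (t' := B 1 1)
      (by omega) (by omega) (by omega) (by omega) (by linear_combination hA1)
      (by linear_combination hB1)
    refine ext_entries (h00.trans h00'.symm) h01 (by rw [hc, hc', hcc]) ?_
    rw [hcc] at hA1
    exact mul_left_cancel₀ hf0.ne' (by linear_combination hB1 - hA1)
  · simp only [Finset.mem_filter, Finset.mem_range] at hj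
    have hco : Nat.Coprime (4 * j) f := Nat.Coprime.mul_left
      (Nat.Coprime.pow_left 2 (Nat.coprime_two_left.2 hf)) hj.2.symm
    obtain ⟨y, t, h0, h1, h⟩ := exists_mul_eq_one_add (x := 4 * j) hf0
      (by have := Nat.isCoprime_iff_coprime.2 hco; push_cast at this; exact this)
    refine ⟨⟨!![-(f : ℤ), -j; 4 * y, t], by rw [Matrix.det_fin_two_of]; linear_combination h⟩,
      (hmem _).2 ⟨Dvd.intro _ rfl, rfl, ⟨?_, ?_⟩, ?_, ?_⟩, ?_⟩ <;> simp <;> omega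

/-- The double cosets of modulus `2f` are indexed by `g`, where `-4g` is the lower left entry. -/
lemma kloosterman_infinity_zero (N : ℤ) {f : ℕ} (hf : Odd f) :
    kloosterman .infinity .zero 0 N (2 * f : ℕ) = gauss N f := by
  have hf0 : (0 : ℤ) < f := by exact_mod_cast hf.pos
  have hfR : (0 : ℝ) < f := by exact_mod_cast hf.pos
  have hmem : ∀ A : SL(2, ℤ), A ∈ cosetReps .infinity .zero ((2 * f : ℕ) : ℝ) ↔
      (4 : ℤ) ∣ A 1 0 ∧ A 1 1 = f ∧ (0 ≤ A 0 1 ∧ A 0 1 < f) ∧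
        (A 1 0 ≤ 0 ∧ -(4 * f) < A 1 0) := fun A => by
    rw [mem_cosetReps_iff, conj_infinity_zero]
    change _ ∧ (2 * (A 1 1 : ℝ) = _) ∧ (0 ≤ 2 * (A 0 1 : ℝ) ∧ 2 * (A 0 1 : ℝ) < _) ∧
      (0 ≤ -(A 1 0 : ℝ) / 2 ∧ -(A 1 0 : ℝ) / 2 < _) ↔ _
    simp only [← Int.cast_inj (α := ℝ), ← Int.cast_le (R := ℝ), ← Int.cast_lt (R := ℝ)]
    push_cast
    refine and_congr Iff.rfl (and_congr ?_ (and_congr (and_congr ?_ ?_) (and_congr ?_ ?_))) <;>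
      constructor <;> intro h <;> linarith
  rw [gauss_eq_coprime N hf.pos]
  refine kloosterman_eq_sum (Or.inl rfl) (by exact_mod_cast (by linarith [hf.pos] : 0 < 2 * f)) _ _
    (fun A => -A 1 0 / 4) (fun A hA => ?_) (fun A hA B hB h => ?_) fun j hj => ?_
  · obtain ⟨⟨c, hc⟩, h11, -, hb0, hb1⟩ := (hmem A).1 hA
    have hdet := det_eq_one A
    obtain ⟨g, hg⟩ := Int.eq_ofNat_of_zero_le (show 0 ≤ -c by omega)
    have h10 : A 1 0 = -(4 * g) := by omega
    rw [h11, h10] at hdet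
    have hco : Nat.Coprime f g := by
      rw [← Nat.isCoprime_iff_coprime]
      exact ⟨A 0 0, 4 * A 0 1, by linear_combination hdet⟩
    refine ⟨g, by simp only [Finset.mem_filter, Finset.mem_range]; exact ⟨by omega, hco⟩,
      by rw [h10]; omega, ?_⟩
    rw [conj_nuTheta, conj_infinity_zero, h10, h11, shimuraSymbol, if_neg (by omega),
      Int.natAbs_natCast, ← mul_neg, jacobiSym_four_mul _ hf, neg_eq_neg_one_mul,
      jacobiSym.mul_left, ← jacobiSym_neg_one_mul_eps hf]
    have harg : ((N : ℝ) - kappa .zero) * (-((4 * (-1 * (g : ℤ)) : ℤ) : ℝ) / 2) / (2 * f : ℕ) =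
        N * g / f := by
      rw [kappa]; push_cast; field_simp; ring
    change _ * e (((N : ℝ) - kappa .zero) * (-((4 * (-1 * (g : ℤ)) : ℤ) : ℝ) / 2) / (2 * f : ℕ)) = _
    rw [harg]
    push_cast
    ring
  · obtain ⟨⟨c, hc⟩, h11, ⟨ha, ha'⟩, -⟩ := (hmem A).1 hA
    obtain ⟨⟨c', hc'⟩, h11', ⟨hb, hb'⟩, -⟩ := (hmem B).1 hB
    have hA1 := det_eq_one A
    have hB1 := det_eq_one B
    have h10 : A 1 0 = B 1 0 := by
      change -A 1 0 / 4 = -B 1 0 / 4 at h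
      omega
    rw [h11, h10] at hA1
    rw [h11'] at hB1
    have h01 : A 0 1 = B 0 1 := eq_of_mul_eq_one_add (x := -B 1 0) (M := f) (t := -A 0 0)
      (t' := -B 0 0) ha ha' hb hb' (by linear_combination hA1) (by linear_combination hB1)
    refine ext_entries ?_ h01 h10 (h11.trans h11'.symm)
    rw [h01] at hA1
    exact mul_right_cancel₀ hf0.ne' (by linear_combination hA1 - hB1)
  · simp only [Finset.mem_filter, Finset.mem_range] at hj
    have hco : Nat.Coprime (4 * j) f := Nat.Coprime.mul_left
      (Nat.Coprime.pow_left 2 (Nat.coprime_two_left.2 hf)) hj.2.symm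
    obtain ⟨y, t, h0, h1, h⟩ := exists_mul_eq_one_add (x := 4 * j) hf0
      (by have := Nat.isCoprime_iff_coprime.2 hco; push_cast at this; exact this)
    refine ⟨⟨!![-t, y; -(4 * j), (f : ℤ)], by rw [Matrix.det_fin_two_of]; linear_combination h⟩,
      (hmem _).2 ⟨(Dvd.intro _ rfl).neg_right, rfl, ⟨?_, ?_⟩, ?_, ?_⟩, ?_⟩ <;> simp <;> omega

/-! ### The Kloosterman sums between the cusps `∞`, `0` and the cusp `1/2` -/

/-- For `n ≡ 1 mod 4`, passing from the residue `1` to the odd residue `x` modulo `8` in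
`e(n·/8)` costs the factor `(2/x) ε_x`. -/
lemma e_eighth_mul_chi_eps {n x : ℤ} (hn : n % 4 = 1) (hx : x % 2 = 1) :
    e (n * x / 8) * ((ZMod.χ₈ x : ℂ) * eps x) = e (n / 8) := by
  obtain ⟨u, rfl⟩ : ∃ u, x = 1 + 2 * u := ⟨x / 2, by omega⟩
  have h1 : e (n * (1 + 2 * u : ℤ) / 8) = e (n / 8) * e ((n * u : ℤ) / 4) := by
    rw [← e_add]; congr 1; push_cast; ring
  have h2 : (n * u) % 4 = u % 4 := by rw [Int.mul_emod, hn, one_mul, Int.emod_emod]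
  rw [h1, e_int_quarter, h2, mul_assoc, ZMod.χ₈_int_eq_if_mod_eight, eps, if_neg (by omega)]
  rcases (by omega : u % 4 = 0 ∨ u % 4 = 1 ∨ u % 4 = 2 ∨ u % 4 = 3) with h | h | h | h
  · rw [if_pos (by omega), if_pos (by omega), h]; simp
  · rw [if_neg (by omega), if_neg (by omega), h]; simp
  · rw [if_neg (by omega), if_pos (by omega), h]; simp
  · rw [if_pos (by omega), if_neg (by omega), h]; simp [pow_succ]

/-- The exponent of `ε_x` as a power of `i`, for odd `x`. -/
def epsExponent (x : ZMod 8) : ℕ := if x = 3 ∨ x = 7 then 1 else 0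

/-- The exponent of `(2/x)` as a power of `i`, for odd `x`. -/
def chiExponent (x : ZMod 8) : ℕ := if x = 3 ∨ x = 5 then 2 else 0

lemma odd_cases_zmod_eight {x : ℤ} (hx : x % 2 = 1) :
    (x : ZMod 8) = 1 ∨ (x : ZMod 8) = 3 ∨ (x : ZMod 8) = 5 ∨ (x : ZMod 8) = 7 := by
  have h (r : ℤ) : (x : ZMod 8) = r ↔ x % 8 = r % 8 := ZMod.intCast_eq_intCast_iff' x r 8
  have h1 := h 1
  have h3 := h 3
  have h5 := h 5
  have h7 := h 7
  push_cast at h1 h3 h5 h7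
  rw [h1, h3, h5, h7]
  omega

lemma eps_eq_pow {x : ℤ} (hx : x % 2 = 1) : eps x = Complex.I ^ epsExponent x := by
  have h (r : ℤ) : (x : ZMod 8) = r ↔ x % 8 = r % 8 := ZMod.intCast_eq_intCast_iff' x r 8
  have h3 := h 3
  have h7 := h 7
  push_cast at h3 h7
  simp only [eps, epsExponent, h3, h7]
  split_ifs <;> first | omega | simp

lemma chi_eq_pow {x : ℤ} (hx : x % 2 = 1) : (ZMod.χ₈ x : ℂ) = Complex.I ^ chiExponent x := by
  rcases odd_cases_zmod_eight hx with h | h | h | h <;> rw [h] <;> simp [chiExponent] <;> decide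

lemma I_pow_eq_of_mod {a b : ℕ} (h : a % 4 = b % 4) : Complex.I ^ a = Complex.I ^ b := by
  rw [← Nat.div_add_mod a 4, ← Nat.div_add_mod b 4, h, pow_add, pow_add, pow_mul, pow_mul]
  simp

/-- The identity modulo `8` behind the Kloosterman sums between the cusps `0` and `1/2`. -/
lemma chi_eps_identity {α a f d g : ℤ} (hα : α % 2 = 1) (hf : f % 2 = 1) (h : a * α = 1 + 2 * g * f)
    (hd : d = α + 2 * g) :
    (ZMod.χ₈ d : ℂ) * ZMod.χ₈ a * eps (α * d) * eps α * eps (a * α * f) =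
      eps (a * α) * eps a * eps f := by
  have ha : a % 2 = 1 := by
    by_contra hne
    have h1 : (a * α) % 2 = 1 := by rw [h, mul_assoc]; omega
    rw [Int.mul_emod, show a % 2 = 0 by omega] at h1
    simp at h1
  have hmul : ∀ x y : ℤ, x % 2 = 1 → y % 2 = 1 → (x * y) % 2 = 1 := fun x y hx hy => by
    rw [Int.mul_emod, hx, hy]; rfl
  have hd2 : d % 2 = 1 := by omega
  rw [chi_eq_pow hd2, chi_eq_pow ha, eps_eq_pow (hmul _ _ hα hd2), eps_eq_pow hα,
    eps_eq_pow (hmul _ _ (hmul _ _ ha hα) hf), eps_eq_pow (hmul _ _ ha hα), eps_eq_pow ha,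
    eps_eq_pow hf]
  simp only [← pow_add]
  apply I_pow_eq_of_mod
  have hZ : (a : ZMod 8) * α = 1 + 2 * g * f := by exact_mod_cast congrArg (Int.cast (R := ZMod 8)) h
  have hα8 := odd_cases_zmod_eight hα
  have ha8 := odd_cases_zmod_eight ha
  have hf8 := odd_cases_zmod_eight hf
  subst hd
  push_cast
  generalize (a : ZMod 8) = a at *
  generalize (α : ZMod 8) = α at *
  generalize (f : ZMod 8) = f at *
  generalize (g : ZMod 8) = g at *
  clear h hα hf ha hd2
  revert g
  rcases hα8 with rfl | rfl | rfl | rfl <;> rcases ha8 with rfl | rfl | rfl | rfl <;>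
    rcases hf8 with rfl | rfl | rfl | rfl <;> decide

lemma jacobiSym_mul_self {a b : ℕ} (h : a.Coprime b) : (jacobiSym a b : ℂ) * jacobiSym a b = 1 := by
  have := jacobiSym.sq_one (a := (a : ℤ)) (b := b) (by simpa using h)
  rw [← pow_two]; exact_mod_cast this

lemma jacobiSym_reciprocity {a b : ℕ} (ha : Odd a) (hb : Odd b) (h : a.Coprime b) :
    (jacobiSym a b : ℂ) * (eps a * eps b) = eps (a * b : ℕ) * jacobiSym b a := by
  have h1 := eps_mul_reciprocity ha hb h
  have h2 := jacobiSym_mul_self h.symm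
  have ha0 := eps_ne_zero a
  have hb0 := eps_ne_zero b
  have hab0 := eps_ne_zero (a * b : ℕ)
  field_simp at h1
  linear_combination (jacobiSym b a : ℂ) * h1 - (jacobiSym a b : ℂ) * (eps a * eps b) * h2

lemma e_ne_zero (x : ℝ) : e x ≠ 0 := Complex.exp_ne_zero _

/-- The summand for the pair `(∞, 1/2)`: the index `g`, written as `4h + fu`, contributes the summand
of the Gauss sum at `h`, and the characters modulo `8` cancel because `n ≡ 1 mod 4`. -/
lemma infinity_half_summand {n : ℤ} (hn : n % 4 = 1) {f g : ℕ} (hf : Odd f) (hco : f.Coprime g)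
    {h u : ℤ} (hg : (g : ℤ) = 4 * h + f * u) :
    (jacobiSym (-(4 * g)) (f + 2 * g) : ℂ) * eps (f + 2 * g : ℕ) * e (n * g / (4 * f)) =
      (eps f)⁻¹ * ((jacobiSym h f : ℂ) * e (n * h / f)) := by
  have hfR : (f : ℝ) ≠ 0 := by exact_mod_cast hf.pos.ne'
  have hf2 := Nat.odd_iff.1 hf
  have hf8 := odd_sq_mod_eight hf
  obtain ⟨d, hd⟩ : ∃ d, d = f + 2 * g := ⟨_, rfl⟩
  have hd2 : d % 2 = 1 := by omega
  have hdodd : Odd d := Nat.odd_iff.2 hd2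
  have hcod : f.Coprime d := by
    rw [hd, Nat.coprime_self_add_right]
    exact Nat.Coprime.mul_right (Nat.coprime_two_right.2 hf) hco
  have hJ : jacobiSym (-(4 * g)) d = jacobiSym 2 d * jacobiSym f d := by
    rw [show (-(4 * g) : ℤ) = 2 * (-(2 * g)) by ring, jacobiSym.mul_left]
    congr 1
    refine jacobiSym.mod_left' (Int.modEq_iff_dvd.2 ⟨1, ?_⟩)
    rw [hd]; push_cast; ring
  have hJ' : jacobiSym d f = jacobiSym 2 f * jacobiSym h f := by
    rw [← jacobiSym.mul_left, ← jacobiSym_four_mul (2 * h) hf]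
    refine jacobiSym.mod_left' (Int.modEq_iff_dvd.2 ⟨-1 - 2 * u, ?_⟩)
    rw [hd]; push_cast; rw [hg]; ring
  have hrec := jacobiSym_reciprocity hf hdodd hcod
  have hdf : ((f * d : ℕ) : ℤ) % 2 = 1 := by
    have := Nat.odd_iff.1 (hf.mul hdodd)
    omega
  have hL := e_eighth_mul_chi_eps hn hdf
  have hchi : (ZMod.χ₈ ((f * d : ℕ) : ℤ) : ℂ) = jacobiSym 2 f * jacobiSym 2 d := by
    rw [jacobiSym.at_two hf, jacobiSym.at_two hdodd]
    push_cast
    rw [map_mul, Int.cast_mul]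
  obtain ⟨t, ht⟩ : ∃ t, (f : ℤ) ^ 2 = 1 + 8 * t := ⟨(f : ℤ) ^ 2 / 8, by omega⟩
  have he1 : e (n * ((f * d : ℕ) : ℤ) / 8) = e (n / 8) * e (n * u / 4) := by
    rw [← e_add]
    refine e_eq_of_sub_intCast (n * (h * f + t + 2 * t * u)) ?_
    have hgR : (g : ℝ) = 4 * h + f * u := by exact_mod_cast hg
    have htR : (f : ℝ) ^ 2 = 1 + 8 * t := by exact_mod_cast ht
    rw [hd]; push_cast; rw [hgR]
    linear_combination (n / 8 + n * u / 4 : ℝ) * htR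
  have he2 : e (n * g / (4 * f)) = e (n * h / f) * e (n * u / 4) := by
    rw [← e_add]
    congr 1
    have hgR : (g : ℝ) = 4 * h + f * u := by exact_mod_cast hg
    rw [hgR]; field_simp
  have hone : (jacobiSym 2 f : ℂ) * jacobiSym 2 d * eps (f * d : ℕ) * e (n * u / 4) = 1 := by
    refine mul_left_cancel₀ (e_ne_zero (n / 8)) ?_
    rw [he1, hchi] at hL
    linear_combination hL
  rw [← hd, hJ, he2]
  have hef := eps_ne_zero f
  have hed := eps_ne_zero d
  field_simp
  push_cast
  rw [hJ'] at hrec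
  push_cast at hrec hone
  linear_combination ((jacobiSym 2 d : ℂ) * e (n * h / f) * e (n * u / 4)) * hrec +
    ((jacobiSym h f : ℂ) * e (n * h / f)) * hone

/-- The summand for the pair `(0, 1/2)`: the upper left entry `a`, written as `8h + fq`, contributes
the summand of the Gauss sum at `h`, and the characters modulo `8` combine to `e(n/8)`. -/
lemma zero_half_summand {n : ℤ} (hn : n % 4 = 1) {f g a α : ℕ} (hf : Odd f)
    (hdet : a * α = 1 + 2 * g * f) {h q : ℤ} (ha : (a : ℤ) = 8 * h + f * q) :
    (jacobiSym (-(4 * g)) (α + 2 * g) : ℂ) * eps (α + 2 * g : ℕ) * e (n * a / (8 * f)) =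
      e (n / 8) * ((eps f)⁻¹ * ((jacobiSym h f : ℂ) * e (n * h / f))) := by
  have hfR : (f : ℝ) ≠ 0 := by exact_mod_cast hf.pos.ne'
  have hf8 := odd_sq_mod_eight hf
  have hprod : Odd (a * α) := by rw [hdet, mul_assoc]; exact ⟨g * f, by ring⟩
  obtain ⟨hao, hαo⟩ := Nat.odd_mul.1 hprod
  have hf2 := Nat.odd_iff.1 hf
  have ha2 := Nat.odd_iff.1 hao
  have hα2 := Nat.odd_iff.1 hαo
  obtain ⟨d, hd⟩ : ∃ d, d = α + 2 * g := ⟨_, rfl⟩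
  have hdodd : Odd d := Nat.odd_iff.2 (by omega)
  have hdetZ : (a : ℤ) * α = 1 + 2 * g * f := by exact_mod_cast hdet
  have hcoaf : f.Coprime a := by
    rw [← Nat.isCoprime_iff_coprime]; exact ⟨-2 * g, α, by linear_combination hdetZ⟩
  have hcoαd : α.Coprime d := by
    rw [← Nat.isCoprime_iff_coprime]
    exact ⟨a + f, -f, by rw [hd]; push_cast; linear_combination hdetZ⟩
  have hcofx : f.Coprime (a * α) := by
    rw [← Nat.isCoprime_iff_coprime]; exact ⟨-2 * g, 1, by push_cast; linear_combination hdetZ⟩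
  have hJ : jacobiSym (-(4 * g)) d = jacobiSym 2 d * jacobiSym α d := by
    rw [show (-(4 * g) : ℤ) = 2 * (-(2 * g)) by ring, jacobiSym.mul_left]
    congr 1
    refine jacobiSym.mod_left' (Int.modEq_iff_dvd.2 ⟨1, ?_⟩)
    rw [hd]; push_cast; ring
  have hJ1 : jacobiSym d α * jacobiSym f α = jacobiSym (-1) α := by
    rw [← jacobiSym.mul_left]
    refine jacobiSym.mod_left' (Int.modEq_iff_dvd.2 ⟨-a - f, ?_⟩)
    rw [hd]; push_cast; linear_combination hdetZ
  have hJ2 : jacobiSym f (a * α) = jacobiSym f a * jacobiSym f α := by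
    have : NeZero a := ⟨hao.pos.ne'⟩
    have : NeZero α := ⟨hαo.pos.ne'⟩
    exact jacobiSym.mul_right _ _ _
  have hJ3 : jacobiSym (a * α : ℕ) f = 1 := by
    rw [← jacobiSym.one_left f]
    refine jacobiSym.mod_left' (Int.modEq_iff_dvd.2 ⟨-2 * g, ?_⟩)
    push_cast; linear_combination -hdetZ
  have hJ4 : jacobiSym a f = jacobiSym 2 f * jacobiSym h f := by
    rw [← jacobiSym.mul_left, ← jacobiSym_four_mul (2 * h) hf]
    refine jacobiSym.mod_left' (Int.modEq_iff_dvd.2 ⟨-q, ?_⟩)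
    rw [ha]; ring
  have hr1 := jacobiSym_reciprocity hαo hdodd hcoαd
  have hr2 := jacobiSym_reciprocity hf hprod hcofx
  have hr3 := jacobiSym_reciprocity hf hao hcoaf
  have hid := chi_eps_identity (α := α) (a := a) (f := f) (d := d) (g := g) (by omega) (by omega)
    hdetZ (by rw [hd]; push_cast; ring)
  have hneg := jacobiSym_neg_one_mul_eps hαo
  have hfa : ((f * a : ℕ) : ℤ) % 2 = 1 := by
    have := Nat.odd_iff.1 (hf.mul hao)
    omega
  have hL := e_eighth_mul_chi_eps hn hfa
  have hchi : (ZMod.χ₈ ((f * a : ℕ) : ℤ) : ℂ) = jacobiSym 2 f * ZMod.χ₈ (a : ℤ) := by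
    rw [jacobiSym.at_two hf]
    push_cast
    rw [map_mul, Int.cast_mul]
  have hchid : (ZMod.χ₈ (d : ℤ) : ℂ) = jacobiSym 2 d := by
    rw [jacobiSym.at_two hdodd]; push_cast; rfl
  obtain ⟨t, ht⟩ : ∃ t, (f : ℤ) ^ 2 = 1 + 8 * t := ⟨(f : ℤ) ^ 2 / 8, by omega⟩
  have haR : (a : ℝ) = 8 * h + f * q := by exact_mod_cast ha
  have he1 : e (n * ((f * a : ℕ) : ℤ) / 8) = e (n * q / 8) := by
    refine e_eq_of_sub_intCast (n * (f * h + t * q)) ?_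
    have htR : (f : ℝ) ^ 2 = 1 + 8 * t := by exact_mod_cast ht
    push_cast; rw [haR]
    linear_combination (n * q / 8 : ℝ) * htR
  have he2 : e (n * a / (8 * f)) = e (n * h / f) * e (n * q / 8) := by
    rw [← e_add]
    congr 1
    rw [haR]; field_simp
  rw [he1, hchi] at hL
  rw [← hd, hJ, he2, ← hL]
  have hcofa : (jacobiSym f a : ℂ) * jacobiSym f a = 1 := jacobiSym_mul_self hcoaf
  have hcofα : (jacobiSym f α : ℂ) * jacobiSym f α = 1 :=
    jacobiSym_mul_self (hcofx.coprime_dvd_right ⟨a, mul_comm _ _⟩)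
  have hNN : (jacobiSym (-1) α : ℂ) * jacobiSym (-1) α = 1 := by
    rw [← Int.cast_mul, ← jacobiSym.mul_left]; simp
  have hχa : (ZMod.χ₈ (a : ℤ) : ℂ) * ZMod.χ₈ (a : ℤ) = 1 := by
    have h1 : ZMod.χ₈ (a : ℤ) = jacobiSym 2 a := by
      rw [jacobiSym.at_two hao]; push_cast; rfl
    rw [h1]
    exact jacobiSym_mul_self (Nat.coprime_two_left.2 hao)
  have hef := eps_ne_zero f
  have hea := eps_ne_zero a
  have heα := eps_ne_zero α
  have hex := eps_ne_zero (a * α : ℕ)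
  have hmain : (jacobiSym 2 d : ℂ) * jacobiSym α d * eps d =
      jacobiSym 2 f * ZMod.χ₈ (a : ℤ) * eps (f * a : ℕ) * (eps f)⁻¹ * jacobiSym h f := by
    have hJ1' : (jacobiSym d α : ℂ) * jacobiSym f α = jacobiSym (-1) α := by exact_mod_cast hJ1
    have hJ2' : (jacobiSym f (a * α) : ℂ) = jacobiSym f a * jacobiSym f α := by exact_mod_cast hJ2
    have hJ4' : (jacobiSym a f : ℂ) = jacobiSym 2 f * jacobiSym h f := by exact_mod_cast hJ4
    rw [hJ3, hJ2', Int.cast_one, mul_one] at hr2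
    rw [hJ4'] at hr3
    rw [hchid] at hid
    have hNe : (jacobiSym (-1) α : ℂ) * (eps α * eps α) = 1 := by
      rw [← mul_assoc, hneg, inv_mul_cancel₀ heα]
    push_cast at hr1 hr2 hr3 hid hex hχa ⊢
    rw [mul_comm (f : ℤ) (a * α : ℤ)] at hr2
    generalize eps (f : ℤ) = ef at *
    generalize eps (a : ℤ) = ea at *
    generalize eps (α : ℤ) = eα at *
    generalize eps (d : ℤ) = ed at *
    generalize eps (a * α : ℤ) = ex at *
    generalize eps (a * α * f : ℤ) = exf at *
    generalize eps (f * a : ℤ) = efa at *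
    generalize eps (α * d : ℤ) = eαd at *
    generalize (jacobiSym (-1) α : ℂ) = N at *
    generalize (jacobiSym d α : ℂ) = Jdα at *
    generalize (jacobiSym f α : ℂ) = Jfα at *
    generalize (jacobiSym f a : ℂ) = Jfa at *
    generalize (jacobiSym α d : ℂ) = Jαd at *
    generalize (jacobiSym 2 d : ℂ) = χd at *
    generalize (ZMod.χ₈ (a : ZMod 8) : ℂ) = χa at *
    have h1 : Jαd * ed = eαd * eα * Jfα := by
      refine mul_right_cancel₀ heα ?_
      have h2 : eα * eα = N := by linear_combination N * hNe - eα * eα * hNN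
      linear_combination hr1 + eαd * Jfα * h2 * (-1) - eαd * Jdα * hcofα + eαd * Jfα * hJ1'
    have h3 : Jfα * (ef * ex * ef * ea) = exf * efa * (jacobiSym 2 f * jacobiSym h f) := by
      linear_combination Jfa * ef * ea * hr2 + exf * hr3 - Jfα * ef * ex * ef * ea * hcofa
    have h4 : χd * Jαd * ed * (ef * ex * ef * ea) =
        χa * efa * ef * (jacobiSym 2 f * jacobiSym h f) * (ex * ea) := by
      linear_combination χd * (ef * ex * ef * ea) * h1 + χd * eαd * eα * h3 +
        χa * efa * (jacobiSym 2 f * jacobiSym h f) * hid -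
        χd * eαd * eα * exf * efa * (jacobiSym 2 f * jacobiSym h f) * hχa
    field_simp
    refine mul_right_cancel₀ (mul_ne_zero (mul_ne_zero hef hex) hea) ?_
    linear_combination h4
  rw [Int.cast_mul]
  linear_combination (e (n * h / f) * e (n * q / 8)) * hmain

lemma gauss_eq_sum_coprime_affine (n : ℤ) {f : ℕ} (hf : 0 < f) {u : ℤ} (hu : IsCoprime u f)
    (t : ℤ) {p : ℕ → Prop} [DecidablePred p]
    (hp : ∀ b, ¬ p b → ¬ Int.gcd (u * b + t) f = 1) :
    gauss n f = ∑ b ∈ (Finset.range f).filter p,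
      (eps f)⁻¹ * ((jacobiSym (u * b + t) f : ℂ) * e (n * (u * b + t : ℤ) / f)) := by
  have hper := sum_range_periodic_affine (F := fun x => (eps f)⁻¹ *
    ((jacobiSym x f : ℂ) * e (n * x / f))) hf (fun x => by
      simp only [gauss_summand_periodic n hf]) hu t
  rw [gauss, Finset.mul_sum]
  simp only [Int.cast_natCast] at hper
  rw [← hper, Finset.sum_filter]
  refine Finset.sum_congr rfl fun b _ => ?_
  split_ifs with h
  · rfl
  · rw [jacobiSym.eq_zero_iff.2 ⟨hf.ne', hp b h⟩]; simp

/-- The double cosets of modulus `2f` are indexed by `g`, where `-4g` is the lower left entry. The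
second index `n/4 + 3/4` becomes `n/4` after subtracting `κ_{1/2} = 3/4`. -/
lemma kloosterman_infinity_half {n : ℤ} (hn : n % 4 = 1) {f : ℕ} (hf : Odd f) :
    kloosterman .infinity .half 0 (n / 4 + 3 / 4 : ℝ) (2 * f : ℕ) = gauss n f := by
  have hf0 : (0 : ℤ) < f := by exact_mod_cast hf.pos
  have hfR : (0 : ℝ) < f := by exact_mod_cast hf.pos
  have hf2 := Nat.odd_iff.1 hf
  have hmem : ∀ A : SL(2, ℤ), A ∈ cosetReps .infinity .half ((2 * f : ℕ) : ℝ) ↔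
      (4 : ℤ) ∣ A 1 0 ∧ A 1 0 + 2 * A 1 1 = 2 * f ∧
        (0 ≤ A 0 0 + 2 * A 0 1 ∧ A 0 0 + 2 * A 0 1 < 2 * f) ∧
        (A 1 0 ≤ 0 ∧ -(4 * f) < A 1 0) := fun A => by
    rw [mem_cosetReps_iff, conj_infinity_half]
    change _ ∧ ((A 1 0 : ℝ) + 2 * A 1 1 = _) ∧ (0 ≤ (A 0 0 : ℝ) + 2 * (A 0 1 : ℝ) ∧
      (A 0 0 : ℝ) + 2 * (A 0 1 : ℝ) < _) ∧ (0 ≤ -(A 1 0 : ℝ) / 2 ∧ -(A 1 0 : ℝ) / 2 < _) ↔ _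
    simp only [← Int.cast_inj (α := ℝ), ← Int.cast_le (R := ℝ), ← Int.cast_lt (R := ℝ)]
    push_cast
    refine and_congr Iff.rfl (and_congr ?_ (and_congr (and_congr ?_ ?_) (and_congr ?_ ?_))) <;>
      constructor <;> intro h <;> linarith
  have hco4 : IsCoprime (4 : ℤ) f := by
    have := Nat.isCoprime_iff_coprime.2 (Nat.Coprime.pow_left 2 (Nat.coprime_two_left.2 hf))
    simpa using this
  -- `u` inverts `4` modulo `f`, so that `g = 4 (u g) + f (-v g)`
  obtain ⟨u, v, -, -, huv⟩ := exists_mul_eq_one_add hf0 hco4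
  have hu : IsCoprime u f := ⟨4, -v, by linear_combination huv⟩
  rw [gauss_eq_sum_coprime_affine n hf.pos hu 0 (p := Nat.Coprime f) (fun b hb hgcd => hb (by
    have h1 : IsCoprime (u * b : ℤ) f := by
      rw [Int.isCoprime_iff_gcd_eq_one]; simpa using hgcd
    exact (Nat.isCoprime_iff_coprime.1 (IsCoprime.of_mul_left_right h1)).symm))]
  refine kloosterman_eq_sum (Or.inl rfl) (by exact_mod_cast (by linarith [hf.pos] : 0 < 2 * f)) _ _
    (fun A => -A 1 0 / 4) (fun A hA => ?_) (fun A hA B hB h => ?_) fun j hj => ?_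
  · obtain ⟨⟨c, hc⟩, h11, -, hb0, hb1⟩ := (hmem A).1 hA
    have hdet := det_eq_one A
    obtain ⟨g, hg⟩ := Int.eq_ofNat_of_zero_le (show 0 ≤ -c by omega)
    have h10 : A 1 0 = -(4 * g) := by omega
    have hd : A 1 1 = (f + 2 * g : ℕ) := by push_cast; omega
    rw [hd, h10] at hdet
    have hco : Nat.Coprime f g := by
      rw [← Nat.isCoprime_iff_coprime]
      exact ⟨A 0 0, 4 * A 0 1 + 2 * A 0 0, by push_cast at hdet; linear_combination hdet⟩
    refine ⟨g, by simp only [Finset.mem_filter, Finset.mem_range]; exact ⟨by omega, hco⟩,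
      by rw [h10]; omega, ?_⟩
    rw [add_zero, ← infinity_half_summand hn hf hco (h := u * g) (u := -v * g)
      (by linear_combination -(g : ℤ) * huv), conj_nuTheta, conj_infinity_half, h10, hd,
      shimuraSymbol, if_neg (by omega), Int.natAbs_natCast]
    have harg : ((n : ℝ) / 4 + 3 / 4 - kappa .half) * (-((-(4 * (g : ℤ)) : ℤ) : ℝ) / 2) /
        (2 * f : ℕ) = n * g / (4 * f) := by
      rw [kappa]; push_cast; field_simp; ring
    change _ * e (((n : ℝ) / 4 + 3 / 4 - kappa .half) * (-((-(4 * (g : ℤ)) : ℤ) : ℝ) / 2) /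
      (2 * f : ℕ)) = _
    rw [harg]
  · obtain ⟨⟨c, hc⟩, h11, ⟨ha, ha'⟩, -⟩ := (hmem A).1 hA
    obtain ⟨⟨c', hc'⟩, h11', ⟨hb, hb'⟩, -⟩ := (hmem B).1 hB
    have hA1 := det_eq_one A
    have hB1 := det_eq_one B
    have h10 : A 1 0 = B 1 0 := by
      change -A 1 0 / 4 = -B 1 0 / 4 at h
      omega
    have hd : A 1 1 = B 1 1 := by omega
    rw [hd, h10] at hA1
    have hα : A 0 0 + 2 * A 0 1 = B 0 0 + 2 * B 0 1 := eq_of_mul_eq_one_add (x := B 1 1)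
      (M := 2 * f) (t := A 0 1) (t' := B 0 1) ha ha' hb hb'
      (by linear_combination hA1 + A 0 1 * h11') (by linear_combination hB1 + B 0 1 * h11')
    have h01 : A 0 1 = B 0 1 := by
      refine mul_right_cancel₀ (show (2 * f : ℤ) ≠ 0 by positivity) ?_
      linear_combination hB1 - hA1 + B 1 1 * hα - (A 0 1 - B 0 1) * h11'
    exact ext_entries (by linarith) h01 h10 hd
  · simp only [Finset.mem_filter, Finset.mem_range] at hj
    have hco : IsCoprime ((f + 2 * j : ℕ) : ℤ) (2 * f : ℕ) := by
      rw [Nat.isCoprime_iff_coprime]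
      refine Nat.Coprime.mul_right (Nat.coprime_two_right.2 (Nat.odd_iff.2 (by omega))) ?_
      rw [Nat.coprime_self_add_left]
      exact Nat.Coprime.mul_left (Nat.coprime_two_left.2 hf) hj.2.symm
    push_cast at hco
    obtain ⟨y, t, h0, h1, h⟩ := exists_mul_eq_one_add (by positivity) hco
    refine ⟨⟨!![y - 2 * t, t; -(4 * j), (f + 2 * j : ℤ)], by
      rw [Matrix.det_fin_two_of]; linear_combination h⟩,
      (hmem _).2 ⟨(show (4 : ℤ) ∣ -(4 * (j : ℤ)) from (Dvd.intro _ rfl).neg_right), ?_, ⟨?_, ?_⟩, ?_, ?_⟩, ?_⟩ <;> simp <;> omega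

/-- The double cosets of modulus `2f` are indexed by the odd upper left entries `2j + 1`. -/
lemma kloosterman_zero_half {n : ℤ} (hn : n % 4 = 1) {f : ℕ} (hf : Odd f) :
    kloosterman .zero .half 0 (n / 4 + 3 / 4 : ℝ) (2 * f : ℕ) = e (n / 8) * gauss n f := by
  have hf0 : (0 : ℤ) < f := by exact_mod_cast hf.pos
  have hfR : (0 : ℝ) < f := by exact_mod_cast hf.pos
  have hf2 := Nat.odd_iff.1 hf
  have hmem : ∀ A : SL(2, ℤ), A ∈ cosetReps .zero .half ((2 * f : ℕ) : ℝ) ↔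
      (4 : ℤ) ∣ A 1 0 ∧ A 0 0 + 2 * A 0 1 = -f ∧
        (0 ≤ A 1 0 + 2 * A 1 1 ∧ A 1 0 + 2 * A 1 1 < 4 * f) ∧
        (0 ≤ A 0 0 ∧ A 0 0 < 2 * f) := fun A => by
    rw [mem_cosetReps_iff, conj_zero_half]
    change _ ∧ (-2 * ((A 0 0 : ℝ) + 2 * A 0 1) = _) ∧ (0 ≤ (A 1 0 : ℝ) / 2 + (A 1 1 : ℝ) ∧
      (A 1 0 : ℝ) / 2 + (A 1 1 : ℝ) < _) ∧ (0 ≤ (A 0 0 : ℝ) ∧ (A 0 0 : ℝ) < _) ↔ _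
    simp only [← Int.cast_inj (α := ℝ), ← Int.cast_le (R := ℝ), ← Int.cast_lt (R := ℝ)]
    push_cast
    refine and_congr Iff.rfl (and_congr ?_ (and_congr (and_congr ?_ ?_) (and_congr ?_ ?_))) <;>
      constructor <;> intro h <;> linarith
  have hco8 : IsCoprime (8 : ℤ) f := by
    have := Nat.isCoprime_iff_coprime.2 (Nat.Coprime.pow_left 3 (Nat.coprime_two_left.2 hf))
    simpa using this
  -- `u` inverts `8` modulo `f`, so that `a = 8 u (a - f) + f (1 - v (a - f))` for `a = 2j + 1`
  obtain ⟨u, v, -, -, huv⟩ := exists_mul_eq_one_add hf0 hco8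
  have hu : IsCoprime (2 * u) f := ⟨4, -v, by linear_combination huv⟩
  rw [gauss_eq_sum_coprime_affine n hf.pos hu (u * (1 - f)) (p := fun b => Nat.Coprime f (2 * b + 1))
    (fun b hb hgcd => hb (by
    have h1 : IsCoprime (u * ((2 * b + 1 : ℕ) - f) : ℤ) f := by
      rw [Int.isCoprime_iff_gcd_eq_one,
        show u * ((2 * b + 1 : ℕ) - f : ℤ) = 2 * u * b + u * (1 - f) by push_cast; ring, hgcd]
    have h2 := (IsCoprime.of_mul_left_right h1).add_mul_right_left 1
    exact (Nat.isCoprime_iff_coprime.1 (by simpa using h2)).symm)), Finset.mul_sum]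
  refine kloosterman_eq_sum (Or.inr rfl) (by exact_mod_cast (by linarith [hf.pos] : 0 < 2 * f)) _ _
    (fun A => A 0 0 / 2) (fun A hA => ?_) (fun A hA B hB h => ?_) fun j hj => ?_
  · obtain ⟨⟨c, hc⟩, h00, ⟨hα, -⟩, ha0, ha1⟩ := (hmem A).1 hA
    have hdet := det_eq_one A
    obtain ⟨a, ha⟩ := Int.eq_ofNat_of_zero_le ha0
    obtain ⟨α, hα⟩ := Int.eq_ofNat_of_zero_le (show 0 ≤ 2 * c + A 1 1 by omega)
    have hdetα : (a : ℤ) * α = 1 + 2 * -c * f := by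
      linear_combination hdet - (α : ℤ) * ha - A 0 0 * hα + A 0 1 * hc + 2 * c * h00
    have hcpos : 0 ≤ -c := by
      have : (0 : ℤ) ≤ a * α := by positivity
      nlinarith
    obtain ⟨g, hg⟩ := Int.eq_ofNat_of_zero_le hcpos
    have h10 : A 1 0 = -(4 * g) := by omega
    have hd : A 1 1 = (α + 2 * g : ℕ) := by push_cast; omega
    obtain ⟨j, hj⟩ : ∃ j : ℕ, a = 2 * j + 1 := ⟨a / 2, by omega⟩
    rw [hg] at hdetα
    have hco : Nat.Coprime f a := by
      rw [← Nat.isCoprime_iff_coprime]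
      exact ⟨-2 * g, α, by linear_combination hdetα⟩
    refine ⟨j, by
      simp only [Finset.mem_filter, Finset.mem_range, ← hj]; exact ⟨by omega, hco⟩, by omega, ?_⟩
    have hju : 2 * u * j + u * (1 - f) = u * (a - f) := by rw [hj]; push_cast; ring
    rw [hju, ← zero_half_summand hn hf (a := a) (α := α) (g := g) (by zify; exact hdetα)
      (h := u * (a - f)) (q := 1 - v * (a - f)) (by linear_combination -((a : ℤ) - f) * huv),
      conj_nuTheta, conj_zero_half, h10, hd, shimuraSymbol, if_neg (by omega), Int.natAbs_natCast]
    have harg : ((n : ℝ) / 4 + 3 / 4 - kappa .half) * (A 0 0 : ℝ) / (2 * f : ℕ) =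
        n * a / (8 * f) := by
      rw [kappa, ha]; push_cast; field_simp; ring
    change _ * e (((n : ℝ) / 4 + 3 / 4 - kappa .half) * (A 0 0 : ℝ) / (2 * f : ℕ)) = _
    rw [harg]
  · obtain ⟨⟨c, hc⟩, h00, ⟨ha, ha'⟩, -⟩ := (hmem A).1 hA
    obtain ⟨⟨c', hc'⟩, h00', ⟨hb, hb'⟩, -⟩ := (hmem B).1 hB
    have hA1 := det_eq_one A
    have hB1 := det_eq_one B
    have hAB : A 0 0 = B 0 0 := by
      change A 0 0 / 2 = B 0 0 / 2 at h
      omega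
    have h01 : A 0 1 = B 0 1 := by omega
    rw [hAB, h01, hc] at hA1
    rw [hc'] at hB1
    have hα : 2 * c + A 1 1 = 2 * c' + B 1 1 := eq_of_mul_eq_one_add (x := B 0 0)
      (M := 2 * f) (t := -c) (t' := -c') (by omega) (by omega) (by omega) (by omega)
      (by linear_combination hA1 + 2 * c * h00') (by linear_combination hB1 + 2 * c' * h00')
    have hcc : c = c' := by
      refine mul_right_cancel₀ (show (2 * f : ℤ) ≠ 0 by positivity) ?_
      linear_combination hA1 - hB1 - B 0 0 * hα + 2 * (c - c') * h00'
    exact ext_entries hAB h01 (by omega) (by omega)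
  · simp only [Finset.mem_filter, Finset.mem_range] at hj
    have hco : IsCoprime ((2 * j + 1 : ℕ) : ℤ) (2 * f : ℕ) := by
      rw [Nat.isCoprime_iff_coprime]
      exact Nat.Coprime.mul_right (Nat.coprime_two_right.2 (Nat.odd_iff.2 (by omega))) hj.2.symm
    push_cast at hco
    obtain ⟨y, t, h0, h1, h⟩ := exists_mul_eq_one_add (by positivity) hco
    obtain ⟨b, hb⟩ : ∃ b : ℤ, 2 * b = -f - (2 * j + 1) := ⟨(-f - (2 * j + 1)) / 2, by omega⟩
    refine ⟨⟨!![(2 * j + 1 : ℤ), b; -(4 * t), y + 2 * t], by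
      rw [Matrix.det_fin_two_of]; linear_combination h + 2 * t * hb⟩,
      (hmem _).2 ⟨(show (4 : ℤ) ∣ -(4 * t) from (Dvd.intro _ rfl).neg_right), ?_, ⟨?_, ?_⟩, ?_, ?_⟩, ?_⟩ <;> simp <;> omega

/-! ### Factorization of the theta Kloosterman sum -/

lemma chi_pow_congr {x y : ℤ} (hx : x % 2 = 1) {i : ℕ} (h : (2 : ℤ) ^ (i + 2) ∣ x - y) :
    ZMod.χ₈ x ^ (i + 2) = ZMod.χ₈ y ^ (i + 2) := by
  rcases i with _ | i
  · have hy : y % 2 = 1 := by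
      have : (2 : ℤ) ∣ x - y := (Dvd.intro 2 (by norm_num)).trans h
      omega
    have hsq : ∀ x : ℤ, x % 2 = 1 → ZMod.χ₈ x ^ 2 = 1 := fun x hx => by
      rw [ZMod.χ₈_int_eq_if_mod_eight, if_neg (by omega)]; split_ifs <;> rfl
    rw [hsq x hx, hsq y hy]
  · have h8 : (8 : ℤ) ∣ x - y := (Dvd.intro (2 ^ i) (by ring)).trans h
    rw [(ZMod.intCast_eq_intCast_iff' x y 8).2 (by push_cast; omega)]

lemma jacobiSym_mul_eps {f d : ℕ} (hf : Odd f) (hd : Odd d) :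
    (jacobiSym f d : ℂ) * eps d = eps (f * d : ℕ) * (eps f)⁻¹ * jacobiSym d f := by
  by_cases hco : f.Coprime d
  · have h := jacobiSym_reciprocity hf hd hco
    have hef := eps_ne_zero f
    field_simp
    linear_combination h
  · rw [jacobiSym.eq_zero_iff.2 ⟨hd.pos.ne', by simpa using hco⟩,
      jacobiSym.eq_zero_iff.2 ⟨hf.pos.ne', by simpa [Nat.gcd_comm] using hco⟩]
    simp

/-- Factorization along `4k = 2^(i+2) f`: reciprocity moves the symbol `(f/d)` to `(d/f)`, and the
Chinese remainder theorem separates the two moduli. -/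
lemma thetaSum_eq (n : ℤ) (i : ℕ) {f : ℕ} (hf : Odd f) :
    thetaSum n (2 ^ i * f) = gaussTwo n (i + 2) * gauss n f := by
  have hf2 := Nat.odd_iff.1 hf
  have hfR : (f : ℝ) ≠ 0 := by exact_mod_cast hf.pos.ne'
  have hfsq := odd_sq_mod_eight hf
  have h4f : 4 * (2 ^ i * f) = 2 ^ (i + 2) * f := by ring
  have hco : (2 ^ (i + 2)).Coprime f := Nat.Coprime.pow_left _ (Nat.coprime_two_left.2 hf)
  let F : ℤ → ℂ := fun x => if x % 2 = 1 then (ZMod.χ₈ x : ℂ) ^ (i + 2) * eps (f * x) * (eps f)⁻¹ *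
    jacobiSym x f * e (n * x / (2 ^ (i + 2) * f)) else 0
  have hF : ∀ x, F (x + (2 ^ (i + 2) * f : ℕ)) = F x := fun x => by
    have h2 : (x + (2 ^ (i + 2) * f : ℕ)) % 2 = x % 2 := by
      have : (2 ^ (i + 2) * f : ℕ) = 2 * (2 ^ (i + 1) * f) := by ring
      omega
    simp only [F, h2]
    split_ifs with hx
    · have h1 : ((ZMod.χ₈ ((x + (2 ^ (i + 2) * f : ℕ) : ℤ) : ZMod 8) : ℤ) : ℂ) ^ (i + 2) =
          (ZMod.χ₈ x : ℂ) ^ (i + 2) := by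
        exact_mod_cast chi_pow_congr (h2.trans hx) (i := i) ⟨f, by push_cast; ring⟩
      have h3 : eps (f * (x + (2 ^ (i + 2) * f : ℕ))) = eps (f * x) := eps_congr (by
        have : (f : ℤ) * (x + (2 ^ (i + 2) * f : ℕ)) = f * x + 4 * (2 ^ i * f * f) := by
          push_cast; ring
        omega)
      have h4 : jacobiSym (x + (2 ^ (i + 2) * f : ℕ)) f = jacobiSym x f :=
        jacobiSym.mod_left' (by push_cast; exact Int.add_mul_emod_self_right _ _ _)
      rw [h1, h3, h4]
      congr 1
      exact e_eq_of_sub_intCast n (by push_cast; field_simp)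
    · rfl
  have hsum : thetaSum n (2 ^ i * f) = ∑ x ∈ Finset.range (2 ^ (i + 2) * f), F x := by
    rw [thetaSum, h4f, Finset.sum_filter]
    refine Finset.sum_congr rfl fun d _ => ?_
    simp only [F]
    by_cases hd : Odd d
    · have hd2 := Nat.odd_iff.1 hd
      rw [if_pos hd, if_pos (by omega)]
      have hχ : (ZMod.χ₈ (d : ℤ) : ℂ) = jacobiSym 2 d := by
        rw [jacobiSym.at_two hd]; push_cast; rfl
      have hsq : (jacobiSym 2 d : ℂ) * jacobiSym 2 d = 1 :=
        jacobiSym_mul_self (Nat.coprime_two_left.2 hd)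
      have h := jacobiSym_mul_eps hf hd
      rw [hχ, Nat.cast_mul, jacobiSym.mul_left, Nat.cast_pow, jacobiSym.pow_left]
      push_cast at h ⊢
      have hpow : (jacobiSym 2 d : ℂ) ^ (i + 2) = (jacobiSym 2 d : ℂ) ^ i := by
        rw [pow_add, pow_two, hsq, mul_one]
      rw [hpow]
      linear_combination (jacobiSym 2 d : ℂ) ^ i * e (n * d / (2 ^ (i + 2) * f)) * h
    · have hd2 := Nat.not_odd_iff.1 hd
      rw [if_neg hd, if_neg (by omega)]
  rw [hsum, sum_range_mul_of_coprime (by positivity) hf.pos hco hF, gaussTwo, gauss,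
    Finset.mul_sum, Finset.sum_filter, Finset.sum_mul]
  refine Finset.sum_congr rfl fun a _ => ?_
  rw [Finset.mul_sum]
  refine Finset.sum_congr rfl fun b _ => ?_
  have hpar : ((a * f + b * (2 ^ (i + 2) : ℕ) : ℤ)) % 2 = a % 2 := by
    have h1 : (a * f + b * (2 ^ (i + 2) : ℕ) : ℤ) = a * f + 2 * (b * 2 ^ (i + 1)) := by
      push_cast; ring
    have h2 : (a * f : ℤ) % 2 = a % 2 := by
      rw [Int.mul_emod, show (f : ℤ) % 2 = 1 by omega, mul_one, Int.emod_emod]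
    omega
  simp only [F, hpar]
  by_cases ha : Odd a
  · have ha2 := Nat.odd_iff.1 ha
    rw [if_pos ha, if_pos (by omega)]
    have h1 : ((ZMod.χ₈ ((a * f + b * (2 ^ (i + 2) : ℕ) : ℤ) : ZMod 8) : ℤ) : ℂ) ^ (i + 2) =
        (jacobiSym 2 a : ℂ) ^ (i + 2) * (jacobiSym 2 f : ℂ) ^ (i + 2) := by
      rw [← mul_pow, ← Int.cast_mul, jacobiSym.at_two ha, jacobiSym.at_two hf, ← map_mul]
      have := chi_pow_congr (x := a * f + b * (2 ^ (i + 2) : ℕ)) (y := a * f) (i := i)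
        (by rw [hpar]; omega) ⟨b, by push_cast; ring⟩
      push_cast at this ⊢
      exact_mod_cast this
    have h2 : eps (f * (a * f + b * (2 ^ (i + 2) : ℕ))) = eps a := eps_congr (by
      obtain ⟨t, ht⟩ : ∃ t, (f : ℤ) ^ 2 = 1 + 8 * t := ⟨(f : ℤ) ^ 2 / 8, by omega⟩
      have : (f : ℤ) * (a * f + b * (2 ^ (i + 2) : ℕ)) = a + 4 * (2 * t * a + f * b * 2 ^ i) := by
        push_cast; linear_combination (a : ℤ) * ht
      omega)
    have h3 : jacobiSym (a * f + b * (2 ^ (i + 2) : ℕ)) f =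
        jacobiSym 2 f ^ (i + 2) * jacobiSym b f := by
      rw [← jacobiSym.pow_left, ← jacobiSym.mul_left]
      refine jacobiSym.mod_left' (Int.modEq_iff_dvd.2 ⟨-a, ?_⟩)
      push_cast; ring
    have h4 : e (n * ((a * f + b * (2 ^ (i + 2) : ℕ) : ℤ) : ℝ) / (2 ^ (i + 2) * f)) =
        e (n * a / (2 ^ (i + 2) : ℕ)) * e (n * b / f) := by
      rw [← e_add]; congr 1; push_cast; field_simp
    have h5 : ((jacobiSym 2 f : ℂ) ^ (i + 2)) * (jacobiSym 2 f : ℂ) ^ (i + 2) = 1 := by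
      rw [← mul_pow, show (jacobiSym 2 f : ℂ) * jacobiSym 2 f = 1 from
        jacobiSym_mul_self (Nat.coprime_two_left.2 hf), one_pow]
    rw [h1, h2, h3, h4]
    push_cast
    linear_combination (jacobiSym 2 a : ℂ) ^ (i + 2) * eps a * (eps f)⁻¹ * jacobiSym b f *
      e (n * a / 2 ^ (i + 2)) * e (n * b / f) * h5
  · have ha2 := Nat.not_odd_iff.1 ha
    rw [if_neg ha, if_neg (by omega), zero_mul]

/-! ### The sets of moduli -/

lemma mem_moduli_iff {a b : Cusp} {c : ℝ} :
    c ∈ moduli a b ↔ 0 < c ∧ ∃ A : SL(2, ℤ), (4 : ℤ) ∣ A 1 0 ∧ (conj a b A).1 1 0 = c := by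
  simp only [← mem_gamma0_four_iff]; rfl

lemma moduli_infinity_infinity (c : ℝ) :
    c ∈ moduli .infinity .infinity ↔ ∃ k : ℕ, 0 < k ∧ c = (4 * k : ℕ) := by
  rw [mem_moduli_iff]
  constructor
  · rintro ⟨h0, A, ⟨k, hk⟩, hc⟩
    rw [conj_infinity_infinity] at hc
    change (A 1 0 : ℝ) = c at hc
    rw [← hc, Int.cast_pos] at h0
    obtain ⟨m, rfl⟩ := Int.eq_ofNat_of_zero_le (show 0 ≤ k by omega)
    exact ⟨m, by omega, by rw [← hc, hk]; push_cast; rfl⟩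
  · rintro ⟨k, hk, rfl⟩
    refine ⟨by positivity, ⟨!![1, 0; 4 * k, 1], by simp⟩, Dvd.intro _ rfl, ?_⟩
    refine (congrFun (congrFun (conj_infinity_infinity _) 1) 0).trans ?_
    change ((4 * (k : ℤ) : ℤ) : ℝ) = _
    push_cast; rfl

lemma moduli_zero_zero (c : ℝ) :
    c ∈ moduli .zero .zero ↔ ∃ k : ℕ, 0 < k ∧ c = (4 * k : ℕ) := by
  rw [mem_moduli_iff]
  constructor
  · rintro ⟨h0, A, -, hc⟩
    rw [conj_zero_zero] at hc
    change -4 * (A 0 1 : ℝ) = c at hc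
    have hneg : A 0 1 < 0 := by
      have : (A 0 1 : ℝ) < 0 := by linarith
      exact_mod_cast this
    obtain ⟨m, hm⟩ := Int.eq_ofNat_of_zero_le (show 0 ≤ -A 0 1 by omega)
    refine ⟨m, by omega, ?_⟩
    rw [← hc, show A 0 1 = -m by omega]
    push_cast; ring
  · rintro ⟨k, hk, rfl⟩
    refine ⟨by positivity, ⟨!![1, -(k : ℤ); 0, 1], by simp⟩, dvd_zero _, ?_⟩
    refine (congrFun (congrFun (conj_zero_zero _) 1) 0).trans ?_
    change -4 * ((-(k : ℤ) : ℤ) : ℝ) = _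
    push_cast; ring

/-- Reduction of the description of the moduli `2f`, `f` odd, to integers. -/
lemma exists_odd_of_pos {x : ℤ} {c : ℝ} (hc : (2 : ℝ) * x = c) (h0 : 0 < c) (hx : x % 2 = 1) :
    ∃ f : ℕ, Odd f ∧ c = (2 * f : ℕ) := by
  have hpos : 0 < x := by
    have : (0 : ℝ) < x := by linarith
    exact_mod_cast this
  obtain ⟨f, rfl⟩ := Int.eq_ofNat_of_zero_le hpos.le
  exact ⟨f, Nat.odd_iff.2 (by omega), by rw [← hc]; push_cast; rfl⟩

lemma odd_diag_of_four_dvd {A : SL(2, ℤ)} (h : (4 : ℤ) ∣ A 1 0) :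
    A 0 0 % 2 = 1 ∧ A 1 1 % 2 = 1 := by
  obtain ⟨k, hk⟩ := h
  have hdet := det_eq_one A
  rw [hk] at hdet
  have hodd : Odd (A 0 0 * A 1 1) := ⟨2 * (A 0 1 * k), by linear_combination hdet⟩
  rw [Int.odd_mul, Int.odd_iff, Int.odd_iff] at hodd
  exact hodd

lemma moduli_zero_infinity (c : ℝ) :
    c ∈ moduli .zero .infinity ↔ ∃ f : ℕ, Odd f ∧ c = (2 * f : ℕ) := by
  rw [mem_moduli_iff]
  constructor
  · rintro ⟨h0, A, h4, hc⟩
    rw [conj_zero_infinity] at hc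
    change -2 * (A 0 0 : ℝ) = c at hc
    have := (odd_diag_of_four_dvd h4).1
    exact exists_odd_of_pos (x := -A 0 0) (by rw [← hc]; push_cast; ring) h0 (by omega)
  · rintro ⟨f, ⟨j, rfl⟩, rfl⟩
    refine ⟨by positivity, ⟨!![-(2 * j + 1 : ℤ), j * (j + 1); 4, -(2 * j + 1)], by
      rw [Matrix.det_fin_two_of]; ring⟩, dvd_rfl, ?_⟩
    refine (congrFun (congrFun (conj_zero_infinity _) 1) 0).trans ?_
    change -2 * ((-(2 * j + 1 : ℤ) : ℤ) : ℝ) = _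
    push_cast; ring

lemma moduli_infinity_zero (c : ℝ) :
    c ∈ moduli .infinity .zero ↔ ∃ f : ℕ, Odd f ∧ c = (2 * f : ℕ) := by
  rw [mem_moduli_iff]
  constructor
  · rintro ⟨h0, A, h4, hc⟩
    rw [conj_infinity_zero] at hc
    change 2 * (A 1 1 : ℝ) = c at hc
    exact exists_odd_of_pos hc h0 (odd_diag_of_four_dvd h4).2
  · rintro ⟨f, ⟨j, rfl⟩, rfl⟩
    refine ⟨by positivity, ⟨!![(2 * j + 1 : ℤ), j * (j + 1); 4, (2 * j + 1)], by
      rw [Matrix.det_fin_two_of]; ring⟩, dvd_rfl, ?_⟩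
    refine (congrFun (congrFun (conj_infinity_zero _) 1) 0).trans ?_
    change 2 * ((2 * j + 1 : ℤ) : ℝ) = _
    push_cast; ring

lemma moduli_infinity_half (c : ℝ) :
    c ∈ moduli .infinity .half ↔ ∃ f : ℕ, Odd f ∧ c = (2 * f : ℕ) := by
  rw [mem_moduli_iff]
  constructor
  · rintro ⟨h0, A, ⟨k, hk⟩, hc⟩
    rw [conj_infinity_half] at hc
    change (A 1 0 : ℝ) + 2 * (A 1 1 : ℝ) = c at hc
    have := (odd_diag_of_four_dvd ⟨k, hk⟩).2
    exact exists_odd_of_pos (x := 2 * k + A 1 1) (by rw [← hc, hk]; push_cast; ring) h0 (by omega)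
  · rintro ⟨f, ⟨j, rfl⟩, rfl⟩
    refine ⟨by positivity, ⟨!![(2 * j - 1 : ℤ), (j - 1) * j; 4, (2 * j - 1)], by
      rw [Matrix.det_fin_two_of]; ring⟩, dvd_rfl, ?_⟩
    refine (congrFun (congrFun (conj_infinity_half _) 1) 0).trans ?_
    change ((4 : ℤ) : ℝ) + 2 * ((2 * j - 1 : ℤ) : ℝ) = _
    push_cast; ring

lemma moduli_zero_half (c : ℝ) :
    c ∈ moduli .zero .half ↔ ∃ f : ℕ, Odd f ∧ c = (2 * f : ℕ) := by
  rw [mem_moduli_iff]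
  constructor
  · rintro ⟨h0, A, h4, hc⟩
    rw [conj_zero_half] at hc
    change -2 * ((A 0 0 : ℝ) + 2 * (A 0 1 : ℝ)) = c at hc
    have := (odd_diag_of_four_dvd h4).1
    exact exists_odd_of_pos (x := -(A 0 0 + 2 * A 0 1)) (by rw [← hc]; push_cast; ring) h0
      (by omega)
  · rintro ⟨f, ⟨j, rfl⟩, rfl⟩
    refine ⟨by positivity, ⟨!![1, -(j + 1 : ℤ); 0, 1], by simp⟩, dvd_zero _, ?_⟩
    refine (congrFun (congrFun (conj_zero_half _) 1) 0).trans ?_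
    change -2 * (((1 : ℤ) : ℝ) + 2 * ((-(j + 1 : ℤ) : ℤ) : ℝ)) = _
    push_cast; ring

/-! ### The Dirichlet series -/

lemma bijective_two_pow_mul_odd :
    Function.Bijective (fun p : {p : ℕ × ℕ // Odd p.1} =>
      (⟨2 ^ p.1.2 * p.1.1, Nat.mul_pos (by positivity) p.2.pos⟩ : {k : ℕ // 0 < k})) := by
  constructor
  · rintro ⟨⟨f, i⟩, hf⟩ ⟨⟨g, j⟩, hg⟩ h
    have h3 : 2 ^ i * f = 2 ^ j * g := congrArg Subtype.val h
    have h4 := congrArg (padicValNat 2) h3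
    have hv : ∀ (i f : ℕ), Odd f → padicValNat 2 (2 ^ i * f) = i := fun i f hf => by
      rw [padicValNat.mul (by positivity) hf.pos.ne', padicValNat.prime_pow,
        padicValNat.eq_zero_of_not_dvd (fun h => Nat.not_even_iff_odd.2 hf (even_iff_two_dvd.2 h)),
        add_zero]
    rw [hv i f hf, hv j g hg] at h4
    subst h4
    have h5 : f = g := Nat.eq_of_mul_eq_mul_left (by positivity) h3
    subst h5
    rfl
  · rintro ⟨k, hk⟩
    obtain ⟨i, f, hf, rfl⟩ := Nat.exists_eq_two_pow_mul_odd hk.ne'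
    exact ⟨⟨(f, i), hf⟩, rfl⟩

/-- The moduli `4k` are parametrized by the odd part of `k` and the exponent of two. -/
lemma exists_equiv_moduli_four {a b : Cusp}
    (hM : ∀ c, c ∈ moduli a b ↔ ∃ k : ℕ, 0 < k ∧ c = (4 * k : ℕ)) :
    ∃ E : {p : ℕ × ℕ // Odd p.1} ≃ moduli a b,
      ∀ p, (E p : ℝ) = ((4 * (2 ^ p.1.2 * p.1.1) : ℕ) : ℝ) := by
  let ψ : {k : ℕ // 0 < k} → moduli a b := fun k =>
    ⟨((4 * k.1 : ℕ) : ℝ), (hM _).2 ⟨k.1, k.2, rfl⟩⟩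
  have hψ : Function.Bijective ψ := by
    constructor
    · rintro ⟨k, hk⟩ ⟨l, hl⟩ h
      have h1 : 4 * k = 4 * l := Nat.cast_injective (R := ℝ) (congrArg Subtype.val h)
      exact Subtype.ext (show k = l by omega)
    · rintro ⟨c, hc⟩
      obtain ⟨k, hk, rfl⟩ := (hM c).1 hc
      exact ⟨⟨k, hk⟩, rfl⟩
  exact ⟨(Equiv.ofBijective _ bijective_two_pow_mul_odd).trans (Equiv.ofBijective ψ hψ),
    fun p => rfl⟩

/-- The Dirichlet series over the moduli `4k = 2^(i+2) f` splits into its `2`-part and its odd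
part. -/
lemma hasSum_of_moduli_four {a b : Cusp} {y : ℝ} {n : ℤ} (hn : n ≠ 0)
    (hM : ∀ c, c ∈ moduli a b ↔ ∃ k : ℕ, 0 < k ∧ c = (4 * k : ℕ))
    (hK : ∀ k : ℕ, 0 < k → kloosterman a b 0 y (4 * k : ℕ) = thetaSum n k)
    {s : ℂ} (hs : 1 < s.re) :
    HasSum (fun c : moduli a b => kloosterman a b 0 y c / ((c : ℝ) : ℂ) ^ (2 * s))
      ((∑' f, oddGauss n s f) * twoSeries n ((2 : ℂ) ^ (2 * s))⁻¹) := by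
  have h2 := hasSum_twoSeries hn ((2 : ℂ) ^ (2 * s))⁻¹
  have hsum := summable_norm_oddGauss n hs
  have hsum2 : Summable fun p : ℕ × ℕ => oddGauss n s p.1 *
      (gaussTwo n (p.2 + 2) * ((2 : ℂ) ^ (2 * s))⁻¹ ^ (p.2 + 2)) :=
    summable_mul_of_summable_norm (f := oddGauss n s)
      (g := fun k => gaussTwo n (k + 2) * ((2 : ℂ) ^ (2 * s))⁻¹ ^ (k + 2)) hsum h2.summable.norm
  have hprod := HasSum.mul (f := oddGauss n s)
    (g := fun k => gaussTwo n (k + 2) * ((2 : ℂ) ^ (2 * s))⁻¹ ^ (k + 2)) hsum.of_norm.hasSum h2 hsum2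
  have hsupp : Function.support (fun p : ℕ × ℕ => oddGauss n s p.1 *
      (gaussTwo n (p.2 + 2) * ((2 : ℂ) ^ (2 * s))⁻¹ ^ (p.2 + 2))) ⊆ {p | Odd p.1} := by
    intro p hp
    by_contra hodd
    exact hp (by simp only [oddGauss, if_neg (show ¬ Odd p.1 from hodd), zero_mul])
  replace hprod := (hasSum_subtype_iff_of_support_subset hsupp).2 hprod
  obtain ⟨E, hE⟩ := exists_equiv_moduli_four hM
  rw [← E.hasSum_iff]
  refine hprod.congr_fun fun p => ?_
  obtain ⟨⟨f, i⟩, hf⟩ := p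
  replace hf : Odd f := hf
  have hk : 0 < 2 ^ i * f := Nat.mul_pos (by positivity) hf.pos
  have hpow : ((4 * (2 ^ i * f) : ℕ) : ℂ) ^ (2 * s) =
      (f : ℂ) ^ (2 * s) * ((2 : ℂ) ^ (2 * s)) ^ (i + 2) := by
    rw [show 4 * (2 ^ i * f) = f * 2 ^ (i + 2) by ring, Nat.cast_mul,
      Complex.natCast_mul_natCast_cpow, Nat.cast_pow, ← Complex.natCast_cpow_natCast_mul,
      mul_comm ((i + 2 : ℕ) : ℂ), Complex.cpow_mul_nat, Nat.cast_ofNat]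
  simp only [Function.comp_apply, hE]
  rw [hK _ hk, thetaSum_eq n i hf, Complex.ofReal_natCast, hpow, oddGauss, if_pos hf, inv_pow]
  ring

/-- The Dirichlet series over the moduli `2f`, `f` odd. -/
lemma hasSum_of_moduli_two {a b : Cusp} {y : ℝ} {n : ℤ} {C : ℂ}
    (hM : ∀ c, c ∈ moduli a b ↔ ∃ f : ℕ, Odd f ∧ c = (2 * f : ℕ))
    (hK : ∀ f : ℕ, Odd f → kloosterman a b 0 y (2 * f : ℕ) = C * gauss n f)
    {s : ℂ} (hs : 1 < s.re) :
    HasSum (fun c : moduli a b => kloosterman a b 0 y c / ((c : ℝ) : ℂ) ^ (2 * s))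
      ((∑' f, oddGauss n s f) * (C * ((2 : ℂ) ^ (2 * s))⁻¹)) := by
  have hsum := (summable_norm_oddGauss n hs).of_norm.hasSum.mul_right (C * ((2 : ℂ) ^ (2 * s))⁻¹)
  have hsupp : Function.support (fun f : ℕ => oddGauss n s f * (C * ((2 : ℂ) ^ (2 * s))⁻¹)) ⊆
      {f | Odd f} := by
    intro p hp
    by_contra hodd
    exact hp (by simp only [oddGauss, if_neg (show ¬ Odd p from hodd), zero_mul])
  rw [← hasSum_subtype_iff_of_support_subset hsupp] at hsum
  let φ : {f : ℕ | Odd f} → moduli a b := fun f => ⟨((2 * f.1 : ℕ) : ℝ), (hM _).2 ⟨_, f.2, rfl⟩⟩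
  have hφ : Function.Bijective φ := by
    constructor
    · rintro ⟨f, hf⟩ ⟨g, hg⟩ h
      have h1 : 2 * f = 2 * g := Nat.cast_injective (R := ℝ) (congrArg Subtype.val h)
      exact Subtype.ext (show f = g by omega)
    · rintro ⟨c, hc⟩
      obtain ⟨f, hf, rfl⟩ := (hM c).1 hc
      exact ⟨⟨f, hf⟩, rfl⟩
  rw [← (Equiv.ofBijective φ hφ).hasSum_iff]
  refine hsum.congr_fun ?_
  rintro ⟨f, hf⟩
  change kloosterman a b 0 y (2 * f : ℕ) / (((2 * f : ℕ) : ℝ) : ℂ) ^ (2 * s) =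
    oddGauss n s f * (C * ((2 : ℂ) ^ (2 * s))⁻¹)
  rw [hK f hf, Complex.ofReal_natCast, Nat.cast_mul, Complex.natCast_mul_natCast_cpow,
    oddGauss, if_pos (show Odd f from hf), Nat.cast_ofNat]
  ring

/-! ### The Eisenstein coefficients -/

/-- A coefficient whose Dirichlet series is the odd Gauss sum series times a holomorphic function
of `4^{-s}` is given on `Re s ≥ 1/2` by the explicit continuation. -/
lemma phi_eq_oddCont_mul {a b : Cusp} {y : ℝ} {d : ℤ} (hd : IsFundamentalDiscriminant d) (j : ℕ)
    {w : ℕ} (hw : Odd w) {E : ℂ → ℂ} (hE : Differentiable ℂ E)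
    (hsum : ∀ s : ℂ, 1 < s.re →
      HasSum (fun c : moduli a b => kloosterman a b 0 y c / ((c : ℝ) : ℂ) ^ (2 * s))
        ((∑' f, oddGauss ((2 ^ j * w : ℕ) ^ 2 * d) s f) * E ((2 : ℂ) ^ (2 * s))⁻¹)) :
    IsContinuation a b y (phi a b y) ∧ ∀ s : ℂ, 1 / 2 ≤ s.re → s ≠ 3 / 4 →
      AnalyticAt ℂ (phi a b y) s ∧
        phi a b y s = oddCont d w s * E ((2 : ℂ) ^ (2 * s))⁻¹ := by
  have hY : Differentiable ℂ fun s : ℂ => E ((2 : ℂ) ^ (2 * s))⁻¹ := hE.comp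
    ((two_cpow_differentiable (fun s => 2 * s) (by fun_prop)).inv fun s => by
      simp [Complex.cpow_eq_zero_iff])
  have han : ∀ s : ℂ, 1 / 2 ≤ s.re → s ≠ 3 / 4 →
      AnalyticAt ℂ (fun s => oddCont d w s * E ((2 : ℂ) ^ (2 * s))⁻¹) s := fun s h1 h2 =>
    (analyticAt_oddCont d w h1 h2).fun_mul (hY.analyticAt s)
  obtain ⟨h1, h2⟩ := isContinuation_phi (a := a) (b := b) (y := y)
    (M := fun s => oddCont d w s * E ((2 : ℂ) ^ (2 * s))⁻¹)
    (fun s _ => (meromorphicAt_oddCont d w s).fun_mul (hY.analyticAt s).meromorphicAt) (σ := 1)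
    (fun s hs => han s (by linarith) (by rintro rfl; norm_num at hs)) (fun s hs => by
      have h := hsum s hs
      rwa [tsum_oddGauss_eq_oddCont hd j hw hs] at h)
  exact ⟨h1, fun s hs hs' => h2 s (han s hs hs')⟩

lemma differentiable_twoSeries (n : ℤ) : Differentiable ℂ (twoSeries n) := by
  have h : twoSeries n = fun Y => ∑ k ∈ Finset.range (n.natAbs + 2),
      gaussTwo n (k + 2) * Y ^ (k + 2) := rfl
  rw [h]
  fun_prop

/-- The factor at two in the coefficient between the cusps `0` and `cuspOf n`. -/
noncomputable def cuspSeries (n : ℤ) (Y : ℂ) : ℂ :=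
  if n % 4 = 0 then twoSeries (n / 4) Y else e (n / 8) * Y

lemma differentiable_cuspSeries (n : ℤ) : Differentiable ℂ (cuspSeries n) := by
  have h : cuspSeries n = fun Y => if n % 4 = 0 then twoSeries (n / 4) Y else e (n / 8) * Y := rfl
  rw [h]
  split_ifs
  · exact differentiable_twoSeries _
  · fun_prop

lemma twoFactor_eq_cuspSeries (n : ℤ) (Y : ℂ) :
    twoFactor n Y = 1 + (1 - Complex.I) * cuspSeries n Y := by
  rw [twoFactor, cuspSeries]
  split_ifs <;> ring

lemma oddGauss_four_mul (N : ℤ) (s : ℂ) (f : ℕ) : oddGauss (4 * N) s f = oddGauss N s f := by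
  rw [oddGauss, oddGauss]
  split_ifs with hf
  · rw [gauss_four_mul N hf]
  · rfl

lemma hasSum_infinity_infinity {n : ℤ} (hn : n ≠ 0) {s : ℂ} (hs : 1 < s.re) :
    HasSum (fun c : moduli .infinity .infinity =>
        kloosterman .infinity .infinity 0 n c / ((c : ℝ) : ℂ) ^ (2 * s))
      ((∑' f, oddGauss n s f) * twoSeries n ((2 : ℂ) ^ (2 * s))⁻¹) :=
  hasSum_of_moduli_four hn moduli_infinity_infinity
    (fun _ hk => kloosterman_infinity_infinity n hk) hs

lemma hasSum_zero_infinity (n : ℤ) {s : ℂ} (hs : 1 < s.re) :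
    HasSum (fun c : moduli .zero .infinity =>
        kloosterman .zero .infinity 0 n c / ((c : ℝ) : ℂ) ^ (2 * s))
      ((∑' f, oddGauss n s f) * (Complex.I * ((2 : ℂ) ^ (2 * s))⁻¹)) :=
  hasSum_of_moduli_two moduli_zero_infinity (fun _ hf => kloosterman_zero_infinity n hf) hs

lemma hasSum_infinity_cuspOf {n : ℤ} (hn4 : n % 4 = 0 ∨ n % 4 = 1) {s : ℂ} (hs : 1 < s.re) :
    HasSum (fun c : moduli .infinity (cuspOf n) =>
        kloosterman .infinity (cuspOf n) 0 ((n : ℝ) / 4 + kappa (cuspOf n)) c /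
          ((c : ℝ) : ℂ) ^ (2 * s))
      ((∑' f, oddGauss n s f) * ((2 : ℂ) ^ (2 * s))⁻¹) := by
  rcases hn4 with h | h
  · obtain ⟨N, rfl⟩ : (4 : ℤ) ∣ n := Int.dvd_of_emod_eq_zero h
    have hy : ((4 * N : ℤ) : ℝ) / 4 + kappa .zero = N := by rw [kappa]; push_cast; ring
    rw [cuspOf, if_pos h, hy]
    have := hasSum_of_moduli_two (C := 1) (n := 4 * N) moduli_infinity_zero (fun f hf => by
      rw [one_mul, gauss_four_mul N hf]; exact kloosterman_infinity_zero N hf) hs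
    rwa [one_mul] at this
  · rw [cuspOf, if_neg (by omega), kappa]
    have := hasSum_of_moduli_two (C := 1) moduli_infinity_half (fun f hf => by
      rw [one_mul]; exact kloosterman_infinity_half h hf) hs
    rwa [one_mul] at this

lemma hasSum_zero_cuspOf {n : ℤ} (hn : n ≠ 0) (hn4 : n % 4 = 0 ∨ n % 4 = 1) {s : ℂ}
    (hs : 1 < s.re) :
    HasSum (fun c : moduli .zero (cuspOf n) =>
        kloosterman .zero (cuspOf n) 0 ((n : ℝ) / 4 + kappa (cuspOf n)) c /
          ((c : ℝ) : ℂ) ^ (2 * s))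
      ((∑' f, oddGauss n s f) * cuspSeries n ((2 : ℂ) ^ (2 * s))⁻¹) := by
  rcases hn4 with h | h
  · rw [cuspSeries, if_pos h]
    obtain ⟨N, rfl⟩ : (4 : ℤ) ∣ n := Int.dvd_of_emod_eq_zero h
    have hy : ((4 * N : ℤ) : ℝ) / 4 + kappa .zero = N := by rw [kappa]; push_cast; ring
    rw [cuspOf, if_pos h, hy, Int.mul_ediv_cancel_left _ (by norm_num)]
    simp only [oddGauss_four_mul]
    exact hasSum_of_moduli_four (by omega) moduli_zero_zero
      (fun _ hk => kloosterman_zero_zero N hk) hs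
  · rw [cuspSeries, if_neg (by omega), cuspOf, if_neg (by omega), kappa]
    exact hasSum_of_moduli_two moduli_zero_half (fun f hf => kloosterman_zero_half h hf) hs

lemma two_cpow_inv_critical (r : ℝ) :
    ((2 : ℂ) ^ (2 * (1 / 2 + Complex.I * r)))⁻¹ = (2 * (4 : ℂ) ^ (Complex.I * r))⁻¹ := by
  have h4 : (4 : ℂ) ^ (Complex.I * r) = (2 : ℂ) ^ (2 * (Complex.I * r)) := by
    have := Complex.natCast_cpow_natCast_mul 2 2 (Complex.I * r)
    rw [show (4 : ℂ) = ((2 : ℕ) : ℂ) ^ 2 by norm_num, ← this]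
    norm_num
  rw [h4, show 2 * (1 / 2 + Complex.I * r) = 1 + 2 * (Complex.I * r) by ring,
    Complex.cpow_add _ _ two_ne_zero, Complex.cpow_one]

/-- On the critical line `4^{-s}` has absolute value `1/2`. -/
lemma conj_two_cpow_inv_mul_self (r : ℝ) :
    (starRingEnd ℂ) ((2 : ℂ) ^ (2 * (1 / 2 + Complex.I * r)))⁻¹ *
      ((2 : ℂ) ^ (2 * (1 / 2 + Complex.I * r)))⁻¹ = 1 / 4 := by
  have h : ‖(2 : ℂ) ^ (2 * (1 / 2 + Complex.I * r))‖ = 2 := by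
    have := Complex.norm_natCast_cpow_of_pos two_pos (2 * (1 / 2 + Complex.I * r))
    rw [Nat.cast_ofNat] at this
    rw [this]
    simp
  rw [Complex.conj_mul', norm_inv, h]
  norm_num

/-- The combination of the coefficients at the cusps `∞` and `0` leaves only the factors at two
`twoFactor`; here `Y = 4^{-s}` on the critical line. -/
lemma combination_identity {Dm Dn Y qm En : ℂ} (hY : (starRingEnd ℂ) Y * Y = 1 / 4) :
    (starRingEnd ℂ) (Dm * ((1 + Complex.I) * Y ^ 2 * (2 * qm - 1))) *
        (Dn * ((1 + Complex.I) * Y ^ 2 * (2 * (1 + (1 - Complex.I) * En) - 1)) +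
          (1 + Complex.I) * Y * (Dn * Y)) +
      (starRingEnd ℂ) (Dm * (Complex.I * Y)) *
        (Dn * (Complex.I * Y) + (1 + Complex.I) * Y * (Dn * En)) =
      1 / 2 * (starRingEnd ℂ) (Dm * qm) * (Dn * (1 + (1 - Complex.I) * En)) := by
  have hI := Complex.I_sq
  simp only [map_mul, map_add, map_sub, map_one, map_pow, map_ofNat, Complex.conj_I]
  generalize (starRingEnd ℂ) Y = Y' at *
  generalize (starRingEnd ℂ) Dm = D at *
  generalize (starRingEnd ℂ) qm = q at *
  have h2 : Y' ^ 2 * Y ^ 2 = 1 / 16 := by rw [← mul_pow, hY]; norm_num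
  linear_combination 4 * D * Dn * (1 + (1 - Complex.I) * En) * (2 * q - 1) * h2 +
    D * Dn * (1 + (1 - Complex.I) * En) * hY -
    (D * Dn * Y' ^ 2 * Y ^ 2 * 2 * (1 + (1 - Complex.I) * En) * (2 * q - 1) +
      D * Dn * Y' * Y * (1 + En)) * hI

/-- The completed odd Gauss sum series at `1/2 + ir` in terms of `frakS`. -/
lemma oddCont_mul_twoFactor_critical {d : ℤ} (hd : IsFundamentalDiscriminant d) (j : ℕ) {w : ℕ}
    (hw : Odd w) (r : ℝ) :
    oddCont d w (1 / 2 + Complex.I * r) * twoFactor ((2 ^ j * w : ℕ) ^ 2 * d)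
        ((2 : ℂ) ^ (2 * (1 / 2 + Complex.I * r)))⁻¹ =
      dirichletL d (1 / 2 + Complex.I * (2 * r : ℝ)) *
        ((2 ^ j * w : ℕ) : ℂ) ^ (-(Complex.I * (2 * r : ℝ))) *
          frakS d (2 ^ j * w) (Complex.I * (2 * r : ℝ)) *
        zetaInv (1 + 4 * Complex.I * r) := by
  have hw0 : 2 ^ j * w ≠ 0 := mul_ne_zero (by positivity) hw.pos.ne'
  rw [oddCont_mul_twoFactor hd j hw (by simp),
    show 2 * (1 / 2 + Complex.I * r) - 1 / 2 = 1 / 2 + Complex.I * (2 * r : ℝ) by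
      push_cast; ring,
    show 4 * (1 / 2 + Complex.I * r) - 1 = 1 + 4 * Complex.I * r by ring,
    squarePart_eq_frakS d hw0]
  ring

lemma critical_ne_three_quarters (r : ℝ) : (1 / 2 + Complex.I * r : ℂ) ≠ 3 / 4 := fun h => by
  have := congrArg Complex.re h
  norm_num at this

lemma conj_zetaInv_mul_self {r : ℝ} (hr : r ≠ 0) :
    (starRingEnd ℂ) (zetaInv (1 + 4 * Complex.I * r)) * zetaInv (1 + 4 * Complex.I * r) =
      1 / (‖riemannZeta (1 + 4 * Complex.I * r)‖ : ℂ) ^ 2 := by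
  have h1 : (1 + 4 * Complex.I * r : ℂ) ≠ 1 := fun h => hr (by simpa using h)
  rw [zetaInv, if_neg h1, Complex.conj_mul', norm_inv]
  push_cast
  rw [inv_pow, one_div]

end EisPlus

open EisPlus in
theorem proposition5 (m n d' d : ℤ) (v w : ℕ) (hv : 0 < v) (hw : 0 < w)
    (hm4 : m % 4 = 0 ∨ m % 4 = 1) (hn4 : n % 4 = 0 ∨ n % 4 = 1)
    (hd' : IsFundamentalDiscriminant d') (hd : IsFundamentalDiscriminant d)
    (hm : m = (v : ℤ) ^ 2 * d') (hn : n = (w : ℤ) ^ 2 * d) (r : ℝ) :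
    -- the coefficients are continued meromorphically and are regular at `1/2 + ir`
    (∀ c ∈ ({Cusp.infinity, Cusp.zero} : Finset Cusp),
      ∀ p ∈ ({(Cusp.infinity, (m : ℝ)), (Cusp.infinity, (n : ℝ)),
          (cuspOf n, (n : ℝ) / 4 + kappa (cuspOf n))} : Set (Cusp × ℝ)),
        IsContinuation c p.1 p.2 (phi c p.1 p.2) ∧
          AnalyticAt ℂ (phi c p.1 p.2) (1 / 2 + Complex.I * r)) ∧
    -- the identity; at `r = 0` the factor `1 / |ζ(1 + 4ir)|²` is `0`
    ∑ c ∈ ({Cusp.infinity, Cusp.zero} : Finset Cusp),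
        (starRingEnd ℂ) (phi c .infinity m (1 / 2 + Complex.I * r)) *
          (phi c .infinity n (1 / 2 + Complex.I * r) +
            (1 + Complex.I) / (2 * (4 : ℂ) ^ (Complex.I * r)) *
              phi c (cuspOf n) ((n : ℝ) / 4 + kappa (cuspOf n)) (1 / 2 + Complex.I * r)) =
      if r = 0 then 0
      else
        dirichletL d' (1 / 2 - 2 * Complex.I * r) * dirichletL d (1 / 2 + 2 * Complex.I * r) /
            (2 * (‖riemannZeta (1 + 4 * Complex.I * r)‖ : ℂ) ^ 2) *
          ((v : ℂ) / (w : ℂ)) ^ (2 * Complex.I * r) *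
          frakS d' v (2 * Complex.I * r) * frakS d w (2 * Complex.I * r) := by
  -- the odd parts of `v` and `w` enter the odd Gauss sums, the powers of two only `twoFactor`
  obtain ⟨i, v', hv', rfl⟩ := Nat.exists_eq_two_pow_mul_odd hv.ne'
  obtain ⟨j, w', hw', rfl⟩ := Nat.exists_eq_two_pow_mul_odd hw.ne'
  have hm0 : m ≠ 0 := by
    rw [hm]; exact mul_ne_zero (pow_ne_zero _ (by exact_mod_cast hv.ne')) hd'.ne_zero
  have hn0 : n ≠ 0 := by
    rw [hn]; exact mul_ne_zero (pow_ne_zero _ (by exact_mod_cast hw.ne')) hd.ne_zero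
  have hre : 1 / 2 ≤ (1 / 2 + Complex.I * r : ℂ).re := by simp
  have hne := critical_ne_three_quarters r
  have hI : Differentiable ℂ fun Y : ℂ => Complex.I * Y := by fun_prop
  obtain ⟨c1, p1⟩ := phi_eq_oddCont_mul hd' i hv' (differentiable_twoSeries m) (fun s hs => by
    have h := hasSum_infinity_infinity hm0 hs
    rwa [← hm])
  obtain ⟨c2, p2⟩ := phi_eq_oddCont_mul hd' i hv' hI (fun s hs => by
    have h := hasSum_zero_infinity m hs
    rwa [← hm])
  obtain ⟨c3, p3⟩ := phi_eq_oddCont_mul hd j hw' (differentiable_twoSeries n) (fun s hs => by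
    have h := hasSum_infinity_infinity hn0 hs
    rwa [← hn])
  obtain ⟨c4, p4⟩ := phi_eq_oddCont_mul hd j hw' hI (fun s hs => by
    have h := hasSum_zero_infinity n hs
    rwa [← hn])
  obtain ⟨c5, p5⟩ := phi_eq_oddCont_mul hd j hw' differentiable_id (fun s hs => by
    have h := hasSum_infinity_cuspOf hn4 hs
    rwa [← hn])
  obtain ⟨c6, p6⟩ := phi_eq_oddCont_mul hd j hw' (differentiable_cuspSeries n) (fun s hs => by
    have h := hasSum_zero_cuspOf hn0 hn4 hs
    rwa [← hn])
  obtain ⟨a1, q1⟩ := p1 _ hre hne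
  obtain ⟨a2, q2⟩ := p2 _ hre hne
  obtain ⟨a3, q3⟩ := p3 _ hre hne
  obtain ⟨a4, q4⟩ := p4 _ hre hne
  obtain ⟨a5, q5⟩ := p5 _ hre hne
  obtain ⟨a6, q6⟩ := p6 _ hre hne
  refine ⟨fun c hc p hp => ?_, ?_⟩
  · simp only [Finset.mem_insert, Finset.mem_singleton] at hc
    simp only [Set.mem_insert_iff, Set.mem_singleton_iff] at hp
    rcases hc with rfl | rfl <;> rcases hp with rfl | rfl | rfl
    · exact ⟨c1, a1⟩
    · exact ⟨c3, a3⟩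
    · exact ⟨c5, a5⟩
    · exact ⟨c2, a2⟩
    · exact ⟨c4, a4⟩
    · exact ⟨c6, a6⟩
  have hfac : (1 + Complex.I) / (2 * (4 : ℂ) ^ (Complex.I * r)) =
      (1 + Complex.I) * ((2 : ℂ) ^ (2 * (1 / 2 + Complex.I * r)))⁻¹ := by
    rw [two_cpow_inv_critical, div_eq_mul_inv]
  rw [Finset.sum_pair (by decide), hfac, q1, q2, q3, q4, q5, q6,
    twoSeries_eq_twoFactor hm0 hm4, twoSeries_eq_twoFactor hn0 hn4, twoFactor_eq_cuspSeries n, id,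
    combination_identity (conj_two_cpow_inv_mul_self r), ← twoFactor_eq_cuspSeries, hm, hn,
    oddCont_mul_twoFactor_critical hd' i hv', oddCont_mul_twoFactor_critical hd j hw']
  split_ifs with hr
  -- at `r = 0` both factors contain `zetaInv 1 = 0`
  · simp [hr, zetaInv]
  have hz1 : (1 / 2 + Complex.I * (2 * r : ℝ) : ℂ) ≠ 1 := fun h => by
    have := congrArg Complex.re h
    norm_num at this
  have hL : (starRingEnd ℂ) (dirichletL d' (1 / 2 + Complex.I * (2 * r : ℝ))) =
      dirichletL d' (1 / 2 - 2 * Complex.I * r) := by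
    rw [← dirichletL_conj hd'.ne_zero hd'.mod_four hz1]
    congr 1
    simp [Complex.ext_iff]
  have hdiv : (((2 ^ i * v' : ℕ) : ℂ) / ((2 ^ j * w' : ℕ) : ℂ)) ^ (Complex.I * (2 * r : ℝ)) =
      ((2 ^ i * v' : ℕ) : ℂ) ^ (Complex.I * (2 * r : ℝ)) *
        ((2 ^ j * w' : ℕ) : ℂ) ^ (-(Complex.I * (2 * r : ℝ))) := by
    have h := Complex.div_cpow_ofReal_nonneg (a := (2 ^ i * v' : ℕ)) (b := (2 ^ j * w' : ℕ))
      (by positivity) (by positivity) (Complex.I * (2 * r : ℝ))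
    simp only [Complex.ofReal_natCast] at h
    rw [h, Complex.cpow_neg, div_eq_mul_inv]
  have hpow : (starRingEnd ℂ) (((2 ^ i * v' : ℕ) : ℂ) ^ (-(Complex.I * (2 * r : ℝ)))) =
      ((2 ^ i * v' : ℕ) : ℂ) ^ (Complex.I * (2 * r : ℝ)) := by
    rw [← conj_natCast_cpow_I_mul, Complex.conj_conj]
  have hz := conj_zetaInv_mul_self hr
  rw [map_mul, map_mul, map_mul, hL, hpow, conj_frakS,
    show 2 * Complex.I * (r : ℂ) = Complex.I * (2 * r : ℝ) by push_cast; ring, hdiv]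
  linear_combination (1 / 2 * dirichletL d' (1 / 2 - Complex.I * (2 * r : ℝ)) *
    ((2 ^ i * v' : ℕ) : ℂ) ^ (Complex.I * (2 * r : ℝ)) *
    frakS d' (2 ^ i * v') (Complex.I * (2 * r : ℝ)) *
    dirichletL d (1 / 2 + Complex.I * (2 * r : ℝ)) *
    ((2 ^ j * w' : ℕ) : ℂ) ^ (-(Complex.I * (2 * r : ℝ))) *
    frakS d (2 ^ j * w') (Complex.I * (2 * r : ℝ))) * hz
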